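/- Let $n\ge 1$, let $m\ge 1$ be odd, and let $M$ be a positive definite symmetric integral $m\times m$ matrix. Write $\sigma$ for the trace, $\mathbb H_n$ for the Siegel upper half plane, $\mathbb H_{n,m}=\mathbb H_n\times\mathbb C^{(m,n)}$, and $J(g,\Omega)=C\Omega+D$, $g\cdot\Omega=(A\Omega+B)(C\Omega+D)^{-1}$ for $g=\begin{pmatrix}A&B\\C&D\end{pmatrix}\in G=Sp(n,\mathbb R)$. *The groups.* Let $\det^{1/2}$ be the holomorphic square root of $\det$ on $\{S\in\mathbb C^{(n,n)}: S={}^tS,\ \mathrm{Re}\,S>0\}$ that is positive on real $S$, and put $$\varepsilon(g;\Omega',\Omega)=\det{}^{-\frac12}\Big(\tfrac{g\cdot\Omega'-\overline{g\cdot\Omega}}{2i}\Big)\det{}^{\frac12}\Big(\tfrac{\Omega'-\overline\Omega}{2i}\Big)|\det J(g,\Omega')|^{-\frac12}|\det J(g,\Omega)|^{-\frac12}.$$ Let $G_*$ be the group of pairs $(g,\epsilon)\in G\times\mathbb C$ with $\epsilon^2=|\det J(g,iI_n)|/\det J(g,iI_n)$ and product $(g_1,\epsilon_1)(g_2,\epsilon_2)=(g_1g_2,\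 \epsilon_1\epsilon_2\,\varepsilon(g_1;iI_n,g_2\cdot iI_n))$. Let $H^{(n,m)}_{\mathbb R}$ be the Heisenberg group of triples $(\lambda,\mu;\kappa)$, $\lambda,\mu\in\mathbb R^{(m,n)}$, $\kappa\in\mathbb R^{(m,m)}$, $\kappa+\mu\,{}^t\lambda$ symmetric, with product $(\lambda,\mu;\kappa)\circ(\lambda',\mu';\kappa')=(\lambda+\lambda',\mu+\mu';\kappa+\kappa'+\lambda\,{}^t\mu'-\mu\,{}^t\lambda')$. Let $G^J_*=G_*\ltimes H^{(n,m)}_{\mathbb R}$, with product $(a,h)(a',h')=(aa',(h\cdot g')\circ h')$ for $a'=(g',\epsilon')$, where $(\lambda,\mu;\kappa)\cdot g'=((\lambda,\mu)g';\kappa)$. For $\tilde g_*=((g,\epsilon),(\lambda,\mu;\kappa))\in G^J_*$ put $\tilde g_*\cdot(\Omega,Z)=(g\cdot\Omega,(Z+\lambda\Omega+\mu)(C\Omega+D)^{-1})$, $J_{1/2}((g,\epsilon),\Omega)=\epsilon^{-1}\varepsilon(g;\Omega,iI_n)|\det J(g,\Omega)|^{1/2}$ and $$J^*_M(\tilde g_*,(\Omega,Z))=e^{\pi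 i\sigma(M(Z+\lambda\Omega+\mu)(C\Omega+D)^{-1}C\,{}^t(Z+\lambda\Omega+\mu))}\,e^{-\pi i\sigma(M(\lambda\Omega\,{}^t\lambda+2\lambda\,{}^tZ+\kappa+\mu\,{}^t\lambda))}\,J_{1/2}((g,\epsilon),\Omega)^m.$$ *The representation.* There is exactly one homomorphism $\omega_M$ from $G^J_*$ to the unitary group of $L^2(\mathbb R^{(m,n)})$ with the following properties; it is the Schrödinger–Weil representation with central character $\kappa\mapsto e^{\pi i\sigma(M\kappa)}$. * On $H^{(n,m)}_{\mathbb R}$: $(\omega_M(\lambda,\mu;\kappa)f)(x)=e^{\pi i\sigma(M(\kappa+\mu\,{}^t\lambda+2x\,{}^t\mu))}f(x+\lambda)$. * For $(g,\epsilon)\in G_*$ with $g=\begin{pmatrix}I&b\\0&I\end{pmatrix}$, $b={}^tb$: $(\omega_M(g,\epsilon)f)(x)=\epsilon^m e^{\pi i\sigma(Mxb\,{}^tx)}f(x)$. * For $(g,\epsilon)\in G_*$ with $g=\begin{pmatrix}{}^t\alpha&0\\0&\alpha^{-1}\end{pmatrix}$, $\alpha\in GL(n,\mathbb R)$: $(\omega_M(g,\epsilon)f)(x)=\epsilon^m|\det\alpha|^{m/2}f(x\,{}^t\alpha)$.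 * For $(g,\epsilon)\in G_*$ with $g=\begin{pmatrix}0&-I\\I&0\end{pmatrix}$ and $f\in L^1\cap L^2$: $(\omega_M(g,\epsilon)f)(x)=\epsilon^m(\det M)^{n/2}\int_{\mathbb R^{(m,n)}}e^{-2\pi i\sigma(My\,{}^tx)}f(y)\,dy$. *The theorem.* The map $\mathscr F^{(M)}:\mathbb H_{n,m}\to L^2(\mathbb R^{(m,n)})$, $\mathscr F^{(M)}_{\Omega,Z}(x)=e^{\pi i\sigma(M(x\Omega\,{}^tx+2x\,{}^tZ))}$, is a covariant map for $\omega_M$ and $J^*_M$, that is, $$\omega_M(\tilde g_*)\,\mathscr F^{(M)}_{\Omega,Z}=J^*_M(\tilde g_*,(\Omega,Z))^{-1}\,\mathscr F^{(M)}_{\tilde g_*\cdot(\Omega,Z)}\qquad\text{for all }\tilde g_*\in G^J_*,\ (\Omega,Z)\in\mathbb H_{n,m}.$$ -/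

import Mathlib

open Matrix MeasureTheory Complex
open scoped Real

namespace JacobiWeil

section DetSqrt

attribute [local instance] Matrix.normedAddCommGroup Matrix.normedSpace

/-- The space of complex symmetric `n × n` matrices with positive definite real part. -/
def symmRePos (n : ℕ) : Set (Matrix (Fin n) (Fin n) ℂ) :=
  {S | S.IsSymm ∧ (S.map Complex.re).PosDef}

theorem re_star_dotProduct_pos {n : ℕ} {S : Matrix (Fin n) (Fin n) ℂ} (hS : S ∈ symmRePos n)
    {x : Fin n → ℂ} (hx : x ≠ 0) : 0 < (star x ⬝ᵥ S *ᵥ x).re := by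
  obtain ⟨hs, hp⟩ := hS
  set R := S.map Complex.re
  let a : Fin n → ℝ := fun i => (x i).re
  let b : Fin n → ℝ := fun i => (x i).im
  have hT : ∑ i, ∑ j, (S i j).im * (a i * b j) = ∑ i, ∑ j, (S i j).im * (b i * a j) := by
    rw [Finset.sum_comm]
    refine Finset.sum_congr rfl fun i _ => Finset.sum_congr rfl fun j _ => ?_
    rw [hs.apply]; ring
  have key : (star x ⬝ᵥ S *ᵥ x).re = a ⬝ᵥ R *ᵥ a + b ⬝ᵥ R *ᵥ b := by
    have h1 : (star x ⬝ᵥ S *ᵥ x).re = ∑ i, ∑ j, ((S i j).re * (a i * a j) + (S i j).re * (b i * b j)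
        - ((S i j).im * (a i * b j) - (S i j).im * (b i * a j))) := by
      simp only [dotProduct, mulVec, Finset.mul_sum, Complex.re_sum]
      refine Finset.sum_congr rfl fun i _ => Finset.sum_congr rfl fun j _ => ?_
      simp [a, b]; ring
    rw [h1]
    simp only [Finset.sum_add_distrib, Finset.sum_sub_distrib, hT, sub_self, sub_zero]
    simp only [dotProduct, mulVec, Finset.mul_sum, R, Matrix.map_apply]
    congr 1 <;> exact Finset.sum_congr rfl fun i _ => Finset.sum_congr rfl fun j _ => by ring
  rw [key]
  have ha : 0 ≤ a ⬝ᵥ R *ᵥ a := by simpa using hp.posSemidef.dotProduct_mulVec_nonneg a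
  have hb : 0 ≤ b ⬝ᵥ R *ᵥ b := by simpa using hp.posSemidef.dotProduct_mulVec_nonneg b
  by_cases h0 : a = 0
  · have hb0 : b ≠ 0 := by
      rintro hb0
      apply hx
      ext i
      exact Complex.ext (congrFun h0 i) (congrFun hb0 i)
    have : 0 < b ⬝ᵥ R *ᵥ b := by simpa using hp.dotProduct_mulVec_pos hb0
    linarith
  · have : 0 < a ⬝ᵥ R *ᵥ a := by simpa using hp.dotProduct_mulVec_pos h0
    linarith

theorem det_ne_zero_of_mem {n : ℕ} {S : Matrix (Fin n) (Fin n) ℂ} (hS : S ∈ symmRePos n) :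
    S.det ≠ 0 := by
  intro h
  obtain ⟨v, hv, hv0⟩ := Matrix.exists_mulVec_eq_zero_iff.mpr h
  have := re_star_dotProduct_pos hS hv
  simp [hv0] at this

theorem submatrix_mem {n : ℕ} {S : Matrix (Fin (n + 1)) (Fin (n + 1)) ℂ}
    (hS : S ∈ symmRePos (n + 1)) : S.submatrix Fin.succ Fin.succ ∈ symmRePos n := by
  refine ⟨hS.1.submatrix _, ?_⟩
  have := hS.2.submatrix (e := (Fin.succ : Fin n → Fin (n + 1))) (Fin.succ_injective n)
  exact this

theorem re_det_div_pos {n : ℕ} {S : Matrix (Fin (n + 1)) (Fin (n + 1)) ℂ}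
    (hS : S ∈ symmRePos (n + 1)) :
    0 < (S.det / (S.submatrix Fin.succ Fin.succ).det).re := by
  have hd := det_ne_zero_of_mem hS
  have hu : IsUnit S.det := isUnit_iff_ne_zero.mpr hd
  let y : Fin (n + 1) → ℂ := S⁻¹ *ᵥ Pi.single 0 1
  have hSy : S *ᵥ y = Pi.single 0 1 := by
    simp only [y, Matrix.mulVec_mulVec, Matrix.mul_nonsing_inv _ hu, Matrix.one_mulVec]
  have hy : y ≠ 0 := by
    intro h
    rw [h] at hSy
    have := congrFun hSy 0
    simp at this
  have h1 := re_star_dotProduct_pos hS hy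
  rw [hSy] at h1
  have h2 : y 0 = (S.submatrix Fin.succ Fin.succ).det / S.det := by
    simp only [y, Matrix.mulVec_single_one, Matrix.col_apply]
    rw [Matrix.inv_def, Matrix.smul_apply, Matrix.adjugate_fin_succ_eq_det_submatrix]
    simp [Ring.inverse_eq_inv', div_eq_inv_mul]
  have h3 : 0 < (y 0).re := by simpa using h1
  rw [← inv_div, ← h2, Complex.inv_re]
  have : y 0 ≠ 0 := by
    intro h; rw [h] at h3; simp at h3
  exact div_pos h3 (Complex.normSq_pos.mpr this)

theorem differentiable_det (n : ℕ) :
    Differentiable ℂ (fun S : Matrix (Fin n) (Fin n) ℂ => S.det) := by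
  have h : ∀ i j, Differentiable ℂ (fun S : Matrix (Fin n) (Fin n) ℂ => S i j) := fun i j =>
    (differentiable_apply (𝕜 := ℂ) (F' := fun _ => ℂ) j).comp
      (differentiable_apply (𝕜 := ℂ) (F' := fun _ => Fin n → ℂ) i)
  simp only [Matrix.det_apply']
  fun_prop

/-- `φ` is a holomorphic branch of `det ^ (1 / 2)` on the (convex) space `symmRePos n`,
positive on the real matrices of that space. -/
structure IsDetSqrt (n : ℕ) (φ : Matrix (Fin n) (Fin n) ℂ → ℂ) : Prop where
  holomorphic : DifferentiableOn ℂ φ (symmRePos n)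
  sq : ∀ S ∈ symmRePos n, φ S ^ 2 = S.det
  real : ∀ P : Matrix (Fin n) (Fin n) ℝ, P.PosDef →
    φ (P.map Complex.ofReal) = (Real.sqrt P.det : ℂ)

theorem exists_isDetSqrt (n : ℕ) : ∃ φ, IsDetSqrt n φ := by
  induction n with
  | zero =>
    refine ⟨fun _ => 1, differentiableOn_const _, fun S _ => by simp, fun P _ => by simp⟩
  | succ n ih =>
    obtain ⟨φ, hφ⟩ := ih
    let sub : Matrix (Fin (n + 1)) (Fin (n + 1)) ℂ → Matrix (Fin n) (Fin n) ℂ :=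
      fun S => S.submatrix Fin.succ Fin.succ
    have hsub : Differentiable ℂ sub := by
      have h : ∀ i j, Differentiable ℂ (fun S : Matrix (Fin (n+1)) (Fin (n+1)) ℂ => S i j) :=
        fun i j => (differentiable_apply (𝕜 := ℂ) (F' := fun _ => ℂ) j).comp
          (differentiable_apply (𝕜 := ℂ) (F' := fun _ => Fin (n+1) → ℂ) i)
      refine (differentiable_pi (𝕜 := ℂ) (F' := fun _ => Fin n → ℂ)).mpr fun i => ?_
      refine (differentiable_pi (𝕜 := ℂ) (F' := fun _ => ℂ)).mpr fun j => ?_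
      exact h i.succ j.succ
    refine ⟨fun S => φ (sub S) * (S.det / (sub S).det) ^ (1 / 2 : ℂ), ?_, ?_, ?_⟩
    · refine (hφ.holomorphic.comp hsub.differentiableOn fun S hS => submatrix_mem hS).mul ?_
      refine DifferentiableOn.cpow_const ?_ ?_
      · have h1 : DifferentiableOn ℂ (fun S => (sub S).det) (symmRePos (n + 1)) :=
          ((differentiable_det n).comp hsub).differentiableOn
        have h2 : ∀ S ∈ symmRePos (n + 1), (sub S).det ≠ 0 := fun S hS =>
          det_ne_zero_of_mem (submatrix_mem hS)
        simp only [div_eq_mul_inv]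
        exact (differentiable_det (n + 1)).differentiableOn.fun_mul (h1.fun_inv h2)
      · intro S hS
        exact Or.inl (re_det_div_pos hS)
    · intro S hS
      have h0 : (sub S).det ≠ 0 := det_ne_zero_of_mem (submatrix_mem hS)
      rw [mul_pow, hφ.sq _ (submatrix_mem hS), ← Complex.cpow_nat_mul]
      norm_num
      exact mul_div_cancel₀ _ h0
    · intro P hP
      have h1 : sub (P.map Complex.ofReal) = (P.submatrix Fin.succ Fin.succ).map Complex.ofReal := rfl
      have hP' := hP.submatrix (e := (Fin.succ : Fin n → Fin (n + 1))) (Fin.succ_injective n)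
      have hd : 0 < P.det := hP.det_pos
      have hd' : 0 < (P.submatrix Fin.succ Fin.succ).det := hP'.det_pos
      have hm : ∀ {k : ℕ} (Q : Matrix (Fin k) (Fin k) ℝ),
          (Q.map Complex.ofReal).det = (Q.det : ℂ) := fun Q =>
        (RingHom.map_det Complex.ofRealHom Q).symm
      simp only [h1, hφ.real _ hP', hm]
      rw [← Complex.ofReal_div, show (1 / 2 : ℂ) = ((1 / 2 : ℝ) : ℂ) by push_cast; rfl,
        ← Complex.ofReal_cpow (by positivity), ← Real.sqrt_eq_rpow, ← Complex.ofReal_mul,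
        ← Real.sqrt_mul hd'.le]
      congr 2
      field_simp

theorem convex_symmRePos (n : ℕ) : Convex ℝ (symmRePos n) := by
  intro S hS T hT a b ha hb hab
  refine ⟨?_, ?_⟩
  · have h1 := hS.1
    have h2 := hT.1
    unfold Matrix.IsSymm at *
    simp [h1, h2]
  · have : (a • S + b • T).map Complex.re = a • S.map Complex.re + b • T.map Complex.re := by
      ext i j; simp
    rw [this]
    rcases ha.eq_or_lt with rfl | ha
    · obtain rfl : b = 1 := by linarith
      simpa using hT.2
    · exact (hS.2.smul ha).add_posSemidef (hT.2.posSemidef.smul hb)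

theorem one_mem_symmRePos (n : ℕ) : (1 : Matrix (Fin n) (Fin n) ℂ) ∈ symmRePos n := by
  refine ⟨Matrix.isSymm_one, ?_⟩
  have : (1 : Matrix (Fin n) (Fin n) ℂ).map Complex.re = 1 := by
    ext i j; by_cases h : i = j <;> simp [h, Matrix.one_apply]
  rw [this]; exact Matrix.PosDef.one

theorem IsDetSqrt.ne_zero {n : ℕ} {φ : Matrix (Fin n) (Fin n) ℂ → ℂ} (h : IsDetSqrt n φ)
    {S : Matrix (Fin n) (Fin n) ℂ} (hS : S ∈ symmRePos n) : φ S ≠ 0 := by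
  intro h0
  have := h.sq S hS
  rw [h0] at this
  exact det_ne_zero_of_mem hS (by simpa using this.symm)

theorem IsDetSqrt.eqOn {n : ℕ} {φ ψ : Matrix (Fin n) (Fin n) ℂ → ℂ} (hφ : IsDetSqrt n φ)
    (hψ : IsDetSqrt n ψ) : Set.EqOn φ ψ (symmRePos n) := by
  have h1 : φ 1 = ψ 1 := by
    have h2 : (1 : Matrix (Fin n) (Fin n) ℂ) = (1 : Matrix (Fin n) (Fin n) ℝ).map Complex.ofReal := by
      ext i j; by_cases h : i = j <;> simp [h, Matrix.one_apply]
    rw [h2, hφ.real _ Matrix.PosDef.one, hψ.real _ Matrix.PosDef.one]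
  refine (convex_symmRePos n).isPreconnected.eq_of_sq_eq hφ.holomorphic.continuousOn
    hψ.holomorphic.continuousOn ?_ (fun hS => hψ.ne_zero hS) (one_mem_symmRePos n) h1
  intro S hS
  simp only [Pi.pow_apply, hφ.sq S hS, hψ.sq S hS]

/-- The function `det ^ (1 / 2)` on `symmRePos n` (it has no meaning elsewhere). -/
noncomputable def detSqrt (n : ℕ) : Matrix (Fin n) (Fin n) ℂ → ℂ :=
  Classical.choose (exists_isDetSqrt n)

theorem isDetSqrt_detSqrt (n : ℕ) : IsDetSqrt n (detSqrt n) :=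
  Classical.choose_spec (exists_isDetSqrt n)

end DetSqrt

section Siegel

variable {n : ℕ}

/-- The real symplectic group of degree `n`. -/
abbrev Sp (n : ℕ) : Type := Matrix.symplecticGroup (Fin n) ℝ

/-- The Siegel upper half plane of degree `n`. -/
abbrev SiegelHalf (n : ℕ) : Type :=
  {Ω : Matrix (Fin n) (Fin n) ℂ // Ω.IsSymm ∧ (Ω.map Complex.im).PosDef}

/-- Entrywise complex conjugate of a matrix. -/
def conjM {k l : ℕ} (X : Matrix (Fin k) (Fin l) ℂ) : Matrix (Fin k) (Fin l) ℂ :=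
  X.map (starRingEnd ℂ)

/-- A real matrix seen as a complex matrix. -/
def toC {k l : ℕ} (X : Matrix (Fin k) (Fin l) ℝ) : Matrix (Fin k) (Fin l) ℂ :=
  X.map Complex.ofReal

namespace Sp

/-- The blocks of `g = (A, B; C, D)`. -/
def A (g : Sp n) : Matrix (Fin n) (Fin n) ℝ := g.1.toBlocks₁₁
def B (g : Sp n) : Matrix (Fin n) (Fin n) ℝ := g.1.toBlocks₁₂
def C (g : Sp n) : Matrix (Fin n) (Fin n) ℝ := g.1.toBlocks₂₁
def D (g : Sp n) : Matrix (Fin n) (Fin n) ℝ := g.1.toBlocks₂₂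

end Sp

/-- `A Ω + B` for `g = (A, B; C, D)`. -/
def numer (g : Sp n) (Ω : Matrix (Fin n) (Fin n) ℂ) : Matrix (Fin n) (Fin n) ℂ :=
  toC g.A * Ω + toC g.B

/-- `J(g, Ω) = C Ω + D` for `g = (A, B; C, D)`. -/
def denom (g : Sp n) (Ω : Matrix (Fin n) (Fin n) ℂ) : Matrix (Fin n) (Fin n) ℂ :=
  toC g.C * Ω + toC g.D

theorem toC_mul {k l p : ℕ} (X : Matrix (Fin k) (Fin l) ℝ) (Y : Matrix (Fin l) (Fin p) ℝ) :
    toC (X * Y) = toC X * toC Y := Matrix.map_mul (f := Complex.ofRealHom)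

theorem toC_add {k l : ℕ} (X Y : Matrix (Fin k) (Fin l) ℝ) : toC (X + Y) = toC X + toC Y := by
  ext; simp [toC]

theorem conjM_mul {k l p : ℕ} (X : Matrix (Fin k) (Fin l) ℂ) (Y : Matrix (Fin l) (Fin p) ℂ) :
    conjM (X * Y) = conjM X * conjM Y := Matrix.map_mul (f := starRingEnd ℂ)

theorem conjM_add {k l : ℕ} (X Y : Matrix (Fin k) (Fin l) ℂ) :
    conjM (X + Y) = conjM X + conjM Y := by
  ext; simp [conjM]

theorem conjM_toC {k l : ℕ} (X : Matrix (Fin k) (Fin l) ℝ) : conjM (toC X) = toC X := by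
  ext; simp [conjM, toC]

theorem det_conjM (X : Matrix (Fin n) (Fin n) ℂ) : (conjM X).det = starRingEnd ℂ X.det :=
  (RingHom.map_det (starRingEnd ℂ) X).symm

theorem denom_conjM (g : Sp n) (Ω : Matrix (Fin n) (Fin n) ℂ) :
    denom g (conjM Ω) = conjM (denom g Ω) := by
  simp [denom, conjM_add, conjM_mul, conjM_toC]

theorem numer_conjM (g : Sp n) (Ω : Matrix (Fin n) (Fin n) ℂ) :
    numer g (conjM Ω) = conjM (numer g Ω) := by
  simp [numer, conjM_add, conjM_mul, conjM_toC]

theorem sp_eq (g : Sp n) : g.1 = fromBlocks g.A g.B g.C g.D := (fromBlocks_toBlocks g.1).symm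

theorem sp_rel (g : Sp n) :
    (toC g.A)ᵀ * toC g.C = (toC g.C)ᵀ * toC g.A ∧ (toC g.B)ᵀ * toC g.D = (toC g.D)ᵀ * toC g.B ∧
      (toC g.A)ᵀ * toC g.D - (toC g.C)ᵀ * toC g.B = 1 := by
  have h := SymplecticGroup.map_mem g.2 Complex.ofRealHom
  rw [sp_eq g, fromBlocks_map] at h
  exact SymplecticGroup.fromBlocks_mem_iff.mp h

theorem sp_mul (g h : Sp n) :
    (g * h).A = g.A * h.A + g.B * h.C ∧ (g * h).B = g.A * h.B + g.B * h.D ∧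
      (g * h).C = g.C * h.A + g.D * h.C ∧ (g * h).D = g.C * h.B + g.D * h.D := by
  have h1 : (g * h).1 = g.1 * h.1 := rfl
  rw [sp_eq g, sp_eq h, sp_eq (g * h), fromBlocks_multiply] at h1
  obtain ⟨a, b, c, d⟩ := fromBlocks_inj.mp h1
  exact ⟨a, b, c, d⟩

theorem sp_one : (1 : Sp n).A = 1 ∧ (1 : Sp n).B = 0 ∧ (1 : Sp n).C = 0 ∧ (1 : Sp n).D = 1 := by
  have h1 : (1 : Sp n).1 = 1 := rfl
  rw [sp_eq (1 : Sp n), ← fromBlocks_one] at h1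
  exact fromBlocks_inj.mp h1

theorem denom_numer (g : Sp n) {Ω₁ Ω₂ : Matrix (Fin n) (Fin n) ℂ} (h₁ : Ω₁.IsSymm) :
    (denom g Ω₁)ᵀ * numer g Ω₂ - (numer g Ω₁)ᵀ * denom g Ω₂ = Ω₂ - Ω₁ := by
  obtain ⟨r1, r2, r3⟩ := sp_rel g
  have r4 : (toC g.D)ᵀ * toC g.A - (toC g.B)ᵀ * toC g.C = 1 := by
    simpa using congrArg Matrix.transpose r3
  have h1 : Ω₁ᵀ = Ω₁ := h₁
  simp only [denom, numer, Matrix.transpose_add, Matrix.transpose_mul, h1]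
  have e : (Ω₁ * (toC g.C)ᵀ + (toC g.D)ᵀ) * (toC g.A * Ω₂ + toC g.B)
      - (Ω₁ * (toC g.A)ᵀ + (toC g.B)ᵀ) * (toC g.C * Ω₂ + toC g.D)
      = Ω₁ * ((toC g.C)ᵀ * toC g.A - (toC g.A)ᵀ * toC g.C) * Ω₂
        - Ω₁ * ((toC g.A)ᵀ * toC g.D - (toC g.C)ᵀ * toC g.B)
        + ((toC g.D)ᵀ * toC g.A - (toC g.B)ᵀ * toC g.C) * Ω₂
        + ((toC g.D)ᵀ * toC g.B - (toC g.B)ᵀ * toC g.D) := by noncomm_ring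
  rw [e, r3, r4, r1, r2]
  simp
  abel

/-- `(Ω' - conj Ω) / (2 i)`. -/
noncomputable def halfDiff (Ω' Ω : Matrix (Fin n) (Fin n) ℂ) : Matrix (Fin n) (Fin n) ℂ :=
  (2 * Complex.I)⁻¹ • (Ω' - conjM Ω)

theorem halfDiff_mem (Ω' Ω : SiegelHalf n) : halfDiff Ω'.1 Ω.1 ∈ symmRePos n := by
  refine ⟨?_, ?_⟩
  · have h1 : Ω'.1ᵀ = Ω'.1 := Ω'.2.1
    have h2 : Ω.1ᵀ = Ω.1 := Ω.2.1
    have h3 : (conjM Ω.1)ᵀ = conjM Ω.1 := by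
      conv_rhs => rw [← h2]
      rfl
    simp [Matrix.IsSymm, halfDiff, h1, h3]
  · have : (halfDiff Ω'.1 Ω.1).map Complex.re
        = (2⁻¹ : ℝ) • (Ω'.1.map Complex.im + Ω.1.map Complex.im) := by
      ext i j
      simp [halfDiff, conjM]
    rw [this]
    exact (Ω'.2.2.add Ω.2.2).smul (by norm_num)

theorem halfDiff_self (Ω : Matrix (Fin n) (Fin n) ℂ) :
    halfDiff Ω Ω = toC (Ω.map Complex.im) := by
  ext i j
  refine Complex.ext ?_ ?_ <;> (simp [halfDiff, conjM, toC]; try ring)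

theorem denom_det_ne_zero (g : Sp n) (Ω : SiegelHalf n) : (denom g Ω.1).det ≠ 0 := by
  intro h
  obtain ⟨v, hv, hv0⟩ := Matrix.exists_mulVec_eq_zero_iff.mpr h
  have hs : (conjM Ω.1).IsSymm := by
    have h2 : Ω.1ᵀ = Ω.1 := Ω.2.1
    unfold Matrix.IsSymm
    conv_rhs => rw [← h2]
    rfl
  have h1 := denom_numer g (Ω₁ := conjM Ω.1) (Ω₂ := Ω.1) hs
  rw [denom_conjM, numer_conjM] at h1
  have h2 := re_star_dotProduct_pos (halfDiff_mem Ω Ω) hv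
  have h4 : star v ᵥ* (conjM (denom g Ω.1))ᵀ = 0 := by
    rw [Matrix.vecMul_transpose]
    have : conjM (denom g Ω.1) *ᵥ star v = star (denom g Ω.1 *ᵥ v) := by
      ext i; simp [conjM, Matrix.mulVec, dotProduct]
    rw [this, hv0, star_zero]
  have h3 : star v ⬝ᵥ (Ω.1 - conjM Ω.1) *ᵥ v = 0 := by
    rw [← h1, Matrix.sub_mulVec, ← Matrix.mulVec_mulVec, ← Matrix.mulVec_mulVec, hv0,
      Matrix.mulVec_zero, sub_zero, Matrix.dotProduct_mulVec, h4, zero_dotProduct]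
  rw [halfDiff, Matrix.smul_mulVec, dotProduct_smul, h3] at h2
  simp at h2

/-- `g ⬝ Ω = (A Ω + B) (C Ω + D)⁻¹`. -/
noncomputable def moeb (g : Sp n) (Ω : Matrix (Fin n) (Fin n) ℂ) : Matrix (Fin n) (Fin n) ℂ :=
  numer g Ω * (denom g Ω)⁻¹

theorem moeb_symm (g : Sp n) (Ω : SiegelHalf n) : (moeb g Ω.1).IsSymm := by
  have h := denom_numer g (Ω₁ := Ω.1) (Ω₂ := Ω.1) Ω.2.1
  rw [sub_self, sub_eq_zero] at h
  have hu : IsUnit (denom g Ω.1).det := isUnit_iff_ne_zero.mpr (denom_det_ne_zero g Ω)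
  have hu' : IsUnit (denom g Ω.1)ᵀ.det := by rwa [Matrix.det_transpose]
  rw [Matrix.IsSymm, moeb, Matrix.transpose_mul, Matrix.transpose_nonsing_inv]
  calc ((denom g Ω.1)ᵀ)⁻¹ * (numer g Ω.1)ᵀ
      = ((denom g Ω.1)ᵀ)⁻¹ * ((numer g Ω.1)ᵀ * denom g Ω.1) * (denom g Ω.1)⁻¹ := by
        rw [Matrix.mul_assoc, Matrix.mul_assoc, Matrix.mul_nonsing_inv _ hu, Matrix.mul_one]
    _ = _ := by
        rw [← h, ← Matrix.mul_assoc, Matrix.nonsing_inv_mul _ hu', Matrix.one_mul]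

theorem halfDiff_moeb (g : Sp n) (Ω' Ω : SiegelHalf n) :
    (conjM (denom g Ω.1))ᵀ * halfDiff (moeb g Ω'.1) (moeb g Ω.1) * denom g Ω'.1
      = halfDiff Ω'.1 Ω.1 := by
  have hs : (conjM Ω.1).IsSymm := by
    have h2 : Ω.1ᵀ = Ω.1 := Ω.2.1
    unfold Matrix.IsSymm
    conv_rhs => rw [← h2]
    rfl
  have hu : ∀ Ω : SiegelHalf n, IsUnit (denom g Ω.1).det := fun Ω =>
    isUnit_iff_ne_zero.mpr (denom_det_ne_zero g Ω)
  have h1 := denom_numer g (Ω₁ := conjM Ω.1) (Ω₂ := Ω'.1) hs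
  rw [denom_conjM, numer_conjM] at h1
  have h2 : moeb g Ω'.1 * denom g Ω'.1 = numer g Ω'.1 := by
    rw [moeb, Matrix.mul_assoc, Matrix.nonsing_inv_mul _ (hu Ω'), Matrix.mul_one]
  have h3 : (conjM (denom g Ω.1))ᵀ * conjM (moeb g Ω.1) = (conjM (numer g Ω.1))ᵀ := by
    have : (moeb g Ω.1)ᵀ = moeb g Ω.1 := moeb_symm g Ω
    have h5 : moeb g Ω.1 * denom g Ω.1 = numer g Ω.1 := by
      rw [moeb, Matrix.mul_assoc, Matrix.nonsing_inv_mul _ (hu Ω), Matrix.mul_one]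
    rw [← h5, conjM_mul, Matrix.transpose_mul]
    congr 1
    conv_lhs => rw [← this]
    rfl
  rw [halfDiff, halfDiff, ← h1, Matrix.mul_smul, Matrix.smul_mul, Matrix.mul_sub, Matrix.sub_mul,
    Matrix.mul_assoc, h2, h3]

theorem moeb_im_posDef (g : Sp n) (Ω : SiegelHalf n) : ((moeb g Ω.1).map Complex.im).PosDef := by
  have hsym : ((moeb g Ω.1).map Complex.im).IsHermitian := by
    have : (moeb g Ω.1)ᵀ = moeb g Ω.1 := moeb_symm g Ω
    rw [Matrix.IsHermitian, Matrix.conjTranspose_eq_transpose_of_trivial]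
    conv_rhs => rw [← this]
    rfl
  refine Matrix.PosDef.of_dotProduct_mulVec_pos hsym fun x hx => ?_
  have hu : IsUnit (denom g Ω.1).det := isUnit_iff_ne_zero.mpr (denom_det_ne_zero g Ω)
  let z : Fin n → ℂ := fun i => x i
  let u := (denom g Ω.1)⁻¹ *ᵥ z
  have hz : denom g Ω.1 *ᵥ u = z := by
    simp only [u, Matrix.mulVec_mulVec, Matrix.mul_nonsing_inv _ hu, Matrix.one_mulVec]
  have hu0 : u ≠ 0 := by
    intro h
    rw [h, Matrix.mulVec_zero] at hz
    apply hx
    ext i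
    have := congrFun hz i
    simpa [z] using this.symm
  have h1 := re_star_dotProduct_pos (halfDiff_mem Ω Ω) hu0
  rw [← halfDiff_moeb g Ω Ω, ← Matrix.mulVec_mulVec, hz, ← Matrix.mulVec_mulVec,
    Matrix.dotProduct_mulVec, Matrix.vecMul_transpose] at h1
  have : conjM (denom g Ω.1) *ᵥ star u = star z := by
    rw [← hz]
    ext i; simp [conjM, Matrix.mulVec, dotProduct]
  rw [this, halfDiff_self] at h1
  have e : star z ⬝ᵥ toC ((moeb g Ω.1).map Complex.im) *ᵥ z
      = ((x ⬝ᵥ (moeb g Ω.1).map Complex.im *ᵥ x : ℝ) : ℂ) := by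
    simp [dotProduct, Matrix.mulVec, toC, z]
  rw [e, Complex.ofReal_re] at h1
  simpa using h1

theorem denom_mul (g h : Sp n) (Ω : SiegelHalf n) :
    denom (g * h) Ω.1 = denom g (moeb h Ω.1) * denom h Ω.1 := by
  have hu : IsUnit (denom h Ω.1).det := isUnit_iff_ne_zero.mpr (denom_det_ne_zero h Ω)
  have h2 : moeb h Ω.1 * denom h Ω.1 = numer h Ω.1 := by
    rw [moeb, Matrix.mul_assoc, Matrix.nonsing_inv_mul _ hu, Matrix.mul_one]
  obtain ⟨-, -, c, d⟩ := sp_mul g h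
  rw [denom, denom, Matrix.add_mul, Matrix.mul_assoc, h2, c, d]
  simp only [toC_add, toC_mul, numer, denom]
  noncomm_ring

theorem numer_mul (g h : Sp n) (Ω : SiegelHalf n) :
    numer (g * h) Ω.1 = numer g (moeb h Ω.1) * denom h Ω.1 := by
  have hu : IsUnit (denom h Ω.1).det := isUnit_iff_ne_zero.mpr (denom_det_ne_zero h Ω)
  have h2 : moeb h Ω.1 * denom h Ω.1 = numer h Ω.1 := by
    rw [moeb, Matrix.mul_assoc, Matrix.nonsing_inv_mul _ hu, Matrix.mul_one]
  obtain ⟨a, b, -, -⟩ := sp_mul g h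
  rw [numer, numer, Matrix.add_mul, Matrix.mul_assoc, h2, a, b]
  simp only [toC_add, toC_mul, numer, denom]
  noncomm_ring

theorem toC_one : toC (1 : Matrix (Fin n) (Fin n) ℝ) = 1 := by
  ext i j; by_cases h : i = j <;> simp [toC, h, Matrix.one_apply]

theorem denom_one (Ω : Matrix (Fin n) (Fin n) ℂ) : denom (1 : Sp n) Ω = 1 := by
  obtain ⟨-, -, c, d⟩ := sp_one (n := n)
  rw [denom, c, d, toC_one]
  simp [toC]

theorem numer_one (Ω : Matrix (Fin n) (Fin n) ℂ) : numer (1 : Sp n) Ω = Ω := by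
  obtain ⟨a, b, -, -⟩ := sp_one (n := n)
  rw [numer, a, b, toC_one]
  simp [toC]

/-- The action of `Sp n` on the Siegel upper half plane. -/
noncomputable instance : MulAction (Sp n) (SiegelHalf n) where
  smul g Ω := ⟨moeb g Ω.1, moeb_symm g Ω, moeb_im_posDef g Ω⟩
  one_smul Ω := by
    apply Subtype.ext
    change moeb 1 Ω.1 = Ω.1
    simp [moeb, numer_one, denom_one]
  mul_smul g h Ω := by
    apply Subtype.ext
    change moeb (g * h) Ω.1 = moeb g (moeb h Ω.1)
    have hu : IsUnit (denom h Ω.1).det := isUnit_iff_ne_zero.mpr (denom_det_ne_zero h Ω)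
    conv_lhs => rw [moeb]
    rw [numer_mul, denom_mul, Matrix.mul_inv_rev, Matrix.mul_assoc,
      ← Matrix.mul_assoc (denom h Ω.1), Matrix.mul_nonsing_inv _ hu, Matrix.one_mul]
    rfl

theorem smul_val (g : Sp n) (Ω : SiegelHalf n) : (g • Ω).1 = moeb g Ω.1 := rfl

/-- The point `i I_n`. -/
noncomputable def basePoint (n : ℕ) : SiegelHalf n :=
  ⟨Complex.I • 1, by simp [Matrix.IsSymm], by
    have : (Complex.I • (1 : Matrix (Fin n) (Fin n) ℂ)).map Complex.im = 1 := by
      ext i j; by_cases h : i = j <;> simp [h, Matrix.one_apply]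
    rw [this]; exact Matrix.PosDef.one⟩

end Siegel

section Metaplectic

variable {n : ℕ}

/-- The factor of modulus one
`ε(g; Ω', Ω) = det^(-1/2) ((g ⬝ Ω' - conj (g ⬝ Ω)) / 2i) * det^(1/2) ((Ω' - conj Ω) / 2i)
  * |det J(g, Ω')|^(-1/2) * |det J(g, Ω)|^(-1/2)`. -/
noncomputable def epsFactor (g : Sp n) (Ω' Ω : SiegelHalf n) : ℂ :=
  (detSqrt n (halfDiff (g • Ω').1 (g • Ω).1))⁻¹ * detSqrt n (halfDiff Ω'.1 Ω.1)
    * ((√‖(denom g Ω'.1).det‖)⁻¹ : ℝ) * ((√‖(denom g Ω.1).det‖)⁻¹ : ℝ)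

/-- `z / |z|` for `z = det J(g, Ω)`; this is `α_Ω(g)`. -/
noncomputable def alphaFactor (Ω : SiegelHalf n) (g : Sp n) : ℂ :=
  (denom g Ω.1).det / (‖(denom g Ω.1).det‖ : ℝ)

/-- `β_Ω(g₁, g₂) = ε(g₁; Ω, g₂ ⬝ Ω)`. -/
noncomputable def betaFactor (Ω : SiegelHalf n) (g₁ g₂ : Sp n) : ℂ :=
  epsFactor g₁ Ω (g₂ • Ω)

theorem detSqrt_halfDiff_ne_zero (Ω' Ω : SiegelHalf n) : detSqrt n (halfDiff Ω'.1 Ω.1) ≠ 0 :=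
  (isDetSqrt_detSqrt n).ne_zero (halfDiff_mem Ω' Ω)

theorem alphaFactor_ne_zero (Ω : SiegelHalf n) (g : Sp n) : alphaFactor Ω g ≠ 0 :=
  div_ne_zero (denom_det_ne_zero g Ω)
    (Complex.ofReal_ne_zero.mpr (norm_ne_zero_iff.mpr (denom_det_ne_zero g Ω)))

theorem norm_alphaFactor (Ω : SiegelHalf n) (g : Sp n) : ‖alphaFactor Ω g‖ = 1 := by
  have := norm_ne_zero_iff.mpr (denom_det_ne_zero g Ω)
  simp [alphaFactor, this]

theorem alphaFactor_one (Ω : SiegelHalf n) : alphaFactor Ω 1 = 1 := by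
  simp [alphaFactor, denom_one]

theorem alphaFactor_mul (Ω : SiegelHalf n) (g h : Sp n) :
    alphaFactor Ω (g * h) = alphaFactor (h • Ω) g * alphaFactor Ω h := by
  simp only [alphaFactor, denom_mul, Matrix.det_mul, norm_mul, smul_val]
  push_cast
  exact mul_div_mul_comm _ _ _ _

theorem epsFactor_ne_zero (g : Sp n) (Ω' Ω : SiegelHalf n) : epsFactor g Ω' Ω ≠ 0 := by
  have h1 := detSqrt_halfDiff_ne_zero (g • Ω') (g • Ω)
  have h2 := detSqrt_halfDiff_ne_zero Ω' Ω
  have h3 : ∀ Ω : SiegelHalf n, (√‖(denom g Ω.1).det‖)⁻¹ ≠ 0 := fun Ω =>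
    inv_ne_zero (Real.sqrt_ne_zero'.mpr (norm_pos_iff.mpr (denom_det_ne_zero g Ω)))
  refine mul_ne_zero (mul_ne_zero (mul_ne_zero (inv_ne_zero h1) h2) ?_) ?_
  · exact Complex.ofReal_ne_zero.mpr (h3 _)
  · exact Complex.ofReal_ne_zero.mpr (h3 _)

theorem epsFactor_sq (g : Sp n) (Ω' Ω : SiegelHalf n) :
    epsFactor g Ω' Ω ^ 2 = alphaFactor Ω' g * (alphaFactor Ω g)⁻¹ := by
  have hd' := denom_det_ne_zero g Ω'
  have hd := denom_det_ne_zero g Ω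
  have h1 := halfDiff_moeb g Ω' Ω
  have h2 := congrArg Matrix.det h1
  rw [Matrix.det_mul, Matrix.det_mul, Matrix.det_transpose, det_conjM] at h2
  have hq := det_ne_zero_of_mem (halfDiff_mem (g • Ω') (g • Ω))
  rw [smul_val, smul_val] at hq
  have hn : ∀ z : ℂ, (((√‖z‖)⁻¹ : ℝ) : ℂ) ^ 2 = ((‖z‖ : ℝ) : ℂ)⁻¹ := fun z => by
    rw [← Complex.ofReal_pow, inv_pow, Real.sq_sqrt (norm_nonneg _), Complex.ofReal_inv]
  have hc : ((‖(denom g Ω.1).det‖ : ℝ) : ℂ) ^ 2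
      = (denom g Ω.1).det * starRingEnd ℂ (denom g Ω.1).det := by
    rw [Complex.mul_conj, Complex.normSq_eq_norm_sq]; push_cast; rfl
  rw [epsFactor, mul_pow, mul_pow, mul_pow, inv_pow, (isDetSqrt_detSqrt n).sq _ (halfDiff_mem _ _),
    (isDetSqrt_detSqrt n).sq _ (halfDiff_mem _ _), hn, hn, smul_val, smul_val, ← h2, alphaFactor,
    alphaFactor, inv_div]
  have hn' : ((‖(denom g Ω'.1).det‖ : ℝ) : ℂ) ≠ 0 :=
    Complex.ofReal_ne_zero.mpr (norm_ne_zero_iff.mpr hd')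
  have hn0 : ((‖(denom g Ω.1).det‖ : ℝ) : ℂ) ≠ 0 :=
    Complex.ofReal_ne_zero.mpr (norm_ne_zero_iff.mpr hd)
  field_simp
  rw [hc]
  ring

theorem epsFactor_self (g : Sp n) (Ω : SiegelHalf n) : epsFactor g Ω Ω = 1 := by
  have h1 := epsFactor_sq g Ω Ω
  rw [mul_inv_cancel₀ (alphaFactor_ne_zero Ω g)] at h1
  have h2 : epsFactor g Ω Ω = (((√((g • Ω).1.map Complex.im).det)⁻¹ * √(Ω.1.map Complex.im).det
      * (√‖(denom g Ω.1).det‖)⁻¹ * (√‖(denom g Ω.1).det‖)⁻¹ : ℝ) : ℂ) := by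
    rw [epsFactor, halfDiff_self, halfDiff_self, toC, toC,
      (isDetSqrt_detSqrt n).real _ (g • Ω).2.2, (isDetSqrt_detSqrt n).real _ Ω.2.2]
    push_cast
    rfl
  rw [h2] at h1 ⊢
  rw [← Complex.ofReal_pow, Complex.ofReal_eq_one] at h1
  rw [Complex.ofReal_eq_one]
  exact (pow_eq_one_iff_of_nonneg (by positivity) two_ne_zero).mp h1

theorem convex_siegelHalf (n : ℕ) :
    Convex ℝ {Ω : Matrix (Fin n) (Fin n) ℂ | Ω.IsSymm ∧ (Ω.map Complex.im).PosDef} := by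
  intro S hS T hT a b ha hb hab
  refine ⟨?_, ?_⟩
  · have h1 := hS.1
    have h2 := hT.1
    unfold Matrix.IsSymm at *
    simp [h1, h2]
  · have : (a • S + b • T).map Complex.im = a • S.map Complex.im + b • T.map Complex.im := by
      ext i j; simp
    rw [this]
    rcases ha.eq_or_lt with rfl | ha
    · obtain rfl : b = 1 := by linarith
      simpa using hT.2
    · exact (hS.2.smul ha).add_posSemidef (hT.2.posSemidef.smul hb)

theorem preconnectedSpace_siegelHalf (n : ℕ) : PreconnectedSpace (SiegelHalf n) :=
  Subtype.preconnectedSpace (convex_siegelHalf n).isPreconnected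

theorem continuous_denom (g : Sp n) : Continuous fun Ω : SiegelHalf n => denom g Ω.1 := by
  unfold denom; fun_prop

theorem continuous_smul_val (g : Sp n) : Continuous fun Ω : SiegelHalf n => (g • Ω).1 := by
  have h1 : Continuous fun Ω : SiegelHalf n => numer g Ω.1 := by
    unfold numer; fun_prop
  have h2 := continuous_denom g
  simp only [smul_val, moeb, Matrix.inv_def, Ring.inverse_eq_inv']
  refine h1.matrix_mul (Continuous.fun_smul ?_ h2.matrix_adjugate)
  exact h2.matrix_det.inv₀ fun Ω => denom_det_ne_zero g Ω

theorem continuous_detSqrt_halfDiff {X : Type*} [TopologicalSpace X] {u v : X → SiegelHalf n}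
    (hu : Continuous fun x => (u x).1) (hv : Continuous fun x => (v x).1) :
    Continuous fun x => detSqrt n (halfDiff (u x).1 (v x).1) := by
  have h1 : ContinuousOn (detSqrt n) (symmRePos n) :=
    (isDetSqrt_detSqrt n).holomorphic.continuousOn
  refine h1.comp_continuous ?_ fun x => halfDiff_mem _ _
  have h2 : Continuous fun x => conjM (v x).1 := hv.matrix_map Complex.continuous_conj
  have h3 : Continuous fun x => (u x).1 - conjM (v x).1 := hu.sub h2
  unfold halfDiff
  fun_prop

theorem continuous_epsFactor (g : Sp n) (Ω' : SiegelHalf n) : Continuous (epsFactor g Ω') := by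
  unfold epsFactor
  have h1 := continuous_detSqrt_halfDiff (u := fun _ : SiegelHalf n => g • Ω')
    (v := fun Ω => g • Ω) continuous_const (continuous_smul_val g)
  have h2 := continuous_detSqrt_halfDiff (u := fun _ : SiegelHalf n => Ω')
    (v := fun Ω => Ω) continuous_const continuous_subtype_val
  have h3 : Continuous fun Ω : SiegelHalf n => (√‖(denom g Ω.1).det‖)⁻¹ :=
    (continuous_denom g).matrix_det.norm.sqrt.inv₀ fun Ω =>
      Real.sqrt_ne_zero'.mpr (norm_pos_iff.mpr (denom_det_ne_zero g Ω))
  exact (((h1.inv₀ fun Ω => detSqrt_halfDiff_ne_zero _ _).mul h2).mul continuous_const).mul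
    (Complex.continuous_ofReal.comp h3)

theorem epsFactor_trans (g : Sp n) (a b c : SiegelHalf n) :
    epsFactor g a b * epsFactor g b c = epsFactor g a c := by
  have := preconnectedSpace_siegelHalf n
  have key : Set.EqOn (fun c => epsFactor g a b * epsFactor g b c) (epsFactor g a) Set.univ := by
    refine isPreconnected_univ.eq_of_sq_eq
      (continuous_const.mul (continuous_epsFactor g b)).continuousOn
      (continuous_epsFactor g a).continuousOn ?_ (fun _ => epsFactor_ne_zero _ _ _)
      (Set.mem_univ b) ?_
    · intro c _
      have := alphaFactor_ne_zero b g
      simp only [Pi.pow_apply, mul_pow, epsFactor_sq]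
      field_simp
    · simp [epsFactor_self]
  exact key (Set.mem_univ c)

theorem epsFactor_mul (g h : Sp n) (a b : SiegelHalf n) :
    epsFactor (g * h) a b = epsFactor g (h • a) (h • b) * epsFactor h a b := by
  have h1 := detSqrt_halfDiff_ne_zero (h • a) (h • b)
  simp only [epsFactor, mul_smul]
  rw [denom_mul, denom_mul, Matrix.det_mul, Matrix.det_mul, norm_mul, norm_mul,
    Real.sqrt_mul (norm_nonneg _), Real.sqrt_mul (norm_nonneg _), mul_inv, mul_inv,
    smul_val h a, smul_val h b]
  rw [smul_val h a, smul_val h b] at h1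
  push_cast
  field_simp

theorem betaFactor_sq (Ω : SiegelHalf n) (g h : Sp n) :
    betaFactor Ω g h ^ 2 = alphaFactor Ω h * (alphaFactor Ω (g * h))⁻¹ * alphaFactor Ω g := by
  have := alphaFactor_ne_zero Ω h
  have h2 := alphaFactor_ne_zero (h • Ω) g
  rw [betaFactor, epsFactor_sq, alphaFactor_mul]
  field_simp

theorem betaFactor_cocycle (Ω : SiegelHalf n) (g₁ g₂ g₃ : Sp n) :
    betaFactor Ω g₁ g₂ * betaFactor Ω (g₁ * g₂) g₃
      = betaFactor Ω g₁ (g₂ * g₃) * betaFactor Ω g₂ g₃ := by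
  simp only [betaFactor, epsFactor_mul, mul_smul]
  rw [← mul_assoc, epsFactor_trans]

theorem betaFactor_one_right (Ω : SiegelHalf n) (g : Sp n) : betaFactor Ω g 1 = 1 := by
  rw [betaFactor, one_smul, epsFactor_self]

theorem betaFactor_one_left (Ω : SiegelHalf n) (g : Sp n) : betaFactor Ω 1 g = 1 := by
  have h := epsFactor_mul 1 1 Ω (g • Ω)
  simp only [one_smul, mul_one] at h
  exact (mul_eq_left₀ (epsFactor_ne_zero _ _ _)).mp h.symm

/-- The two-fold covering group `G_*` of `Sp n`: the pairs `(g, ε)` with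
`ε ^ 2 = α_{i I_n}(g)⁻¹`; in particular `|ε| = 1`. -/
@[ext] structure GStar (n : ℕ) where
  g : Sp n
  ε : ℂ
  sq : ε ^ 2 = (alphaFactor (basePoint n) g)⁻¹

theorem GStar.norm_ε (a : GStar n) : ‖a.ε‖ = 1 := by
  have := congrArg norm a.sq
  rw [norm_pow, norm_inv, norm_alphaFactor, inv_one] at this
  exact (pow_eq_one_iff_of_nonneg (norm_nonneg _) two_ne_zero).mp this

theorem GStar.ε_ne_zero (a : GStar n) : a.ε ≠ 0 := by
  intro h
  have := a.norm_ε
  simp [h] at this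

/-- The multiplication law is
`(g₁, ε₁) (g₂, ε₂) = (g₁ g₂, ε₁ ε₂ β_{i I_n}(g₁, g₂))`. -/
noncomputable instance : Group (GStar n) where
  mul a b := ⟨a.g * b.g, a.ε * b.ε * betaFactor (basePoint n) a.g b.g, by
    have h1 := alphaFactor_ne_zero (basePoint n) a.g
    have h2 := alphaFactor_ne_zero (basePoint n) b.g
    have h3 := alphaFactor_ne_zero (basePoint n) (a.g * b.g)
    rw [mul_pow, mul_pow, a.sq, b.sq, betaFactor_sq]
    field_simp⟩
  one := ⟨1, 1, by rw [alphaFactor_one]; simp⟩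
  inv a := ⟨a.g⁻¹, a.ε⁻¹ * (betaFactor (basePoint n) a.g⁻¹ a.g)⁻¹, by
    have h1 := alphaFactor_ne_zero (basePoint n) a.g
    have h2 := alphaFactor_ne_zero (basePoint n) a.g⁻¹
    rw [mul_pow, inv_pow, inv_pow, a.sq, betaFactor_sq, inv_mul_cancel, alphaFactor_one]
    field_simp⟩
  mul_assoc a b c := by
    refine GStar.ext (mul_assoc a.g b.g c.g) ?_
    change a.ε * b.ε * betaFactor (basePoint n) a.g b.g * c.ε
        * betaFactor (basePoint n) (a.g * b.g) c.g
      = a.ε * (b.ε * c.ε * betaFactor (basePoint n) b.g c.g)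
        * betaFactor (basePoint n) a.g (b.g * c.g)
    linear_combination (a.ε * b.ε * c.ε) * betaFactor_cocycle (basePoint n) a.g b.g c.g
  one_mul a := by
    refine GStar.ext (one_mul a.g) ?_
    change 1 * a.ε * betaFactor (basePoint n) 1 a.g = a.ε
    rw [betaFactor_one_left, one_mul, mul_one]
  mul_one a := by
    refine GStar.ext (mul_one a.g) ?_
    change a.ε * 1 * betaFactor (basePoint n) a.g 1 = a.ε
    rw [betaFactor_one_right, mul_one, mul_one]
  inv_mul_cancel a := by
    refine GStar.ext (inv_mul_cancel a.g) ?_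
    change a.ε⁻¹ * (betaFactor (basePoint n) a.g⁻¹ a.g)⁻¹ * a.ε
      * betaFactor (basePoint n) a.g⁻¹ a.g = 1
    have h1 := a.ε_ne_zero
    have h2 : betaFactor (basePoint n) a.g⁻¹ a.g ≠ 0 := epsFactor_ne_zero _ _ _
    field_simp

/-- The automorphic factor
`J_{1/2}((g, ε), Ω) = ε⁻¹ ε(g; Ω, i I_n) |det J(g, Ω)| ^ (1 / 2)`. -/
noncomputable def jHalf (a : GStar n) (Ω : SiegelHalf n) : ℂ :=
  a.ε⁻¹ * epsFactor a.g Ω (basePoint n) * (√‖(denom a.g Ω.1).det‖ : ℝ)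

end Metaplectic

section Jacobi

variable {n m : ℕ}

/-- The Heisenberg group: triples `(lam, mu; kap)` with `kap + mu lamᵀ` symmetric. -/
@[ext] structure Heis (n m : ℕ) where
  lam : Matrix (Fin m) (Fin n) ℝ
  mu : Matrix (Fin m) (Fin n) ℝ
  kap : Matrix (Fin m) (Fin m) ℝ
  symm : (kap + mu * lamᵀ).IsSymm

theorem Heis.kapT (h : Heis n m) : h.kapᵀ = h.kap + h.mu * h.lamᵀ - h.lam * h.muᵀ := by
  have h1 : (h.kap + h.mu * h.lamᵀ)ᵀ = h.kap + h.mu * h.lamᵀ := h.symm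
  rw [← h1]
  simp

/-- The multiplication law is
`(λ, μ; κ) ∘ (λ', μ'; κ') = (λ + λ', μ + μ'; κ + κ' + λ μ'ᵀ - μ λ'ᵀ)`. -/
instance : Group (Heis n m) where
  mul a b := ⟨a.lam + b.lam, a.mu + b.mu, a.kap + b.kap + a.lam * b.muᵀ - a.mu * b.lamᵀ, by
    unfold Matrix.IsSymm
    simp only [Matrix.transpose_add, Matrix.transpose_sub, Matrix.transpose_mul,
      Matrix.transpose_transpose, a.kapT, b.kapT, Matrix.add_mul, Matrix.mul_add]
    abel⟩
  one := ⟨0, 0, 0, by simp [Matrix.IsSymm]⟩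
  inv a := ⟨-a.lam, -a.mu, -a.kap + a.lam * a.muᵀ - a.mu * a.lamᵀ, by
    unfold Matrix.IsSymm
    simp only [Matrix.transpose_add, Matrix.transpose_sub, Matrix.transpose_mul,
      Matrix.transpose_transpose, a.kapT, Matrix.transpose_neg, Matrix.neg_mul, Matrix.mul_neg]
    abel⟩
  mul_assoc a b c := by
    refine Heis.ext (add_assoc _ _ _) (add_assoc _ _ _) ?_
    change (a.kap + b.kap + a.lam * b.muᵀ - a.mu * b.lamᵀ) + c.kap + (a.lam + b.lam) * c.muᵀ
        - (a.mu + b.mu) * c.lamᵀ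
      = a.kap + (b.kap + c.kap + b.lam * c.muᵀ - b.mu * c.lamᵀ) + a.lam * (b.mu + c.mu)ᵀ
        - a.mu * (b.lam + c.lam)ᵀ
    simp only [Matrix.transpose_add, Matrix.add_mul, Matrix.mul_add]
    abel
  one_mul a := by
    refine Heis.ext (zero_add _) (zero_add _) ?_
    change 0 + a.kap + 0 * a.muᵀ - 0 * a.lamᵀ = a.kap
    simp
  mul_one a := by
    refine Heis.ext (add_zero _) (add_zero _) ?_
    change a.kap + 0 + a.lam * (0 : Matrix (Fin m) (Fin n) ℝ)ᵀ
      - a.mu * (0 : Matrix (Fin m) (Fin n) ℝ)ᵀ = a.kap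
    simp
  inv_mul_cancel a := by
    refine Heis.ext (neg_add_cancel _) (neg_add_cancel _) ?_
    change (-a.kap + a.lam * a.muᵀ - a.mu * a.lamᵀ) + a.kap + (-a.lam) * a.muᵀ
      - (-a.mu) * a.lamᵀ = 0
    simp only [Matrix.neg_mul]
    abel

/-- The right action of `Sp n` on the Heisenberg group,
`(λ, μ; κ) ↦ ((λ, μ) g; κ) = (λ A + μ C, λ B + μ D; κ)`. -/
def Heis.act (h : Heis n m) (g : Sp n) : Heis n m where
  lam := h.lam * g.A + h.mu * g.C
  mu := h.lam * g.B + h.mu * g.D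
  kap := h.kap
  symm := by
    have hg : g.1 * Matrix.J (Fin n) ℝ * g.1ᵀ = Matrix.J (Fin n) ℝ := SymplecticGroup.mem_iff.mp g.2
    rw [sp_eq g, Matrix.J, fromBlocks_transpose, fromBlocks_multiply, fromBlocks_multiply] at hg
    obtain ⟨e1, e2, e3, e4⟩ := fromBlocks_inj.mp hg
    simp only [Matrix.mul_zero, Matrix.mul_one, zero_add, Matrix.mul_neg, add_zero,
      Matrix.neg_mul] at e1 e2 e3 e4
    unfold Matrix.IsSymm
    simp only [Matrix.transpose_add, Matrix.transpose_mul, Matrix.transpose_transpose, h.kapT]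
    rw [← sub_eq_zero]
    have key : h.kap + h.mu * h.lamᵀ - h.lam * h.muᵀ
        + (h.lam * g.A + h.mu * g.C) * (g.Bᵀ * h.lamᵀ + g.Dᵀ * h.muᵀ)
        - (h.kap + (h.lam * g.B + h.mu * g.D) * (g.Aᵀ * h.lamᵀ + g.Cᵀ * h.muᵀ))
        = h.mu * h.lamᵀ - h.lam * h.muᵀ
          - (h.lam * (g.B * g.Aᵀ + -(g.A * g.Bᵀ)) * h.lamᵀ
            + h.lam * (g.B * g.Cᵀ + -(g.A * g.Dᵀ)) * h.muᵀ
            + h.mu * (g.D * g.Aᵀ + -(g.C * g.Bᵀ)) * h.lamᵀ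
            + h.mu * (g.D * g.Cᵀ + -(g.C * g.Dᵀ)) * h.muᵀ) := by
      simp only [Matrix.mul_add, Matrix.add_mul, Matrix.mul_neg, Matrix.neg_mul, Matrix.mul_assoc]
      abel
    rw [key, e1, e2, e3, e4]
    simp only [Matrix.mul_zero, Matrix.zero_mul, Matrix.mul_one, Matrix.mul_neg, Matrix.neg_mul]
    abel

theorem Heis.mul_act (a b : Heis n m) (g : Sp n) : (a * b).act g = a.act g * b.act g := by
  have hg : g.1 * Matrix.J (Fin n) ℝ * g.1ᵀ = Matrix.J (Fin n) ℝ := SymplecticGroup.mem_iff.mp g.2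
  rw [sp_eq g, Matrix.J, fromBlocks_transpose, fromBlocks_multiply, fromBlocks_multiply] at hg
  obtain ⟨e1, e2, e3, e4⟩ := fromBlocks_inj.mp hg
  simp only [Matrix.mul_zero, Matrix.mul_one, zero_add, Matrix.mul_neg, add_zero,
    Matrix.neg_mul] at e1 e2 e3 e4
  refine Heis.ext ?_ ?_ ?_
  · change (a.lam + b.lam) * g.A + (a.mu + b.mu) * g.C
      = (a.lam * g.A + a.mu * g.C) + (b.lam * g.A + b.mu * g.C)
    simp only [Matrix.add_mul]; abel
  · change (a.lam + b.lam) * g.B + (a.mu + b.mu) * g.D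
      = (a.lam * g.B + a.mu * g.D) + (b.lam * g.B + b.mu * g.D)
    simp only [Matrix.add_mul]; abel
  · change a.kap + b.kap + a.lam * b.muᵀ - a.mu * b.lamᵀ
      = a.kap + b.kap + (a.lam * g.A + a.mu * g.C) * (b.lam * g.B + b.mu * g.D)ᵀ
        - (a.lam * g.B + a.mu * g.D) * (b.lam * g.A + b.mu * g.C)ᵀ
    have key : a.kap + b.kap + (a.lam * g.A + a.mu * g.C) * (b.lam * g.B + b.mu * g.D)ᵀ
        - (a.lam * g.B + a.mu * g.D) * (b.lam * g.A + b.mu * g.C)ᵀ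
        = a.kap + b.kap - (a.lam * (g.B * g.Aᵀ + -(g.A * g.Bᵀ)) * b.lamᵀ
            + a.lam * (g.B * g.Cᵀ + -(g.A * g.Dᵀ)) * b.muᵀ
            + a.mu * (g.D * g.Aᵀ + -(g.C * g.Bᵀ)) * b.lamᵀ
            + a.mu * (g.D * g.Cᵀ + -(g.C * g.Dᵀ)) * b.muᵀ) := by
      simp only [Matrix.transpose_add, Matrix.transpose_mul, Matrix.mul_add, Matrix.add_mul,
        Matrix.mul_neg, Matrix.neg_mul, Matrix.mul_assoc]
      abel
    rw [key, e1, e2, e3, e4]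
    simp only [Matrix.mul_zero, Matrix.zero_mul, Matrix.mul_one, Matrix.mul_neg, Matrix.neg_mul]
    abel

theorem Heis.act_act (a : Heis n m) (g h : Sp n) : (a.act g).act h = a.act (g * h) := by
  obtain ⟨e1, e2, e3, e4⟩ := sp_mul g h
  refine Heis.ext ?_ ?_ rfl
  · change (a.lam * g.A + a.mu * g.C) * h.A + (a.lam * g.B + a.mu * g.D) * h.C
      = a.lam * (g * h).A + a.mu * (g * h).C
    rw [e1, e3]
    simp only [Matrix.mul_add, Matrix.add_mul, Matrix.mul_assoc]
    abel
  · change (a.lam * g.A + a.mu * g.C) * h.B + (a.lam * g.B + a.mu * g.D) * h.D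
      = a.lam * (g * h).B + a.mu * (g * h).D
    rw [e2, e4]
    simp only [Matrix.mul_add, Matrix.add_mul, Matrix.mul_assoc]
    abel

theorem Heis.act_one (a : Heis n m) : a.act 1 = a := by
  obtain ⟨e1, e2, e3, e4⟩ := sp_one (n := n)
  refine Heis.ext ?_ ?_ rfl
  · change a.lam * (1 : Sp n).A + a.mu * (1 : Sp n).C = a.lam
    simp [e1, e3]
  · change a.lam * (1 : Sp n).B + a.mu * (1 : Sp n).D = a.mu
    simp [e2, e4]

theorem Heis.one_act (g : Sp n) : (1 : Heis n m).act g = 1 := by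
  refine Heis.ext ?_ ?_ rfl
  · change (0 : Matrix (Fin m) (Fin n) ℝ) * g.A + (0 : Matrix (Fin m) (Fin n) ℝ) * g.C = 0
    simp
  · change (0 : Matrix (Fin m) (Fin n) ℝ) * g.B + (0 : Matrix (Fin m) (Fin n) ℝ) * g.D = 0
    simp

/-- The group `G_*^J = G_* ⋉ H`, with elements `((g, ε), (λ, μ; κ))`. -/
@[ext] structure GStarJ (n m : ℕ) where
  a : GStar n
  h : Heis n m

/-- The multiplication law is `(a, h) (a', h') = (a a', (h ⬝ g') ∘ h')` for `a' = (g', ε')`. -/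
noncomputable instance : Group (GStarJ n m) where
  mul x y := ⟨x.a * y.a, x.h.act y.a.g * y.h⟩
  one := ⟨1, 1⟩
  inv x := ⟨x.a⁻¹, x.h⁻¹.act (x.a⁻¹).g⟩
  mul_assoc x y z := by
    refine GStarJ.ext (mul_assoc _ _ _) ?_
    change (x.h.act y.a.g * y.h).act z.a.g * z.h
      = x.h.act (y.a.g * z.a.g) * (y.h.act z.a.g * z.h)
    rw [Heis.mul_act, Heis.act_act, mul_assoc]
  one_mul x := by
    refine GStarJ.ext (one_mul _) ?_
    change (1 : Heis n m).act x.a.g * x.h = x.h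
    rw [Heis.one_act, one_mul]
  mul_one x := by
    refine GStarJ.ext (mul_one _) ?_
    change x.h.act 1 * 1 = x.h
    rw [Heis.act_one, mul_one]
  inv_mul_cancel x := by
    refine GStarJ.ext (inv_mul_cancel _) ?_
    change (x.h⁻¹.act (x.a.g⁻¹)).act x.a.g * x.h = 1
    rw [Heis.act_act, inv_mul_cancel, Heis.act_one, inv_mul_cancel]

/-- The Siegel-Jacobi space, with points `(Ω, Z)`. -/
abbrev SiegelJacobi (n m : ℕ) : Type := SiegelHalf n × Matrix (Fin m) (Fin n) ℂ

/-- `Z + λ Ω + μ`. -/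
def shiftZ (h : Heis n m) (p : SiegelJacobi n m) : Matrix (Fin m) (Fin n) ℂ :=
  p.2 + toC h.lam * p.1.1 + toC h.mu

/-- `((g, ε), (λ, μ; κ)) ⬝ (Ω, Z) = (g ⬝ Ω, (Z + λ Ω + μ) (C Ω + D)⁻¹)`. -/
noncomputable instance : SMul (GStarJ n m) (SiegelJacobi n m) where
  smul x p := (x.a.g • p.1, shiftZ x.h p * (denom x.a.g p.1.1)⁻¹)

/-- The automorphic factor `J*_M`. -/
noncomputable def jStar (M : Matrix (Fin m) (Fin m) ℝ) (x : GStarJ n m) (p : SiegelJacobi n m) : ℂ :=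
  Complex.exp (π * Complex.I * Matrix.trace (toC M *
      (shiftZ x.h p * (denom x.a.g p.1.1)⁻¹ * toC x.a.g.C * (shiftZ x.h p)ᵀ)))
    * Complex.exp (-(π * Complex.I * Matrix.trace (toC M *
      (toC x.h.lam * p.1.1 * (toC x.h.lam)ᵀ + (2 : ℂ) • (toC x.h.lam * p.2ᵀ)
        + toC x.h.kap + toC x.h.mu * (toC x.h.lam)ᵀ))))
    * jHalf x.a p.1 ^ m

/-- Lebesgue measure on the space of real matrices. -/
noncomputable instance (m n : ℕ) : MeasureSpace (Matrix (Fin m) (Fin n) ℝ) :=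
  inferInstanceAs (MeasureSpace (Fin m → Fin n → ℝ))

instance (m n : ℕ) : BorelSpace (Matrix (Fin m) (Fin n) ℝ) :=
  inferInstanceAs (BorelSpace (Fin m → Fin n → ℝ))

/-- The Hilbert space `L²(ℝ^(m,n))`. -/
abbrev L2 (n m : ℕ) : Type := Lp ℂ 2 (volume : Measure (Matrix (Fin m) (Fin n) ℝ))

/-- The function `x ↦ exp (π i σ(M (x Ω xᵀ + 2 x Zᵀ)))`. -/
noncomputable def gaussFun (M : Matrix (Fin m) (Fin m) ℝ) (p : SiegelJacobi n m)
    (x : Matrix (Fin m) (Fin n) ℝ) : ℂ :=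
  Complex.exp (π * Complex.I * Matrix.trace (toC M *
    (toC x * p.1.1 * (toC x)ᵀ + (2 : ℂ) • (toC x * p.2ᵀ))))

theorem continuous_gaussFun (M : Matrix (Fin m) (Fin m) ℝ) (p : SiegelJacobi n m) :
    Continuous (gaussFun M p) := by
  have h : Continuous fun x : Matrix (Fin m) (Fin n) ℝ => toC x :=
    continuous_id.matrix_map Complex.continuous_ofReal
  unfold gaussFun
  refine Complex.continuous_exp.comp (continuous_const.mul (Continuous.matrix_trace ?_))
  fun_prop

/-- The quadratic form `x ↦ σ(M x Y xᵀ)`. -/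
def quadM (M : Matrix (Fin m) (Fin m) ℝ) (Y : Matrix (Fin n) (Fin n) ℝ)
    (x : Matrix (Fin m) (Fin n) ℝ) : ℝ := Matrix.trace (M * (x * Y * xᵀ))

theorem norm_gaussFun (M : Matrix (Fin m) (Fin m) ℝ) (p : SiegelJacobi n m)
    (x : Matrix (Fin m) (Fin n) ℝ) :
    ‖gaussFun M p x‖ = Real.exp (-(π * quadM M (p.1.1.map Complex.im) x)
      + -(2 * π * Matrix.trace (M * (x * (p.2.map Complex.im)ᵀ)))) := by
  have h : (Matrix.trace (toC M * (toC x * p.1.1 * (toC x)ᵀ + (2 : ℂ) • (toC x * p.2ᵀ)))).im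
      = quadM M (p.1.1.map Complex.im) x
        + 2 * Matrix.trace (M * (x * (p.2.map Complex.im)ᵀ)) := by
    simp only [quadM, Matrix.trace, Matrix.diag, Matrix.mul_apply, toC, Matrix.map_apply,
      Matrix.add_apply, Matrix.smul_apply, Matrix.transpose_apply, Complex.im_sum, mul_add,
      Finset.sum_add_distrib, smul_eq_mul, Finset.mul_sum, Complex.add_im, Finset.sum_mul]
    congr 1
    · refine Finset.sum_congr rfl fun i _ => Finset.sum_congr rfl fun j _ =>
        Finset.sum_congr rfl fun k _ => Finset.sum_congr rfl fun l _ => ?_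
      simp
    · refine Finset.sum_congr rfl fun i _ => Finset.sum_congr rfl fun j _ =>
        Finset.sum_congr rfl fun k _ => ?_
      simp
      ring
  rw [gaussFun, Complex.norm_exp]
  congr 1
  have : ∀ z : ℂ, ((π : ℂ) * Complex.I * z).re = -(π * z.im) := fun z => by simp
  rw [this, h]
  ring

theorem quadM_pos {M : Matrix (Fin m) (Fin m) ℝ} {Y : Matrix (Fin n) (Fin n) ℝ} (hM : M.PosDef)
    (hY : Y.PosDef) {x : Matrix (Fin m) (Fin n) ℝ} (hx : x ≠ 0) : 0 < quadM M Y x := by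
  have h := hM.kronecker hY
  have hv : (fun ij : Fin m × Fin n => x ij.1 ij.2) ≠ 0 := by
    intro h0
    apply hx
    ext i j
    exact congrFun h0 (i, j)
  have h1 := h.dotProduct_mulVec_pos hv
  have hs : ∀ i j, Y i j = Y j i := fun i j => by simpa using (hY.1.apply j i)
  have hs' : ∀ i j, M i j = M j i := fun i j => by simpa using (hM.1.apply j i)
  suffices key : quadM M Y x = star (fun ij : Fin m × Fin n => x ij.1 ij.2) ⬝ᵥ
      (Matrix.kroneckerMap (· * ·) M Y *ᵥ fun ij : Fin m × Fin n => x ij.1 ij.2) by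
    rw [key]; exact h1
  simp only [quadM, Matrix.trace, Matrix.diag, Matrix.mul_apply, Matrix.transpose_apply,
    dotProduct, Matrix.mulVec, Matrix.kroneckerMap_apply, Fintype.sum_prod_type, Finset.mul_sum,
    Finset.sum_mul, star_trivial]
  refine Finset.sum_congr rfl fun i _ => ?_
  rw [Finset.sum_comm]
  refine Finset.sum_congr rfl fun l _ => Finset.sum_congr rfl fun k _ =>
    Finset.sum_congr rfl fun j _ => ?_
  rw [hs l j]
  ring

theorem quadM_lower {M : Matrix (Fin m) (Fin m) ℝ} {Y : Matrix (Fin n) (Fin n) ℝ} (hM : M.PosDef)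
    (hY : Y.PosDef) : ∃ c : ℝ, 0 < c ∧ ∀ x : Fin m → Fin n → ℝ,
      c * ∑ i, ∑ j, x i j ^ 2 ≤ quadM M Y x := by
  have hcont : Continuous fun x : Fin m → Fin n → ℝ => quadM M Y x := by
    have : Continuous fun x : Matrix (Fin m) (Fin n) ℝ => quadM M Y x := by
      unfold quadM
      refine Continuous.matrix_trace ?_
      fun_prop
    exact this
  have hhom : ∀ (t : ℝ) (x : Fin m → Fin n → ℝ), quadM M Y (t • x) = t ^ 2 * quadM M Y x := by
    suffices h : ∀ (t : ℝ) (x : Matrix (Fin m) (Fin n) ℝ),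
        quadM M Y (t • x) = t ^ 2 * quadM M Y x from h
    intro t x
    simp only [Matrix.transpose_smul, Matrix.smul_mul, Matrix.mul_smul, Matrix.trace_smul, quadM,
      smul_eq_mul]
    ring
  have hsum : ∀ x : Fin m → Fin n → ℝ, ∑ i, ∑ j, x i j ^ 2 ≤ ((m : ℝ) * n + 1) * ‖x‖ ^ 2 := by
    intro x
    have h1 : ∀ i j, x i j ^ 2 ≤ ‖x‖ ^ 2 := fun i j => by
      rw [← sq_abs]
      exact pow_le_pow_left₀ (abs_nonneg _)
        ((norm_le_pi_norm (x i) j).trans (norm_le_pi_norm x i)) 2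
    calc ∑ i, ∑ j, x i j ^ 2 ≤ ∑ _i : Fin m, ∑ _j : Fin n, ‖x‖ ^ 2 :=
          Finset.sum_le_sum fun i _ => Finset.sum_le_sum fun j _ => h1 i j
      _ = (m : ℝ) * n * ‖x‖ ^ 2 := by simp; ring
      _ ≤ _ := by nlinarith [sq_nonneg ‖x‖]
  have hpos : (0 : ℝ) < (m : ℝ) * n + 1 := by positivity
  obtain ⟨c, hc, hcq⟩ : ∃ c : ℝ, 0 < c ∧ ∀ x : Fin m → Fin n → ℝ, c * ‖x‖ ^ 2 ≤ quadM M Y x := by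
    have h0 : quadM M Y (0 : Fin m → Fin n → ℝ) = 0 := by
      simpa using hhom 0 0
    rcases (Metric.sphere (0 : Fin m → Fin n → ℝ) 1).eq_empty_or_nonempty with he | hne
    · refine ⟨1, one_pos, fun x => ?_⟩
      have hx : x = 0 := by
        by_contra hx
        have : ‖x‖⁻¹ • x ∈ Metric.sphere (0 : Fin m → Fin n → ℝ) 1 := by
          simp [norm_smul, hx]
        rw [he] at this
        exact this
      rw [hx, h0]; simp
    · obtain ⟨y, hy, hmin⟩ := (isCompact_sphere (0 : Fin m → Fin n → ℝ) 1).exists_isMinOn hne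
        hcont.continuousOn
      have hy0 : y ≠ 0 := by
        rintro rfl
        simp at hy
      refine ⟨quadM M Y y, quadM_pos hM hY hy0, fun x => ?_⟩
      by_cases hx : x = 0
      · rw [hx, h0]; simp
      · have hx' : ‖x‖ ≠ 0 := norm_ne_zero_iff.mpr hx
        have h1 : ‖x‖⁻¹ • x ∈ Metric.sphere (0 : Fin m → Fin n → ℝ) 1 := by
          simp [norm_smul, hx]
        have h2 : quadM M Y y ≤ quadM M Y (‖x‖⁻¹ • x) := hmin h1
        rw [hhom] at h2
        calc quadM M Y y * ‖x‖ ^ 2 ≤ (‖x‖⁻¹ ^ 2 * quadM M Y x) * ‖x‖ ^ 2 := by gcongr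
          _ = quadM M Y x := by field_simp
  refine ⟨c / ((m : ℝ) * n + 1), by positivity, fun x => le_trans ?_ (hcq x)⟩
  rw [div_mul_eq_mul_div, div_le_iff₀ hpos]
  nlinarith [hsum x]

theorem memLp_gaussFun {M : Matrix (Fin m) (Fin m) ℝ} (hM : M.PosDef) (p : SiegelJacobi n m) :
    MemLp (gaussFun M p) 2 volume := by
  have hmeas : AEStronglyMeasurable (gaussFun M p) volume :=
    (continuous_gaussFun M p).measurable.aestronglyMeasurable
  rw [memLp_two_iff_integrable_sq_norm hmeas]
  obtain ⟨c, hc, hq⟩ := quadM_lower hM p.1.2.2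
  let b : Matrix (Fin m) (Fin n) ℝ := Mᵀ * p.2.map Complex.im
  have hb : ∀ x : Matrix (Fin m) (Fin n) ℝ,
      Matrix.trace (M * (x * (p.2.map Complex.im)ᵀ)) = ∑ i, ∑ j, b i j * x i j := by
    intro x
    have h1 : Matrix.trace (M * (x * (p.2.map Complex.im)ᵀ)) = Matrix.trace (bᵀ * x) := by
      simp only [b, Matrix.transpose_mul, Matrix.transpose_transpose]
      rw [Matrix.mul_assoc, Matrix.trace_mul_comm (p.2.map Complex.im)ᵀ, Matrix.mul_assoc]
    rw [h1]
    simp only [Matrix.trace, Matrix.diag, Matrix.mul_apply, Matrix.transpose_apply]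
    exact Finset.sum_comm
  have hone : ∀ β : ℝ, Integrable fun t : ℝ => Real.exp (-(2 * π * c) * t ^ 2 + β * t) := by
    intro β
    have h := (integrable_cexp_quadratic (b := ((2 * π * c : ℝ) : ℂ))
      (by rw [Complex.ofReal_re]; positivity) (β : ℂ) 0).norm
    refine h.congr (Filter.Eventually.of_forall fun t => ?_)
    simp only [Complex.norm_exp]
    congr 1
    have : (-((2 * π * c : ℝ) : ℂ) * (t : ℂ) ^ 2 + (β : ℂ) * t + 0)
        = ((-(2 * π * c) * t ^ 2 + β * t : ℝ) : ℂ) := by push_cast; ring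
    rw [this, Complex.ofReal_re]
  have hprod : Integrable (fun x : Fin m → Fin n → ℝ =>
      ∏ i, ∏ j, Real.exp (-(2 * π * c) * x i j ^ 2 + (-(4 * π * b i j)) * x i j)) volume := by
    refine Integrable.fintype_prod (f := fun i (y : Fin n → ℝ) =>
      ∏ j, Real.exp (-(2 * π * c) * y j ^ 2 + (-(4 * π * b i j)) * y j)) fun i => ?_
    exact Integrable.fintype_prod (f := fun j (t : ℝ) =>
      Real.exp (-(2 * π * c) * t ^ 2 + (-(4 * π * b i j)) * t)) fun j => hone _
  refine Integrable.mono' (μ := (volume : Measure (Matrix (Fin m) (Fin n) ℝ))) hprod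
    (hmeas.norm.pow 2) (Filter.Eventually.of_forall fun x => ?_)
  rw [norm_gaussFun, ← Real.exp_nat_mul, Real.norm_eq_abs, Real.abs_exp]
  simp only [← Real.exp_sum]
  rw [Real.exp_le_exp, hb]
  have h1 := mul_le_mul_of_nonneg_left (hq x) (by positivity : (0 : ℝ) ≤ 2 * π)
  simp only [Finset.sum_add_distrib, ← Finset.mul_sum]
  have h2 : ∑ i, ∑ j, -(4 * π * b i j) * x i j = -(4 * π) * ∑ i, ∑ j, b i j * x i j := by
    simp only [Finset.mul_sum]
    exact Finset.sum_congr rfl fun i _ => Finset.sum_congr rfl fun j _ => by ring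
  rw [h2]
  push_cast
  nlinarith [h1]

/-- The map `F^(M)` from the Siegel-Jacobi space to `L²(ℝ^(m,n))`. -/
noncomputable def covMap {M : Matrix (Fin m) (Fin m) ℝ} (hM : M.PosDef) (p : SiegelJacobi n m) :
    L2 n m :=
  (memLp_gaussFun hM p).toLp (gaussFun M p)

/-- `ω` is the Schrödinger-Weil representation of `G_*^J` on `L²(ℝ^(m,n))` with central character
`κ ↦ exp (π i σ(M κ))`: a homomorphism to the unitary group which is the Schrödinger
representation `W` on the Heisenberg group, and which is given by the explicit formulas of the Weil
representation on the elements of `G_*` over the generators `t(b) = (1, b; 0, 1)`,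
`g(α) = (αᵀ, 0; 0, α⁻¹)` and `σ_n = (0, -1; 1, 0)` of `Sp n`.

Over `t(b)`, `g(α)`, `σ_n` one has `ε ^ 2 = 1`, `ε ^ 2 = sgn (det α)`, `ε ^ 2 = (1 / i) ^ n`
respectively, so `ε ^ m` is the constant `1`, `(sgn (det α)) ^ (m / 2)`, `(1 / i) ^ (m n / 2)` of the
classical formulas if `ε` is the principal root, and the other choice of `ε` changes the operator
by the factor `(-1) ^ m`.  Since `ω` is multiplicative, the relation
`ω(g) W(h) ω(g)⁻¹ = W(g h g⁻¹)` is part of the definition. -/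
structure IsSchrodingerWeil (M : Matrix (Fin m) (Fin m) ℝ)
    (ω : GStarJ n m →* (L2 n m ≃ₗᵢ[ℂ] L2 n m)) : Prop where
  heis : ∀ (h : Heis n m) (f : L2 n m), ω ⟨1, h⟩ f =ᵐ[volume] fun x =>
    Complex.exp (π * Complex.I * Matrix.trace (M * (h.kap + h.mu * h.lamᵀ
      + (2 : ℝ) • (x * h.muᵀ))) ) * f (x + h.lam)
  trans : ∀ (a : GStar n) (b : Matrix (Fin n) (Fin n) ℝ), b.IsSymm →
    a.g.1 = fromBlocks 1 b 0 1 → ∀ f : L2 n m, ω ⟨a, 1⟩ f =ᵐ[volume] fun x =>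
      a.ε ^ m * Complex.exp (π * Complex.I * Matrix.trace (M * (x * b * xᵀ))) * f x
  dil : ∀ (a : GStar n) (α : Matrix (Fin n) (Fin n) ℝ), IsUnit α →
    a.g.1 = fromBlocks αᵀ 0 0 α⁻¹ → ∀ f : L2 n m, ω ⟨a, 1⟩ f =ᵐ[volume] fun x =>
      a.ε ^ m * ((|α.det| ^ ((m : ℝ) / 2) : ℝ) : ℂ) * f (x * αᵀ)
  fourier : ∀ a : GStar n, a.g.1 = fromBlocks 0 (-1) 1 0 → ∀ f : L2 n m, Integrable f volume →
    ω ⟨a, 1⟩ f =ᵐ[volume] fun x =>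
      a.ε ^ m * ((M.det ^ ((n : ℝ) / 2) : ℝ) : ℂ) *
        ∫ y : Matrix (Fin m) (Fin n) ℝ,
          Complex.exp (-(2 * π * Complex.I * Matrix.trace (M * (y * xᵀ)))) * f y

end Jacobi

end JacobiWeil

/-!
The covariance relation is used as the definition of the representation. The Gaussians `F_p`,
`p = (Ω, Z)`, are total in `L²` (`dense_span_covMap`), because multiplying the Gaussian at
`(i I_n, 0)` by all characters of `ℝ^(m,n)` stays in the family, and an integrable function with
vanishing Fourier transform is zero. Their inner products are computed in closed form from the
Gaussian integral (`integral_gaussFun`), and this kernel satisfies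

  `⟨F_{x q}, F_{x p}⟩ = J*(x, p) conj J*(x, q) ⟨F_q, F_p⟩`

(`inner_covMap_smul`). On the determinant part this is the definition of `ε(g; Ω', Ω)` together with
its cocycle property; on the exponents it is an identity between matrices. Hence
`F_p ↦ J*(x, p)⁻¹ F_{x p}` preserves the Gram matrix of a total family and extends to a unitary
operator `weilOp x`. The cocycle relation `J*(x y, p) = J*(x, y p) J*(y, p)` (`jStar_mul`) makes
`weilRep` a homomorphism. The value of the automorphic factor, including the branch of its square
root, is thus built in, and what remains is to see that this is the Schrödinger-Weil representation.

Over the Heisenberg group, `t(b)` and `g(α)` the prescribed operators are bounded weighted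
compositions, so agreement on Gaussians suffices (`ae_eq_weighted_comp`). Over `σ_n` the prescribed
formula only makes sense for integrable `f`. It holds for Gaussians by the Gaussian integral, and it
is carried over to integrable `f` by pairing with Gaussians: by Fubini both the Fourier transform
and the operator are symmetric for the bilinear form `∫ f g` (`weilRep_fourier`).

Uniqueness holds because `t(b)`, `g(α)` and `σ_n` generate `Sp n` (`sp_subgroup_eq_top`), the kernel
of `G_* → Sp n` lies over `t(0)`, and over `σ_n` the integral formula on the integrable total family
of Gaussians already fixes a unitary operator.

The lemmas are stated for an arbitrary real positive definite `M`.
-/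

namespace JacobiWeil

/-! ### The holomorphic square root of the determinant -/

/-- A continuous square root of `det S` on a connected space is the branch `detSqrt` as soon as the
two agree at one point. -/
theorem detSqrt_eq_of_continuous {n : ℕ} {X : Type*} [TopologicalSpace X] [PreconnectedSpace X]
    {S : X → Matrix (Fin n) (Fin n) ℂ} (hS : Continuous S) (hmem : ∀ x, S x ∈ symmRePos n)
    {φ : X → ℂ} (hφ : Continuous φ) (hsq : ∀ x, φ x ^ 2 = (S x).det) (x₀ : X)
    (h₀ : φ x₀ = detSqrt n (S x₀)) (x : X) : φ x = detSqrt n (S x) := by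
  have hc : Continuous fun x => detSqrt n (S x) :=
    (isDetSqrt_detSqrt n).holomorphic.continuousOn.comp_continuous hS hmem
  refine isPreconnected_univ.eq_of_sq_eq hφ.continuousOn hc.continuousOn ?_
    (fun {x} _ => (isDetSqrt_detSqrt n).ne_zero (hmem x)) (Set.mem_univ x₀) h₀ (Set.mem_univ x)
  intro x _
  simp only [Pi.pow_apply, hsq, (isDetSqrt_detSqrt n).sq _ (hmem x)]

theorem detSqrt_one (n : ℕ) : detSqrt n 1 = 1 := by
  have := (isDetSqrt_detSqrt n).real 1 Matrix.PosDef.one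
  rw [show (1 : Matrix (Fin n) (Fin n) ℝ).map Complex.ofReal = 1 from toC_one] at this
  simpa using this

theorem det_toC {n : ℕ} (X : Matrix (Fin n) (Fin n) ℝ) : (toC X).det = (X.det : ℂ) :=
  (RingHom.map_det Complex.ofRealHom X).symm

theorem map_re_toC_mul_mul_toC {n : ℕ} (P Q : Matrix (Fin n) (Fin n) ℝ)
    (S : Matrix (Fin n) (Fin n) ℂ) :
    (toC P * S * toC Q).map Complex.re = P * S.map Complex.re * Q := by
  ext i j
  simp [Matrix.mul_apply, toC, Finset.sum_mul]

theorem toC_transpose {k l : ℕ} (X : Matrix (Fin k) (Fin l) ℝ) : (toC X)ᵀ = toC Xᵀ := rfl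

/-- Congruence by an invertible real matrix preserves `symmRePos`. -/
theorem congr_mem_symmRePos {n : ℕ} {P : Matrix (Fin n) (Fin n) ℝ} (hP : P.det ≠ 0)
    {S : Matrix (Fin n) (Fin n) ℂ} (hS : S ∈ symmRePos n) :
    toC P * S * toC Pᵀ ∈ symmRePos n := by
  refine ⟨?_, ?_⟩
  · have h : Sᵀ = S := hS.1
    simp only [Matrix.IsSymm, Matrix.transpose_mul, h, toC_transpose, Matrix.transpose_transpose,
      Matrix.mul_assoc]
  · rw [map_re_toC_mul_mul_toC]
    have hu : IsUnit P := (Matrix.isUnit_iff_isUnit_det P).mpr (isUnit_iff_ne_zero.mpr hP)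
    have := (Matrix.IsUnit.posDef_star_right_conjugate_iff (x := S.map Complex.re) hu).mpr hS.2
    simpa [Matrix.star_eq_conjTranspose] using this

/-- Both sides are continuous square roots of `det (P S Pᵗ)`, and they agree at `S = 1`. -/
theorem detSqrt_congr {n : ℕ} {P : Matrix (Fin n) (Fin n) ℝ} (hP : P.det ≠ 0)
    {S : Matrix (Fin n) (Fin n) ℂ} (hS : S ∈ symmRePos n) :
    detSqrt n (toC P * S * toC Pᵀ) = (|P.det| : ℝ) * detSqrt n S := by
  have : PreconnectedSpace (symmRePos n) :=
    Subtype.preconnectedSpace (convex_symmRePos n).isPreconnected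
  have hc : Continuous fun S : symmRePos n => detSqrt n S.1 :=
    (isDetSqrt_detSqrt n).holomorphic.continuousOn.comp_continuous continuous_subtype_val
      fun S => S.2
  refine (detSqrt_eq_of_continuous (X := symmRePos n)
    (S := fun S => toC P * S.1 * toC Pᵀ)
    (φ := fun S => (|P.det| : ℝ) * detSqrt n S.1) (by fun_prop)
    (fun S => congr_mem_symmRePos hP S.2) (continuous_const.mul hc) (fun S => ?_)
    ⟨1, one_mem_symmRePos n⟩ ?_ ⟨S, hS⟩).symm
  · rw [mul_pow, (isDetSqrt_detSqrt n).sq _ S.2, Matrix.det_mul, Matrix.det_mul, det_toC, det_toC,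
      Matrix.det_transpose, ← Complex.ofReal_pow, sq_abs]
    push_cast; ring
  · have hp : (P * Pᵀ).PosDef := by
      have hu : IsUnit P := (Matrix.isUnit_iff_isUnit_det P).mpr (isUnit_iff_ne_zero.mpr hP)
      have := (Matrix.IsUnit.posDef_star_right_conjugate_iff (x := (1 : Matrix (Fin n) (Fin n) ℝ))
        hu).mpr Matrix.PosDef.one
      simpa [Matrix.star_eq_conjTranspose] using this
    have h1 := (isDetSqrt_detSqrt n).real _ hp
    rw [Matrix.det_mul, Matrix.det_transpose, ← pow_two, Real.sqrt_sq_eq_abs] at h1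
    have h2 : toC P * 1 * toC Pᵀ = (P * Pᵀ).map Complex.ofReal := by
      rw [Matrix.mul_one, ← toC_mul]; rfl
    change _ = detSqrt n (toC P * 1 * toC Pᵀ)
    rw [h2, h1, detSqrt_one, mul_one]

theorem diagonal_mem_symmRePos {n : ℕ} {d : Fin n → ℂ} (hd : ∀ j, 0 < (d j).re) :
    Matrix.diagonal d ∈ symmRePos n := by
  refine ⟨Matrix.isSymm_diagonal d, ?_⟩
  have : (Matrix.diagonal d).map Complex.re = Matrix.diagonal fun j => (d j).re := by
    rw [Matrix.diagonal_map (by simp)]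
  rw [this]
  exact Matrix.PosDef.diagonal hd

/-- The branch is transported from the identity matrix along `t ↦ diag (1 - i t d_j)`. -/
theorem detSqrt_diagonal {n : ℕ} (d : Fin n → ℝ) :
    detSqrt n (Matrix.diagonal fun j => 1 - Complex.I * d j)
      = ∏ j, (1 - Complex.I * (d j : ℂ)) ^ (1 / 2 : ℂ) := by
  have hre : ∀ (t : ℝ) j, 0 < (1 - Complex.I * ((t * d j : ℝ) : ℂ)).re := fun t j => by simp
  have h := detSqrt_eq_of_continuous (X := ℝ)
    (S := fun t => Matrix.diagonal fun j => 1 - Complex.I * ((t * d j : ℝ) : ℂ))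
    (φ := fun t => ∏ j, (1 - Complex.I * ((t * d j : ℝ) : ℂ)) ^ (1 / 2 : ℂ))
    (Continuous.matrix_diagonal (by fun_prop))
    (fun t => diagonal_mem_symmRePos (hre t))
    (continuous_finsetProd _ fun j _ => Continuous.cpow (by fun_prop) continuous_const
      fun t => Or.inl (hre t j))
    (fun t => by
      rw [Matrix.det_diagonal, ← Finset.prod_pow]
      refine Finset.prod_congr rfl fun j _ => ?_
      rw [← Complex.cpow_nat_mul]; norm_num) 0 (by simp [detSqrt_one]) 1
  simpa using h.symm

/-! ### Lebesgue measure and normal forms on matrix spaces -/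

section MatrixMeasure

variable {n m : ℕ}

instance : SigmaFinite (volume : Measure (Matrix (Fin m) (Fin n) ℝ)) :=
  inferInstanceAs (SigmaFinite (volume : Measure (Fin m → Fin n → ℝ)))

instance : SecondCountableTopology (Matrix (Fin m) (Fin n) ℝ) :=
  inferInstanceAs (SecondCountableTopology (Fin m → Fin n → ℝ))

theorem isAddHaarMeasure_volume_pi (m n : ℕ) :
    (volume : Measure (Fin m → Fin n → ℝ)).IsAddHaarMeasure :=
  Measure.pi.isAddHaarMeasure _

instance : (volume : Measure (Matrix (Fin m) (Fin n) ℝ)).IsAddLeftInvariant :=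
  have := isAddHaarMeasure_volume_pi m n
  inferInstanceAs (volume : Measure (Fin m → Fin n → ℝ)).IsAddLeftInvariant

theorem map_linear_volume (f : Matrix (Fin m) (Fin n) ℝ →ₗ[ℝ] Matrix (Fin m) (Fin n) ℝ)
    (hf : LinearMap.det f ≠ 0) :
    Measure.map f volume = ENNReal.ofReal |(LinearMap.det f)⁻¹| • volume := by
  have := isAddHaarMeasure_volume_pi m n
  exact Measure.map_linearMap_addHaar_eq_smul_addHaar
    (E := Fin m → Fin n → ℝ) (volume : Measure (Fin m → Fin n → ℝ)) hf

/-- Right multiplication by `P` on `m × n` matrices. -/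
def mulRightLin (m : ℕ) (P : Matrix (Fin n) (Fin n) ℝ) :
    Matrix (Fin m) (Fin n) ℝ →ₗ[ℝ] Matrix (Fin m) (Fin n) ℝ where
  toFun x := x * P
  map_add' x y := Matrix.add_mul x y P
  map_smul' c x := Matrix.smul_mul c x P

/-- Left multiplication by `L` on `m × n` matrices. -/
def mulLeftLin (n : ℕ) (L : Matrix (Fin m) (Fin m) ℝ) :
    Matrix (Fin m) (Fin n) ℝ →ₗ[ℝ] Matrix (Fin m) (Fin n) ℝ where
  toFun x := L * x
  map_add' x y := Matrix.mul_add L x y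
  map_smul' c x := Matrix.mul_smul L c x

theorem det_mulRightLin (m : ℕ) (P : Matrix (Fin n) (Fin n) ℝ) :
    LinearMap.det (mulRightLin m P) = P.det ^ m := by
  have h : LinearMap.det (LinearMap.pi fun i : Fin m =>
      P.vecMulLinear ∘ₗ (LinearMap.proj i : (Fin m → Fin n → ℝ) →ₗ[ℝ] _)) = P.det ^ m := by
    rw [LinearMap.det_pi, ← Matrix.mulVecLin_transpose, ← Matrix.toLin'_apply',
      LinearMap.det_toLin']
    simp
  exact h

theorem det_mulLeftLin (n : ℕ) (L : Matrix (Fin m) (Fin m) ℝ) :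
    LinearMap.det (mulLeftLin n L) = L.det ^ n := by
  have h := LinearMap.det_conj (mulRightLin n Lᵀ)
    (Matrix.transposeLinearEquiv (Fin n) (Fin m) ℝ ℝ)
  rw [det_mulRightLin, Matrix.det_transpose] at h
  rw [← h]
  congr 1
  ext x : 1
  simp [mulRightLin, mulLeftLin]

/-- Change of variables `u = L x P` on the space of real matrices. -/
theorem integral_comp_mul_mul {L : Matrix (Fin m) (Fin m) ℝ} {P : Matrix (Fin n) (Fin n) ℝ}
    (hL : L.det ≠ 0) (hP : P.det ≠ 0) (f : Matrix (Fin m) (Fin n) ℝ → ℂ) :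
    ∫ x : Matrix (Fin m) (Fin n) ℝ, f (L * x * P)
      = ((|L.det| ^ n)⁻¹ * (|P.det| ^ m)⁻¹ : ℝ) * ∫ u, f u := by
  let T := (mulRightLin m P) ∘ₗ (mulLeftLin n L)
  have hdet : LinearMap.det T = P.det ^ m * L.det ^ n := by
    rw [LinearMap.det_comp, det_mulRightLin, det_mulLeftLin]
  have h0 : LinearMap.det T ≠ 0 := by
    rw [hdet]; exact mul_ne_zero (pow_ne_zero _ hP) (pow_ne_zero _ hL)
  have hT : Continuous T := by
    change Continuous fun x : Matrix (Fin m) (Fin n) ℝ => L * x * P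
    fun_prop
  have hinv : ∀ x, L⁻¹ * T x * P⁻¹ = x := fun x => by
    change L⁻¹ * (L * x * P) * P⁻¹ = x
    rw [← Matrix.mul_assoc, ← Matrix.mul_assoc,
      Matrix.nonsing_inv_mul _ (isUnit_iff_ne_zero.mpr hL), Matrix.one_mul, Matrix.mul_assoc,
      Matrix.mul_nonsing_inv _ (isUnit_iff_ne_zero.mpr hP), Matrix.mul_one]
  have hemb : MeasurableEmbedding T := by
    let e : Matrix (Fin m) (Fin n) ℝ ≃ₜ Matrix (Fin m) (Fin n) ℝ :=
      { toFun := T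
        invFun := fun x => L⁻¹ * x * P⁻¹
        left_inv := hinv
        right_inv := fun x => by
          change L * (L⁻¹ * x * P⁻¹) * P = x
          rw [← Matrix.mul_assoc, ← Matrix.mul_assoc,
            Matrix.mul_nonsing_inv _ (isUnit_iff_ne_zero.mpr hL), Matrix.one_mul, Matrix.mul_assoc,
            Matrix.nonsing_inv_mul _ (isUnit_iff_ne_zero.mpr hP), Matrix.mul_one]
        continuous_toFun := hT
        continuous_invFun := by fun_prop }
    exact e.measurableEmbedding
  have h := hemb.integral_map (μ := volume) f
  rw [map_linear_volume T h0, integral_smul_measure, hdet] at h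
  change ∫ x, f (T x) = _
  rw [← h, ENNReal.toReal_ofReal (abs_nonneg _), Complex.real_smul, abs_inv, abs_mul, abs_pow,
    abs_pow, mul_inv, mul_comm (|P.det| ^ m)⁻¹]

end MatrixMeasure

section Factorization

theorem isSymm_of_posDef {m : ℕ} {M : Matrix (Fin m) (Fin m) ℝ} (hM : M.PosDef) : M.IsSymm := by
  have := hM.1
  rwa [Matrix.IsHermitian, Matrix.conjTranspose_eq_transpose_of_trivial] at this

theorem exists_transpose_mul_self {k : ℕ} {M : Matrix (Fin k) (Fin k) ℝ} (hM : M.PosDef) :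
    ∃ L : Matrix (Fin k) (Fin k) ℝ, L.det ≠ 0 ∧ M = Lᵀ * L := by
  have key : ∃ L : Matrix (Fin k) (Fin k) ℝ, M = Lᵀ * L := by
    open scoped MatrixOrder Matrix.Norms.L2Operator in
    obtain ⟨L, hL, h⟩ := CStarAlgebra.isStrictlyPositive_iff_eq_star_mul_self.mp
      hM.isStrictlyPositive
    exact ⟨L, by simpa [Matrix.star_eq_conjTranspose] using h⟩
  obtain ⟨L, h⟩ := key
  refine ⟨L, fun h0 => ?_, h⟩
  have := hM.det_pos
  rw [h, Matrix.det_mul, h0] at this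
  simp at this

/-- Simultaneous diagonalization of the real and imaginary parts of a point of the Siegel upper
half plane. -/
theorem siegel_diagonalize {n : ℕ} (Ω : SiegelHalf n) :
    ∃ (P : Matrix (Fin n) (Fin n) ℝ) (d : Fin n → ℝ), P.det ≠ 0 ∧
      Ω.1 = toC P * Matrix.diagonal (fun j => (d j : ℂ) + Complex.I) * toC Pᵀ := by
  obtain ⟨B, hB, hY⟩ := exists_transpose_mul_self Ω.2.2
  set X := Ω.1.map Complex.re with hX
  have hXs : Xᵀ = X := by
    have h : Ω.1ᵀ = Ω.1 := Ω.2.1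
    conv_rhs => rw [hX, ← h]
    rfl
  have hBu : IsUnit B.det := isUnit_iff_ne_zero.mpr hB
  have hBu' : IsUnit Bᵀ.det := by rwa [Matrix.det_transpose]
  let X' := (Bᵀ)⁻¹ * X * B⁻¹
  have hX' : X'.IsHermitian := by
    simp only [X', Matrix.IsHermitian, Matrix.conjTranspose_eq_transpose_of_trivial,
      Matrix.transpose_mul, hXs, Matrix.transpose_nonsing_inv, Matrix.transpose_transpose,
      Matrix.mul_assoc]
  let U : Matrix (Fin n) (Fin n) ℝ := hX'.eigenvectorUnitary
  have hU : U * Uᵀ = 1 := by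
    have := (Matrix.mem_unitaryGroup_iff).mp hX'.eigenvectorUnitary.2
    simpa [Matrix.star_eq_conjTranspose] using this
  have hspec : X' = U * Matrix.diagonal hX'.eigenvalues * Uᵀ := by
    have := hX'.spectral_theorem
    rw [Unitary.conjStarAlgAut_apply] at this
    exact this
  refine ⟨Bᵀ * U, hX'.eigenvalues, ?_, ?_⟩
  · rw [Matrix.det_mul, Matrix.det_transpose]
    have := congrArg Matrix.det hU
    rw [Matrix.det_mul, Matrix.det_one] at this
    exact mul_ne_zero hB (left_ne_zero_of_mul_eq_one this)
  · have h1 : Ω.1 = toC X + Complex.I • toC (Ω.1.map Complex.im) := by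
      ext i j
      simp [toC, X, mul_comm Complex.I, Complex.re_add_im]
    have h2 : X = Bᵀ * U * Matrix.diagonal hX'.eigenvalues * (Bᵀ * U)ᵀ := by
      rw [Matrix.transpose_mul, Matrix.transpose_transpose]
      have : X = Bᵀ * X' * B := by
        simp only [X', Matrix.mul_assoc]
        rw [Matrix.nonsing_inv_mul _ hBu, Matrix.mul_one, ← Matrix.mul_assoc,
          Matrix.mul_nonsing_inv _ hBu', Matrix.one_mul]
      calc X = Bᵀ * X' * B := this
        _ = Bᵀ * (U * Matrix.diagonal hX'.eigenvalues * Uᵀ) * B :=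
          congrArg (fun Y => Bᵀ * Y * B) hspec
        _ = _ := by simp only [Matrix.mul_assoc]
    have h3 : Ω.1.map Complex.im = Bᵀ * U * (Bᵀ * U)ᵀ := by
      rw [hY, Matrix.transpose_mul, Matrix.transpose_transpose, Matrix.mul_assoc,
        ← Matrix.mul_assoc U, hU, Matrix.one_mul]
    have h4 : Matrix.diagonal (fun j => (hX'.eigenvalues j : ℂ) + Complex.I)
        = toC (Matrix.diagonal hX'.eigenvalues) + Complex.I • 1 := by
      ext i j
      by_cases h : i = j <;> simp [toC, h, Matrix.diagonal]
    rw [h1, h3, h4]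
    conv_lhs => rw [h2]
    simp only [toC_mul, Matrix.mul_add, Matrix.add_mul, Matrix.mul_smul, Matrix.smul_mul,
      Matrix.mul_one]

end Factorization

/-! ### The Gaussian integral on real matrices -/

section GaussianIntegral

variable {n m : ℕ}

/-- The Gaussian integral in one variable at the point `d + i` of the upper half plane; since
`1 - i d` has positive real part, the square root is the principal one. -/
theorem integral_gauss_one (d : ℝ) (w : ℂ) :
    ∫ u : ℝ, cexp (π * Complex.I * (((d : ℂ) + Complex.I) * u ^ 2 + 2 * (u * w)))
      = ((1 - Complex.I * d) ^ (1 / 2 : ℂ))⁻¹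
        * cexp (-(π * Complex.I * (w ^ 2 / ((d : ℂ) + Complex.I)))) := by
  have hb : (π * Complex.I * ((d : ℂ) + Complex.I)).re < 0 := by
    simp [Real.pi_pos]
  have hI : Complex.I ^ 2 = -1 := Complex.I_sq
  have hz : 0 < (1 - Complex.I * (d : ℂ)).re := by simp
  have hz0 : (1 - Complex.I * (d : ℂ)) ≠ 0 := by
    intro h; rw [h] at hz; simp at hz
  have hd0 : (d : ℂ) + Complex.I ≠ 0 := by
    intro h
    have := congrArg Complex.im h
    simp at this
  have hpi : (π : ℂ) ≠ 0 := by exact_mod_cast Real.pi_ne_zero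
  have h := integral_cexp_quadratic hb (2 * π * Complex.I * w) 0
  have h1 : (π : ℂ) / -(π * Complex.I * ((d : ℂ) + Complex.I)) = (1 - Complex.I * d)⁻¹ := by
    have : -(π * Complex.I * ((d : ℂ) + Complex.I)) = π * (1 - Complex.I * d) := by
      linear_combination (-(π : ℂ)) * hI
    rw [this, ← div_div, div_self hpi, one_div]
  rw [h1, Complex.inv_cpow _ _ (by
    have : Complex.arg (1 - Complex.I * d) ≠ π := by
      intro h
      rw [Complex.arg_eq_pi_iff] at h
      linarith [h.1]
    exact this)] at h
  have h2 : ∀ u : ℝ, (π * Complex.I * (((d : ℂ) + Complex.I) * u ^ 2 + 2 * (u * w)))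
      = π * Complex.I * ((d : ℂ) + Complex.I) * (u : ℂ) ^ 2 + 2 * π * Complex.I * w * u + 0 :=
    fun u => by ring
  simp only [h2]
  rw [h]
  congr 2
  have hI0 := Complex.I_ne_zero
  field_simp
  ring

/-- A sum-of-squares expansion of a trace. -/
theorem trace_diagonal_form (v w : Matrix (Fin m) (Fin n) ℂ) (c : Fin n → ℂ) :
    Matrix.trace (v * Matrix.diagonal c * wᵀ) = ∑ i, ∑ j, c j * (v i j * w i j) := by
  simp only [Matrix.trace, Matrix.diag, Matrix.mul_apply (N := wᵀ), Matrix.transpose_apply,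
    Matrix.mul_diagonal]
  exact Finset.sum_congr rfl fun i _ => Finset.sum_congr rfl fun j _ => by ring

theorem isUnit_det_siegel (Ω : SiegelHalf n) : IsUnit Ω.1.det := by
  obtain ⟨P, d, hP, h⟩ := siegel_diagonalize Ω
  rw [h, Matrix.det_mul, Matrix.det_mul, Matrix.det_diagonal, det_toC, det_toC,
    Matrix.det_transpose]
  have hP' : (P.det : ℂ) ≠ 0 := by exact_mod_cast hP
  refine isUnit_iff_ne_zero.mpr (mul_ne_zero (mul_ne_zero hP' ?_) hP')
  refine Finset.prod_ne_zero_iff.mpr fun j _ h => ?_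
  have := congrArg Complex.im h
  simp at this

theorem neg_I_smul_mem (Ω : SiegelHalf n) : (-Complex.I) • Ω.1 ∈ symmRePos n := by
  refine ⟨?_, ?_⟩
  · have h : Ω.1ᵀ = Ω.1 := Ω.2.1
    simp [Matrix.IsSymm, h]
  · have : ((-Complex.I) • Ω.1).map Complex.re = Ω.1.map Complex.im := by
      ext i j; simp
    rw [this]; exact Ω.2.2

/-- The Gaussian integral on the space of real `m × n` matrices. With `M = Lᵗ L` and
`Ω = P diag (d_j + i) Pᵗ`, the substitution `u = L x P` turns it into a product of integrals in one
variable. -/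
theorem integral_gaussFun {M : Matrix (Fin m) (Fin m) ℝ} (hM : M.PosDef)
    (Ω : SiegelHalf n) (Z : Matrix (Fin m) (Fin n) ℂ) :
    ∫ x, gaussFun M (Ω, Z) x = (((√M.det) ^ n)⁻¹ : ℝ)
      * (detSqrt n ((-Complex.I) • Ω.1) ^ m)⁻¹
      * cexp (-(π * Complex.I * Matrix.trace (toC M * (Z * Ω.1⁻¹ * Zᵀ)))) := by
  obtain ⟨L, hL, hML⟩ := exists_transpose_mul_self hM
  obtain ⟨P, d, hP, hΩ⟩ := siegel_diagonalize Ω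
  set D : Fin n → ℂ := fun j => (d j : ℂ) + Complex.I with hD
  have hD0 : ∀ j, D j ≠ 0 := fun j h => by
    have := congrArg Complex.im h
    simp [hD] at this
  have hPu : IsUnit (toC P).det := by
    rw [det_toC]; exact isUnit_iff_ne_zero.mpr (by exact_mod_cast hP)
  have hPu' : IsUnit (toC P)ᵀ.det := by rwa [Matrix.det_transpose]
  set W : Matrix (Fin m) (Fin n) ℂ := toC L * Z * ((toC P)⁻¹)ᵀ with hW
  have hLZ : toC L * Z = W * (toC P)ᵀ := by
    rw [hW, Matrix.transpose_nonsing_inv, Matrix.mul_assoc, Matrix.nonsing_inv_mul _ hPu',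
      Matrix.mul_one]
  have htr : ∀ Y : Matrix (Fin m) (Fin m) ℂ,
      Matrix.trace (toC M * Y) = Matrix.trace (toC L * Y * (toC L)ᵀ) := fun Y => by
    rw [hML, toC_mul, ← toC_transpose, Matrix.mul_assoc, Matrix.trace_mul_comm]
  have h1 : ∀ x, gaussFun M (Ω, Z) x = ∏ i, ∏ j, cexp (π * Complex.I *
      (D j * (((L * x * P) i j : ℝ) : ℂ) ^ 2 + 2 * (((L * x * P) i j : ℝ) * W i j))) := by
    intro x
    simp only [← Complex.exp_sum, ← Finset.mul_sum]
    rw [gaussFun, htr]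
    congr 2
    have hu : toC L * toC x * toC P = toC (L * x * P) := by rw [toC_mul, toC_mul]
    have e1 : toC L * (toC x * Ω.1 * (toC x)ᵀ + (2 : ℂ) • (toC x * Zᵀ)) * (toC L)ᵀ
        = toC (L * x * P) * Matrix.diagonal D * (toC (L * x * P))ᵀ
          + (2 : ℂ) • (toC (L * x * P) * Wᵀ) := by
      have e2 : toC L * toC x * Zᵀ * (toC L)ᵀ = toC (L * x * P) * Wᵀ := by
        have : Zᵀ * (toC L)ᵀ = toC P * Wᵀ := by
          rw [← Matrix.transpose_mul, hLZ, Matrix.transpose_mul, Matrix.transpose_transpose]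
        rw [Matrix.mul_assoc _ Zᵀ, this, ← hu]
        simp only [Matrix.mul_assoc]
      rw [← e2, ← hu, hΩ, ← toC_transpose]
      simp only [Matrix.mul_add, Matrix.add_mul, Matrix.transpose_mul, Matrix.mul_assoc,
        Matrix.mul_smul, Matrix.smul_mul]
    have e3 := trace_diagonal_form (toC (L * x * P)) W fun _ => 1
    rw [Matrix.diagonal_one, Matrix.mul_one] at e3
    rw [e1, Matrix.trace_add, Matrix.trace_smul, trace_diagonal_form, e3, smul_eq_mul,
      Finset.mul_sum, ← Finset.sum_add_distrib]
    refine Finset.sum_congr rfl fun i _ => ?_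
    rw [Finset.mul_sum, ← Finset.sum_add_distrib]
    refine Finset.sum_congr rfl fun j _ => ?_
    simp only [toC, Matrix.map_apply]
    ring
  have h2 : ∫ u : Fin m → Fin n → ℝ, ∏ i, ∏ j, cexp (π * Complex.I *
      (D j * ((u i j : ℝ) : ℂ) ^ 2 + 2 * ((u i j : ℝ) * W i j)))
      = ∏ i, ∏ j, (((1 - Complex.I * d j) ^ (1 / 2 : ℂ))⁻¹
        * cexp (-(π * Complex.I * (W i j ^ 2 / D j)))) := by
    rw [integral_fintype_prod_volume_eq_prod (fun i (y : Fin n → ℝ) => ∏ j, cexp (π * Complex.I *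
      (D j * ((y j : ℝ) : ℂ) ^ 2 + 2 * ((y j : ℝ) * W i j))))]
    refine Finset.prod_congr rfl fun i _ => ?_
    rw [integral_fintype_prod_volume_eq_prod (fun j (t : ℝ) => cexp (π * Complex.I *
      (D j * (t : ℂ) ^ 2 + 2 * ((t : ℂ) * W i j))))]
    exact Finset.prod_congr rfl fun j _ => integral_gauss_one (d j) (W i j)
  have h3 := integral_comp_mul_mul hL hP (fun u : Matrix (Fin m) (Fin n) ℝ =>
    ∏ i, ∏ j, cexp (π * Complex.I * (D j * ((u i j : ℝ) : ℂ) ^ 2 + 2 * ((u i j : ℝ) * W i j))))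
  have h4 : detSqrt n ((-Complex.I) • Ω.1)
      = (|P.det| : ℝ) * ∏ j, (1 - Complex.I * (d j : ℂ)) ^ (1 / 2 : ℂ) := by
    rw [← detSqrt_diagonal, ← detSqrt_congr hP (diagonal_mem_symmRePos fun j => by simp), hΩ]
    congr 1
    have : Matrix.diagonal (fun j => 1 - Complex.I * (d j : ℂ))
        = (-Complex.I) • Matrix.diagonal D := by
      rw [← Matrix.diagonal_smul]
      congr 1
      ext j
      simp only [Pi.smul_apply, smul_eq_mul, hD]
      linear_combination Complex.I_sq
    rw [this]
    simp only [Matrix.mul_smul, Matrix.smul_mul]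
  have h5 : Matrix.trace (toC M * (Z * Ω.1⁻¹ * Zᵀ)) = ∑ i, ∑ j, W i j ^ 2 / D j := by
    have e1 : Ω.1⁻¹ = ((toC P)⁻¹)ᵀ * Matrix.diagonal (fun j => (D j)⁻¹) * (toC P)⁻¹ := by
      refine Matrix.inv_eq_left_inv ?_
      rw [hΩ]
      have e2 : Matrix.diagonal (fun j => (D j)⁻¹) * Matrix.diagonal D = 1 := by
        rw [Matrix.diagonal_mul_diagonal]
        simp [hD0]
      calc ((toC P)⁻¹)ᵀ * Matrix.diagonal (fun j => (D j)⁻¹) * (toC P)⁻¹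
            * (toC P * Matrix.diagonal D * toC Pᵀ)
          = ((toC P)⁻¹)ᵀ * (Matrix.diagonal (fun j => (D j)⁻¹) * (((toC P)⁻¹ * toC P)
            * Matrix.diagonal D)) * toC Pᵀ := by simp only [Matrix.mul_assoc]
        _ = 1 := by
          rw [Matrix.nonsing_inv_mul _ hPu, Matrix.one_mul, e2, Matrix.mul_one, ← toC_transpose,
            Matrix.transpose_nonsing_inv, Matrix.nonsing_inv_mul _ hPu']
    rw [htr, e1]
    have e3 : toC L * (Z * (((toC P)⁻¹)ᵀ * Matrix.diagonal (fun j => (D j)⁻¹) * (toC P)⁻¹) * Zᵀ)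
        * (toC L)ᵀ = W * Matrix.diagonal (fun j => (D j)⁻¹) * Wᵀ := by
      simp only [hW, Matrix.transpose_mul, Matrix.transpose_transpose, Matrix.mul_assoc]
    rw [e3, trace_diagonal_form]
    refine Finset.sum_congr rfl fun i _ => Finset.sum_congr rfl fun j _ => ?_
    rw [div_eq_mul_inv]; ring
  have hdet : |L.det| = √M.det := by
    rw [hML, Matrix.det_mul, Matrix.det_transpose, ← pow_two, Real.sqrt_sq_eq_abs]
  simp only [h1]
  rw [h3]
  have h2' : ∫ u : Matrix (Fin m) (Fin n) ℝ, ∏ i, ∏ j, cexp (π * Complex.I *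
      (D j * ((u i j : ℝ) : ℂ) ^ 2 + 2 * ((u i j : ℝ) * W i j)))
      = ∏ i, ∏ j, (((1 - Complex.I * d j) ^ (1 / 2 : ℂ))⁻¹
        * cexp (-(π * Complex.I * (W i j ^ 2 / D j)))) := h2
  rw [h2', h4, h5, hdet]
  simp only [Finset.prod_mul_distrib, ← Complex.exp_sum, Finset.prod_const, Finset.prod_inv_distrib,
    Finset.card_univ, Fintype.card_fin, Finset.sum_neg_distrib, ← Finset.mul_sum]
  push_cast
  rw [mul_pow, mul_inv]
  ring

end GaussianIntegral

/-! ### The action on the Siegel-Jacobi space and the cocycle `J*_M` -/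

section Cocycle

variable {n m : ℕ}

theorem sp_row_rel (g : Sp n) :
    toC g.C * (toC g.D)ᵀ = toC g.D * (toC g.C)ᵀ := by
  have h := SymplecticGroup.map_mem (SymplecticGroup.transpose_mem g.2) Complex.ofRealHom
  rw [sp_eq g, fromBlocks_transpose, fromBlocks_map] at h
  exact (SymplecticGroup.fromBlocks_mem_iff.mp h).2.1

/-- `N⁻¹ C` for `N = C Ω + D`. -/
noncomputable def slope (g : Sp n) (Ω : Matrix (Fin n) (Fin n) ℂ) : Matrix (Fin n) (Fin n) ℂ :=
  (denom g Ω)⁻¹ * toC g.C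

theorem isUnit_det_denom (g : Sp n) (Ω : SiegelHalf n) : IsUnit (denom g Ω.1).det :=
  isUnit_iff_ne_zero.mpr (denom_det_ne_zero g Ω)

theorem isUnit_det_denom_transpose (g : Sp n) (Ω : SiegelHalf n) :
    IsUnit (denom g Ω.1)ᵀ.det := by
  rw [Matrix.det_transpose]; exact isUnit_det_denom g Ω

theorem denom_mul_slope (g : Sp n) (Ω : SiegelHalf n) : denom g Ω.1 * slope g Ω.1 = toC g.C := by
  rw [slope, ← Matrix.mul_assoc, Matrix.mul_nonsing_inv _ (isUnit_det_denom g Ω), Matrix.one_mul]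

theorem slope_transpose (g : Sp n) (Ω : SiegelHalf n) : (slope g Ω.1)ᵀ = slope g Ω.1 := by
  have h1 : denom g Ω.1 * (toC g.C)ᵀ = toC g.C * (denom g Ω.1)ᵀ := by
    have h : Ω.1ᵀ = Ω.1 := Ω.2.1
    simp only [denom, Matrix.add_mul, Matrix.transpose_add, Matrix.transpose_mul, h, Matrix.mul_add,
      sp_row_rel, Matrix.mul_assoc]
  have hu := isUnit_det_denom g Ω
  have hu' := isUnit_det_denom_transpose g Ω
  rw [slope, Matrix.transpose_mul, Matrix.transpose_nonsing_inv]
  calc (toC g.C)ᵀ * ((denom g Ω.1)ᵀ)⁻¹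
      = (denom g Ω.1)⁻¹ * (denom g Ω.1 * (toC g.C)ᵀ) * ((denom g Ω.1)ᵀ)⁻¹ := by
        rw [← Matrix.mul_assoc, Matrix.nonsing_inv_mul _ hu, Matrix.one_mul]
    _ = _ := by
        rw [h1, ← Matrix.mul_assoc, Matrix.mul_assoc, Matrix.mul_nonsing_inv _ hu', Matrix.mul_one]

theorem moeb_mul_denom (g : Sp n) (Ω : SiegelHalf n) :
    moeb g Ω.1 * denom g Ω.1 = numer g Ω.1 := by
  rw [moeb, Matrix.mul_assoc, Matrix.nonsing_inv_mul _ (isUnit_det_denom g Ω), Matrix.mul_one]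

/-- `(g ⬝ Ω) C = A - N⁻ᵀ`. -/
theorem moeb_mul_C (g : Sp n) (Ω : SiegelHalf n) :
    moeb g Ω.1 * toC g.C = toC g.A - ((denom g Ω.1)ᵀ)⁻¹ := by
  obtain ⟨r1, -, r3⟩ := sp_rel g
  have r4 : (toC g.D)ᵀ * toC g.A - (toC g.B)ᵀ * toC g.C = 1 := by
    simpa using congrArg Matrix.transpose r3
  have hΩ : Ω.1ᵀ = Ω.1 := Ω.2.1
  have h1 : (denom g Ω.1)ᵀ * toC g.A - (numer g Ω.1)ᵀ * toC g.C = 1 := by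
    rw [← r4]
    simp only [denom, numer, Matrix.transpose_add, Matrix.transpose_mul, hΩ, Matrix.add_mul,
      Matrix.mul_assoc, r1]
    abel
  have h2 : (numer g Ω.1)ᵀ = (denom g Ω.1)ᵀ * moeb g Ω.1 := by
    have h3 : (moeb g Ω.1)ᵀ = moeb g Ω.1 := moeb_symm g Ω
    rw [← moeb_mul_denom, Matrix.transpose_mul, h3]
  rw [h2, Matrix.mul_assoc, ← Matrix.mul_sub] at h1
  have h5 : toC g.A - moeb g Ω.1 * toC g.C = ((denom g Ω.1)ᵀ)⁻¹ :=
    (Matrix.inv_eq_right_inv h1).symm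
  rw [← h5]; abel

/-- The cocycle relation which makes the quadratic exponent of `J*_M` additive. -/
theorem slope_mul (g h : Sp n) (Ω : SiegelHalf n) :
    slope (g * h) Ω.1 = slope h Ω.1
      + (denom h Ω.1)⁻¹ * slope g (h • Ω).1 * ((denom h Ω.1)ᵀ)⁻¹ := by
  have hu := isUnit_det_denom (g * h) Ω
  have h1 : denom (g * h) Ω.1 * (slope h Ω.1
      + (denom h Ω.1)⁻¹ * slope g (h • Ω).1 * ((denom h Ω.1)ᵀ)⁻¹) = toC (g * h).C := by
    rw [denom_mul, Matrix.mul_add, Matrix.mul_assoc, denom_mul_slope]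
    have e1 : denom g (moeb h Ω.1) * denom h Ω.1
        * ((denom h Ω.1)⁻¹ * slope g (h • Ω).1 * ((denom h Ω.1)ᵀ)⁻¹)
        = toC g.C * ((denom h Ω.1)ᵀ)⁻¹ := by
      rw [← denom_mul_slope g (h • Ω), smul_val]
      simp only [Matrix.mul_assoc]
      rw [← Matrix.mul_assoc (denom h Ω.1), Matrix.mul_nonsing_inv _ (isUnit_det_denom h Ω),
        Matrix.one_mul]
    obtain ⟨-, -, c, -⟩ := sp_mul g h
    rw [e1, c, denom, Matrix.add_mul, Matrix.mul_assoc, moeb_mul_C]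
    simp only [toC_add, toC_mul, Matrix.mul_sub]
    abel
  rw [slope, ← h1, ← Matrix.mul_assoc, Matrix.nonsing_inv_mul _ hu, Matrix.one_mul]

/-- The action of the Heisenberg group, `(Ω, Z) ↦ (Ω, Z + λ Ω + μ)`, on the Siegel-Jacobi space. -/
noncomputable def heisAct (h : Heis n m) (p : SiegelJacobi n m) : SiegelJacobi n m :=
  (p.1, shiftZ h p)

/-- The action of the symplectic group, `(Ω, Z) ↦ (g ⬝ Ω, Z (C Ω + D)⁻¹)`, on the Siegel-Jacobi space. -/
noncomputable def spAct (g : Sp n) (p : SiegelJacobi n m) : SiegelJacobi n m :=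
  (g • p.1, p.2 * (denom g p.1.1)⁻¹)

theorem smul_eq_spAct (x : GStarJ n m) (p : SiegelJacobi n m) :
    x • p = spAct x.a.g (heisAct x.h p) := rfl

theorem heis_mul (h k : Heis n m) : (h * k).lam = h.lam + k.lam ∧ (h * k).mu = h.mu + k.mu ∧
    (h * k).kap = h.kap + k.kap + h.lam * k.muᵀ - h.mu * k.lamᵀ := ⟨rfl, rfl, rfl⟩

theorem toC_sub {k l : ℕ} (X Y : Matrix (Fin k) (Fin l) ℝ) : toC (X - Y) = toC X - toC Y := by
  ext; simp [toC]

theorem heisAct_mul (h k : Heis n m) (p : SiegelJacobi n m) :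
    heisAct (h * k) p = heisAct h (heisAct k p) := by
  refine Prod.ext rfl ?_
  obtain ⟨e1, e2, -⟩ := heis_mul h k
  simp only [heisAct, shiftZ, e1, e2, toC_add, Matrix.add_mul]
  abel

theorem spAct_mul (g h : Sp n) (p : SiegelJacobi n m) :
    spAct (g * h) p = spAct g (spAct h p) := by
  refine Prod.ext (mul_smul g h p.1) ?_
  change p.2 * (denom (g * h) p.1.1)⁻¹ = p.2 * (denom h p.1.1)⁻¹ * (denom g (moeb h p.1.1))⁻¹
  rw [denom_mul, Matrix.mul_inv_rev, Matrix.mul_assoc]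

theorem act_shift (h : Heis n m) (g : Sp n) (Ω : Matrix (Fin n) (Fin n) ℂ) :
    toC (h.act g).lam * Ω + toC (h.act g).mu = toC h.lam * numer g Ω + toC h.mu * denom g Ω := by
  simp only [Heis.act, numer, denom, toC_add, toC_mul, Matrix.mul_add, Matrix.add_mul,
    Matrix.mul_assoc]
  abel

theorem heisAct_spAct (h : Heis n m) (g : Sp n) (p : SiegelJacobi n m) :
    heisAct h (spAct g p) = spAct g (heisAct (h.act g) p) := by
  refine Prod.ext rfl ?_
  change p.2 * (denom g p.1.1)⁻¹ + toC h.lam * moeb g p.1.1 + toC h.mu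
    = (p.2 + toC (h.act g).lam * p.1.1 + toC (h.act g).mu) * (denom g p.1.1)⁻¹
  rw [add_assoc p.2, act_shift, Matrix.add_mul, Matrix.add_mul, Matrix.mul_assoc _ (numer _ _),
    Matrix.mul_assoc _ (denom _ _), Matrix.mul_nonsing_inv _ (isUnit_det_denom g p.1),
    Matrix.mul_one, ← add_assoc]
  rfl

theorem mul_smul_siegelJacobi (x y : GStarJ n m) (p : SiegelJacobi n m) :
    (x * y) • p = x • (y • p) := by
  simp only [smul_eq_spAct]
  rw [heisAct_spAct, ← spAct_mul, ← heisAct_mul]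
  rfl

theorem one_smul_siegelJacobi (p : SiegelJacobi n m) : (1 : GStarJ n m) • p = p := by
  rw [smul_eq_spAct]
  change spAct 1 (heisAct 1 p) = p
  refine Prod.ext (one_smul _ p.1) ?_
  change (p.2 + toC (0 : Matrix (Fin m) (Fin n) ℝ) * p.1.1 + toC (0 : Matrix (Fin m) (Fin n) ℝ))
    * (denom (1 : Sp n) p.1.1)⁻¹ = p.2
  rw [denom_one]
  simp [toC]

/-- The quadratic exponent of `J*_M` coming from the symplectic part. -/
noncomputable def spExp (g : Sp n) (p : SiegelJacobi n m) : Matrix (Fin m) (Fin m) ℂ :=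
  p.2 * slope g p.1.1 * p.2ᵀ

/-- The exponent of `J*_M` coming from the Heisenberg part. -/
noncomputable def heisExp (h : Heis n m) (p : SiegelJacobi n m) : Matrix (Fin m) (Fin m) ℂ :=
  toC h.lam * p.1.1 * (toC h.lam)ᵀ + (2 : ℂ) • (toC h.lam * p.2ᵀ)
    + toC h.kap + toC h.mu * (toC h.lam)ᵀ

theorem jStar_eq (M : Matrix (Fin m) (Fin m) ℝ) (x : GStarJ n m) (p : SiegelJacobi n m) :
    jStar M x p = cexp (π * Complex.I * (Matrix.trace (toC M * spExp x.a.g (heisAct x.h p))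
      - Matrix.trace (toC M * heisExp x.h p))) * jHalf x.a p.1 ^ m := by
  rw [mul_sub, Complex.exp_sub, jStar, Complex.exp_neg, div_eq_mul_inv]
  simp only [spExp, slope, heisAct, heisExp, Matrix.mul_assoc]

/-- Inside `σ(M ·)` a matrix can be replaced by its transpose. Most identities between exponents
hold only up to such a replacement. -/
theorem trace_mul_transpose_symm {M : Matrix (Fin m) (Fin m) ℝ} (hM : M.IsSymm)
    (X : Matrix (Fin m) (Fin m) ℂ) :
    Matrix.trace (toC M * Xᵀ) = Matrix.trace (toC M * X) := by
  have h : (toC M)ᵀ = toC M := by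
    rw [toC_transpose, hM]
  rw [← Matrix.trace_transpose, Matrix.transpose_mul, Matrix.transpose_transpose, h,
    Matrix.trace_mul_comm]

theorem heisExp_mul {M : Matrix (Fin m) (Fin m) ℝ} (hM : M.IsSymm) (h k : Heis n m)
    (p : SiegelJacobi n m) :
    Matrix.trace (toC M * heisExp (h * k) p) = Matrix.trace (toC M * heisExp h (heisAct k p))
      + Matrix.trace (toC M * heisExp k p) := by
  obtain ⟨e1, e2, e3⟩ := heis_mul h k
  have hΩ : p.1.1ᵀ = p.1.1 := p.1.2.1
  have key : heisExp (h * k) p = heisExp h (heisAct k p) + heisExp k p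
      + ((toC k.lam * p.1.1 * (toC h.lam)ᵀ) - (toC k.lam * p.1.1 * (toC h.lam)ᵀ)ᵀ)
      + ((toC k.mu * (toC h.lam)ᵀ) - (toC k.mu * (toC h.lam)ᵀ)ᵀ) := by
    simp only [heisExp, e1, e2, e3, heisAct, shiftZ, toC_add, toC_sub, toC_mul,
      Matrix.transpose_add, Matrix.transpose_mul, hΩ, ← toC_transpose, Matrix.transpose_transpose,
      Matrix.mul_add, Matrix.add_mul, two_smul, Matrix.mul_assoc]
    abel
  rw [key]
  simp only [Matrix.mul_add, Matrix.mul_sub, Matrix.trace_add, Matrix.trace_sub,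
    trace_mul_transpose_symm hM]
  ring

theorem spExp_mul (g h : Sp n) (p : SiegelJacobi n m) :
    spExp (g * h) p = spExp g (spAct h p) + spExp h p := by
  simp only [spExp, spAct, slope_mul, Matrix.transpose_mul, Matrix.transpose_nonsing_inv,
    Matrix.mul_add, Matrix.add_mul, Matrix.mul_assoc]
  abel

/-- The exponents of `J*_M` are compatible with the relation `h g = g (h ⬝ g)` that commutes the
Heisenberg part past the symplectic part. -/
theorem spExp_sub_heisExp {M : Matrix (Fin m) (Fin m) ℝ} (hM : M.IsSymm) (h : Heis n m) (g : Sp n)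
    (p : SiegelJacobi n m) :
    Matrix.trace (toC M * spExp g (heisAct (h.act g) p))
        - Matrix.trace (toC M * heisExp (h.act g) p)
      = Matrix.trace (toC M * spExp g p) - Matrix.trace (toC M * heisExp h (spAct g p)) := by
  set S := slope g p.1.1 with hS
  set N := denom g p.1.1 with hN
  set l := toC (h.act g).lam with hl
  set R := toC h.lam * numer g p.1.1 + toC h.mu * N with hR
  have hSt : Sᵀ = S := slope_transpose g p.1
  have hu := isUnit_det_denom g p.1
  have hR' : l * p.1.1 + toC (h.act g).mu = R := act_shift h g p.1.1
  have hG : (moeb g p.1.1)ᵀ = moeb g p.1.1 := moeb_symm g p.1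
  -- `R S = λ' - λ N⁻ᵀ`, where `λ'` is the first component of `h ⬝ g`.
  have hRS : R * S = l - toC h.lam * (Nᵀ)⁻¹ := by
    have e1 : numer g p.1.1 * S = toC g.A - (Nᵀ)⁻¹ := by
      rw [← moeb_mul_C, ← moeb_mul_denom, Matrix.mul_assoc, hS, denom_mul_slope]
    have e2 : l = toC h.lam * toC g.A + toC h.mu * toC g.C := by
      rw [hl, ← toC_mul, ← toC_mul, ← toC_add]; rfl
    rw [hR, Matrix.add_mul, Matrix.mul_assoc, Matrix.mul_assoc, e1, hS, hN, denom_mul_slope, e2,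
      Matrix.mul_sub]
    abel
  have hSR : S * Rᵀ = lᵀ - N⁻¹ * (toC h.lam)ᵀ := by
    have := congrArg Matrix.transpose hRS
    rwa [Matrix.transpose_mul, hSt, Matrix.transpose_sub, Matrix.transpose_mul,
      Matrix.transpose_nonsing_inv, Matrix.transpose_transpose] at this
  have hRN : R * N⁻¹ = toC h.lam * moeb g p.1.1 + toC h.mu := by
    rw [hR, Matrix.add_mul, Matrix.mul_assoc, Matrix.mul_assoc, Matrix.mul_nonsing_inv _ hu,
      Matrix.mul_one]
    rfl
  have h1 : spExp g (heisAct (h.act g) p)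
      = spExp g p + p.2 * (S * Rᵀ) + (R * S) * p.2ᵀ + R * (S * Rᵀ) := by
    have e : (heisAct (h.act g) p).2 = p.2 + R := by
      change p.2 + l * p.1.1 + toC (h.act g).mu = _
      rw [add_assoc, hR']
    simp only [spExp, e]
    change (p.2 + R) * S * (p.2 + R)ᵀ = p.2 * S * p.2ᵀ + _ + _ + _
    simp only [Matrix.transpose_add, Matrix.mul_add, Matrix.add_mul, Matrix.mul_assoc]
    abel
  have h2 : heisExp (h.act g) p = R * lᵀ + (2 : ℂ) • (l * p.2ᵀ) + toC h.kap := by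
    rw [← hR', Matrix.add_mul]
    simp only [heisExp]
    change l * p.1.1 * lᵀ + (2 : ℂ) • (l * p.2ᵀ) + toC h.kap + _ * lᵀ = _
    abel
  have h3 : heisExp h (spAct g p) = R * (N⁻¹ * (toC h.lam)ᵀ)
      + (2 : ℂ) • (toC h.lam * ((Nᵀ)⁻¹ * p.2ᵀ)) + toC h.kap := by
    rw [← Matrix.mul_assoc R, hRN, Matrix.add_mul]
    simp only [heisExp, spAct, smul_val, Matrix.transpose_mul, Matrix.transpose_nonsing_inv]
    abel
  have h4 : p.2 * (S * Rᵀ) = ((R * S) * p.2ᵀ)ᵀ := by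
    simp only [Matrix.transpose_mul, Matrix.transpose_transpose, hSt]
  rw [h1, h2, h3, h4]
  simp only [Matrix.mul_add, Matrix.trace_add, trace_mul_transpose_symm hM, hRS, hSR,
    Matrix.sub_mul, Matrix.mul_sub, Matrix.trace_sub, Matrix.mul_smul, Matrix.trace_smul,
    smul_eq_mul, Matrix.mul_assoc]
  ring

theorem jHalf_mul (a b : GStar n) (Ω : SiegelHalf n) :
    jHalf (a * b) Ω = jHalf a (b.g • Ω) * jHalf b Ω := by
  have h1 : (a * b).g = a.g * b.g := rfl
  have h2 : (a * b).ε = a.ε * b.ε * betaFactor (basePoint n) a.g b.g := rfl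
  have h3 := epsFactor_trans a.g (b.g • Ω) (basePoint n) (b.g • basePoint n)
  have h4 := epsFactor_ne_zero a.g (basePoint n) (b.g • basePoint n)
  have ha := a.ε_ne_zero
  have hb := b.ε_ne_zero
  simp only [jHalf, h1, h2, betaFactor, epsFactor_mul, denom_mul, Matrix.det_mul, norm_mul,
    Real.sqrt_mul (norm_nonneg _), ← h3, smul_val]
  push_cast
  rw [mul_inv, mul_inv]
  field_simp

/-- The cocycle property of `J*_M`. -/
theorem jStar_mul {M : Matrix (Fin m) (Fin m) ℝ} (hM : M.IsSymm) (x y : GStarJ n m)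
    (p : SiegelJacobi n m) : jStar M (x * y) p = jStar M x (y • p) * jStar M y p := by
  have ea : (x * y).a = x.a * y.a := rfl
  have eg : (x.a * y.a).g = x.a.g * y.a.g := rfl
  have eh : (x * y).h = x.h.act y.a.g * y.h := rfl
  have e1 := spExp_sub_heisExp hM x.h y.a.g (heisAct y.h p)
  have hy : (y • p).1 = y.a.g • p.1 := rfl
  rw [jStar_eq, jStar_eq, jStar_eq, ea, eg, eh, heisExp_mul hM, heisAct_mul, spExp_mul,
    ← heisAct_spAct, jHalf_mul, hy, mul_pow, ← smul_eq_spAct y p, Matrix.mul_add,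
    Matrix.trace_add, mul_mul_mul_comm, ← Complex.exp_add]
  rw [← smul_eq_spAct y p] at e1
  congr 2
  linear_combination (π * Complex.I) * e1

theorem jHalf_ne_zero (a : GStar n) (Ω : SiegelHalf n) : jHalf a Ω ≠ 0 := by
  refine mul_ne_zero (mul_ne_zero (inv_ne_zero a.ε_ne_zero) (epsFactor_ne_zero _ _ _)) ?_
  exact Complex.ofReal_ne_zero.mpr
    (Real.sqrt_ne_zero'.mpr (norm_pos_iff.mpr (denom_det_ne_zero a.g Ω)))

theorem jStar_ne_zero (M : Matrix (Fin m) (Fin m) ℝ) (x : GStarJ n m) (p : SiegelJacobi n m) :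
    jStar M x p ≠ 0 := by
  rw [jStar_eq]
  exact mul_ne_zero (Complex.exp_ne_zero _) (pow_ne_zero _ (jHalf_ne_zero _ _))

end Cocycle

/-! ### The reproducing kernel of the Gaussians -/

section ReproducingKernel

variable {n m : ℕ}

/-- The point `Ω - conj Ω'` of the Siegel upper half plane. -/
noncomputable def siegelSub (Ω Ω' : SiegelHalf n) : SiegelHalf n :=
  ⟨Ω.1 - conjM Ω'.1, by
    have h1 : Ω.1ᵀ = Ω.1 := Ω.2.1
    have h2 : (conjM Ω'.1)ᵀ = conjM Ω'.1 := congrArg conjM Ω'.2.1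
    simp [Matrix.IsSymm, h1, h2], by
    have : (Ω.1 - conjM Ω'.1).map Complex.im = Ω.1.map Complex.im + Ω'.1.map Complex.im := by
      ext i j; simp [conjM]
    rw [this]
    exact Ω.2.2.add Ω'.2.2⟩

theorem conjM_transpose {k l : ℕ} (X : Matrix (Fin k) (Fin l) ℂ) : conjM Xᵀ = (conjM X)ᵀ := rfl

theorem conj_trace {k : ℕ} (X : Matrix (Fin k) (Fin k) ℂ) :
    starRingEnd ℂ (Matrix.trace X) = Matrix.trace (conjM X) := by
  simp [Matrix.trace, conjM]

theorem conj_cexp_trace (M : Matrix (Fin m) (Fin m) ℝ) (X : Matrix (Fin m) (Fin m) ℂ) :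
    starRingEnd ℂ (cexp (π * Complex.I * Matrix.trace (toC M * X)))
      = cexp (-(π * Complex.I * Matrix.trace (toC M * conjM X))) := by
  rw [← Complex.exp_conj, map_mul, map_mul, Complex.conj_I, Complex.conj_ofReal, conj_trace,
    conjM_mul, conjM_toC]
  congr 1
  ring

/-- The product of a Gaussian with a conjugate Gaussian is again a Gaussian, at the point
`(Ω - conj Ω', Z - conj Z')`. -/
theorem conj_gaussFun_mul (M : Matrix (Fin m) (Fin m) ℝ) (p q : SiegelJacobi n m)
    (x : Matrix (Fin m) (Fin n) ℝ) :
    starRingEnd ℂ (gaussFun M q x) * gaussFun M p x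
      = gaussFun M (siegelSub p.1 q.1, p.2 - conjM q.2) x := by
  simp only [gaussFun]
  rw [conj_cexp_trace, ← Complex.exp_add, add_comm, ← sub_eq_add_neg, ← mul_sub,
    ← Matrix.trace_sub, ← Matrix.mul_sub]
  congr 4
  have h : conjM ((2 : ℂ) • (toC x * q.2ᵀ)) = (2 : ℂ) • (toC x * (conjM q.2)ᵀ) := by
    rw [two_smul, two_smul, conjM_add, conjM_mul, conjM_toC, conjM_transpose]
  simp only [conjM_add, h, conjM_mul, conjM_toC, conjM_transpose, siegelSub, Matrix.transpose_sub,
    Matrix.mul_sub, Matrix.sub_mul, smul_sub]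
  abel

theorem covMap_coeFn {M : Matrix (Fin m) (Fin m) ℝ} (hM : M.PosDef) (p : SiegelJacobi n m) :
    covMap hM p =ᵐ[volume] gaussFun M p := MemLp.coeFn_toLp _

theorem inner_covMap_eq_integral {M : Matrix (Fin m) (Fin m) ℝ} (hM : M.PosDef)
    (p q : SiegelJacobi n m) :
    inner ℂ (covMap hM q) (covMap hM p)
      = ∫ x, gaussFun M (siegelSub p.1 q.1, p.2 - conjM q.2) x := by
  rw [L2.inner_def]
  refine integral_congr_ae ?_
  filter_upwards [covMap_coeFn hM p, covMap_coeFn hM q] with x h1 h2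
  rw [h1, h2, ← conj_gaussFun_mul, RCLike.inner_apply, mul_comm]

theorem detSqrt_neg_I_smul_siegelSub (Ω Ω' : SiegelHalf n) :
    detSqrt n ((-Complex.I) • (siegelSub Ω Ω').1)
      = (|((√2 : ℝ) • (1 : Matrix (Fin n) (Fin n) ℝ)).det| : ℝ) * detSqrt n (halfDiff Ω.1 Ω'.1) := by
  rw [← detSqrt_congr _ (halfDiff_mem Ω Ω')]
  · congr 1
    have h1 : toC ((√2 : ℝ) • (1 : Matrix (Fin n) (Fin n) ℝ)) = ((√2 : ℝ) : ℂ) • 1 := by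
      ext i j; by_cases h : i = j <;> simp [toC, h]
    have h2 : (((√2 : ℝ) : ℂ) * ((√2 : ℝ) : ℂ)) = 2 := by
      rw [← Complex.ofReal_mul, Real.mul_self_sqrt (by norm_num)]; norm_num
    rw [Matrix.transpose_smul, Matrix.transpose_one, h1, Matrix.smul_mul, Matrix.one_mul,
      Matrix.mul_smul, Matrix.mul_one, smul_smul, h2, halfDiff, smul_smul]
    congr 1
    rw [mul_inv, Complex.inv_I]
    ring
  · rw [Matrix.det_smul]
    simp

/-- The reproducing kernel of the family `F^(M)`. The factor `|det (√2 I)| ^ m` compares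
`-i (Ω - conj Ω')` with `(Ω - conj Ω') / (2 i)`; only its independence of the points matters. -/
theorem inner_covMap {M : Matrix (Fin m) (Fin m) ℝ} (hM : M.PosDef) (p q : SiegelJacobi n m) :
    inner ℂ (covMap hM q) (covMap hM p)
      = (((√M.det) ^ n)⁻¹ : ℝ)
        * ((|((√2 : ℝ) • (1 : Matrix (Fin n) (Fin n) ℝ)).det| : ℝ) ^ m : ℂ)⁻¹
        * (detSqrt n (halfDiff p.1.1 q.1.1) ^ m)⁻¹
        * cexp (-(π * Complex.I * Matrix.trace (toC M *
          ((p.2 - conjM q.2) * (siegelSub p.1 q.1).1⁻¹ * (p.2 - conjM q.2)ᵀ)))) := by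
  rw [inner_covMap_eq_integral, integral_gaussFun hM, detSqrt_neg_I_smul_siegelSub, mul_pow, mul_inv]
  simp only [mul_assoc]

theorem conj_epsFactor (g : Sp n) (Ω Ω' : SiegelHalf n) :
    starRingEnd ℂ (epsFactor g Ω Ω') = epsFactor g Ω' Ω := by
  have h1 : ‖epsFactor g Ω Ω'‖ = 1 := by
    have h := congrArg norm (epsFactor_sq g Ω Ω')
    rw [norm_pow, norm_mul, norm_inv, norm_alphaFactor, norm_alphaFactor, inv_one, mul_one] at h
    exact (pow_eq_one_iff_of_nonneg (norm_nonneg _) two_ne_zero).mp h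
  have h2 := epsFactor_trans g Ω Ω' Ω
  rw [epsFactor_self] at h2
  have h3 : epsFactor g Ω Ω' * starRingEnd ℂ (epsFactor g Ω Ω') = 1 := by
    rw [Complex.mul_conj, Complex.normSq_eq_norm_sq, h1]; simp
  exact mul_left_cancel₀ (epsFactor_ne_zero g Ω Ω') (h3.trans h2.symm)

/-- The branch of the square root in the kernel transforms exactly by the factor `J_{1/2}`. -/
theorem detSqrt_halfDiff_smul (a : GStar n) (Ω Ω' : SiegelHalf n) :
    (detSqrt n (halfDiff (a.g • Ω).1 (a.g • Ω').1))⁻¹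
      = jHalf a Ω * starRingEnd ℂ (jHalf a Ω') * (detSqrt n (halfDiff Ω.1 Ω'.1))⁻¹ := by
  have h0 := detSqrt_halfDiff_ne_zero Ω Ω'
  have hε : a.ε⁻¹ * (starRingEnd ℂ a.ε)⁻¹ = 1 := by
    rw [← mul_inv, Complex.mul_conj, Complex.normSq_eq_norm_sq, a.norm_ε]; simp
  have h1 := epsFactor_trans a.g Ω (basePoint n) Ω'
  have hs : ∀ Ω : SiegelHalf n, ((√‖(denom a.g Ω.1).det‖ : ℝ) : ℂ) ≠ 0 := fun Ω =>
    Complex.ofReal_ne_zero.mpr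
      (Real.sqrt_ne_zero'.mpr (norm_pos_iff.mpr (denom_det_ne_zero a.g Ω)))
  have h2 : jHalf a Ω * starRingEnd ℂ (jHalf a Ω') = epsFactor a.g Ω Ω'
      * (√‖(denom a.g Ω.1).det‖ : ℝ) * (√‖(denom a.g Ω'.1).det‖ : ℝ) := by
    rw [← h1, jHalf, jHalf, map_mul, map_mul, Complex.conj_ofReal, conj_epsFactor, map_inv₀]
    linear_combination (epsFactor a.g Ω (basePoint n) * epsFactor a.g (basePoint n) Ω'
      * (√‖(denom a.g Ω.1).det‖ : ℝ) * (√‖(denom a.g Ω'.1).det‖ : ℝ)) * hε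
  rw [h2, epsFactor]
  have := hs Ω
  have := hs Ω'
  push_cast
  field_simp

/-- The matrix identity behind the transformation of the reproducing kernel under the symplectic
group. -/
theorem kernel_exponent_identity {N N' C Δ G : Matrix (Fin n) (Fin n) ℂ}
    (Z Y : Matrix (Fin m) (Fin n) ℂ) (hN : IsUnit N.det) (hN' : IsUnit N'.det)
    (hΔ : IsUnit Δ.det) (hΔt : Δᵀ = Δ) (hNN : N = N' + C * Δ) (hG : N'ᵀ * G * N = Δ)
    (hS : (N⁻¹ * C)ᵀ = N⁻¹ * C) :
    (Z * N⁻¹ - Y * N'⁻¹) * G⁻¹ * (Z * N⁻¹ - Y * N'⁻¹)ᵀ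
      = (Z - Y) * Δ⁻¹ * (Z - Y)ᵀ - Z * (N⁻¹ * C) * Zᵀ + Y * (N'⁻¹ * C) * Yᵀ := by
  set S := N⁻¹ * C with hSd
  set S' := N'⁻¹ * C with hSd'
  have hN't : IsUnit N'ᵀ.det := by rwa [Matrix.det_transpose]
  have hNS : N * S = C := by rw [hSd, ← Matrix.mul_assoc, Matrix.mul_nonsing_inv _ hN, Matrix.one_mul]
  have e1 : N'⁻¹ * N = 1 + S' * Δ := by
    rw [hNN, Matrix.mul_add, Matrix.nonsing_inv_mul _ hN', hSd', Matrix.mul_assoc]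
  have e2 : N⁻¹ * N' = 1 - S * Δ := by
    have : N' = N - C * Δ := by rw [hNN]; abel
    rw [this, Matrix.mul_sub, Matrix.nonsing_inv_mul _ hN, hSd, Matrix.mul_assoc]
  have e3 : S' = S + S' * Δ * S := by
    have : S' = (N'⁻¹ * N) * S := by rw [Matrix.mul_assoc, hNS]
    conv_lhs => rw [this, e1, Matrix.add_mul, Matrix.one_mul]
  have hGi : G⁻¹ = N * Δ⁻¹ * N'ᵀ := by
    have hG' : G = (N'ᵀ)⁻¹ * Δ * N⁻¹ := by
      rw [← hG, Matrix.mul_assoc, Matrix.mul_assoc, Matrix.mul_nonsing_inv _ hN, Matrix.mul_one,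
        ← Matrix.mul_assoc, Matrix.nonsing_inv_mul _ hN't, Matrix.one_mul]
    refine Matrix.inv_eq_left_inv ?_
    rw [hG']
    calc N * Δ⁻¹ * N'ᵀ * ((N'ᵀ)⁻¹ * Δ * N⁻¹)
        = N * (Δ⁻¹ * (N'ᵀ * (N'ᵀ)⁻¹) * Δ) * N⁻¹ := by simp only [Matrix.mul_assoc]
      _ = 1 := by
        rw [Matrix.mul_nonsing_inv _ hN't, Matrix.mul_one, Matrix.nonsing_inv_mul _ hΔ,
          Matrix.mul_one, Matrix.mul_nonsing_inv _ hN]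
  have f1 : (Z * N⁻¹ - Y * N'⁻¹) * N = (Z - Y) - Y * S' * Δ := by
    rw [Matrix.sub_mul, Matrix.mul_assoc, Matrix.nonsing_inv_mul _ hN, Matrix.mul_one,
      Matrix.mul_assoc, e1, Matrix.mul_add, Matrix.mul_one, ← Matrix.mul_assoc]
    abel
  have f2 : N'ᵀ * (Z * N⁻¹ - Y * N'⁻¹)ᵀ = (Z - Y)ᵀ - Δ * S * Zᵀ := by
    have : (Z * N⁻¹ - Y * N'⁻¹) * N' = (Z - Y) - Z * S * Δ := by
      rw [Matrix.sub_mul, Matrix.mul_assoc, e2, Matrix.mul_assoc Y, Matrix.nonsing_inv_mul _ hN',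
        Matrix.mul_one, Matrix.mul_sub, Matrix.mul_one, ← Matrix.mul_assoc]
      abel
    rw [← Matrix.transpose_mul, this]
    simp only [Matrix.transpose_sub, Matrix.transpose_mul, hΔt, hS, Matrix.mul_assoc]
  have key : (Z * N⁻¹ - Y * N'⁻¹) * G⁻¹ * (Z * N⁻¹ - Y * N'⁻¹)ᵀ
      = ((Z - Y) - Y * S' * Δ) * Δ⁻¹ * ((Z - Y)ᵀ - Δ * S * Zᵀ) := by
    rw [hGi, ← f1, ← f2]; simp only [Matrix.mul_assoc]
  have g1 : ((Z - Y) - Y * S' * Δ) * Δ⁻¹ = (Z - Y) * Δ⁻¹ - Y * S' := by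
    rw [Matrix.sub_mul, Matrix.mul_assoc (Y * S'), Matrix.mul_nonsing_inv _ hΔ, Matrix.mul_one]
  have g2 : Δ⁻¹ * (Δ * (S * Zᵀ)) = S * Zᵀ := by
    rw [← Matrix.mul_assoc, Matrix.nonsing_inv_mul _ hΔ, Matrix.one_mul]
  have g3 : Y * (S' * Zᵀ) = Y * (S * Zᵀ) + Y * (S' * (Δ * (S * Zᵀ))) := by
    conv_lhs => rw [e3]
    simp only [Matrix.mul_add, Matrix.add_mul, Matrix.mul_assoc]
  rw [key, g1]
  simp only [Matrix.sub_mul, Matrix.mul_sub, Matrix.transpose_sub, Matrix.mul_assoc, g2, g3]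
  abel

theorem isUnit_det_siegelSub (Ω Ω' : SiegelHalf n) : IsUnit (siegelSub Ω Ω').1.det :=
  isUnit_det_siegel _

theorem conjM_inv (X : Matrix (Fin n) (Fin n) ℂ) (hX : IsUnit X.det) :
    conjM X⁻¹ = (conjM X)⁻¹ := by
  refine (Matrix.inv_eq_left_inv ?_).symm
  rw [← conjM_mul, Matrix.nonsing_inv_mul _ hX]
  ext i j; by_cases h : i = j <;> simp [conjM, h, Matrix.one_apply]

theorem kernel_exponent_spAct (g : Sp n) (p q : SiegelJacobi n m) :
    ((spAct g p).2 - conjM (spAct g q).2) * (siegelSub (spAct g p).1 (spAct g q).1).1⁻¹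
        * ((spAct g p).2 - conjM (spAct g q).2)ᵀ
      = (p.2 - conjM q.2) * (siegelSub p.1 q.1).1⁻¹ * (p.2 - conjM q.2)ᵀ
        - spExp g p + conjM (spExp g q) := by
  have hu := isUnit_det_denom g p.1
  have hu' := isUnit_det_denom g q.1
  have huc : IsUnit (conjM (denom g q.1.1)).det := by
    rw [det_conjM]; exact hu'.map (starRingEnd ℂ)
  have h1 : conjM (spAct g q).2 = conjM q.2 * (conjM (denom g q.1.1))⁻¹ := by
    rw [spAct, conjM_mul, conjM_inv _ hu']
  have hG : (conjM (denom g q.1.1))ᵀ * (siegelSub (spAct g p).1 (spAct g q).1).1 * denom g p.1.1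
      = (siegelSub p.1 q.1).1 := by
    have h := congrArg (fun X => (2 * Complex.I) • X) (halfDiff_moeb g p.1 q.1)
    have h2I : (2 * Complex.I) ≠ 0 := mul_ne_zero two_ne_zero Complex.I_ne_zero
    simp only [halfDiff, Matrix.mul_smul, Matrix.smul_mul, smul_smul, mul_inv_cancel₀ h2I,
      one_smul] at h
    exact h
  have hNN : denom g p.1.1 = conjM (denom g q.1.1) + toC g.C * (siegelSub p.1 q.1).1 := by
    simp only [denom, siegelSub, conjM_add, conjM_mul, conjM_toC, Matrix.mul_sub]
    abel
  have key := kernel_exponent_identity p.2 (conjM q.2) hu huc (isUnit_det_siegelSub p.1 q.1)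
    (siegelSub p.1 q.1).2.1 hNN hG (slope_transpose g p.1)
  have h2 : conjM (spExp g q) = conjM q.2 * ((conjM (denom g q.1.1))⁻¹ * toC g.C)
      * (conjM q.2)ᵀ := by
    simp only [spExp, slope, conjM_mul, conjM_inv _ hu', conjM_toC, conjM_transpose]
  rw [h1, h2]
  exact key

theorem kernel_exponent_heisAct {M : Matrix (Fin m) (Fin m) ℝ} (hM : M.IsSymm) (h : Heis n m)
    (p q : SiegelJacobi n m) :
    Matrix.trace (toC M * (((heisAct h p).2 - conjM (heisAct h q).2)
        * (siegelSub (heisAct h p).1 (heisAct h q).1).1⁻¹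
        * ((heisAct h p).2 - conjM (heisAct h q).2)ᵀ))
      = Matrix.trace (toC M * ((p.2 - conjM q.2) * (siegelSub p.1 q.1).1⁻¹ * (p.2 - conjM q.2)ᵀ))
        + Matrix.trace (toC M * heisExp h p) - Matrix.trace (toC M * conjM (heisExp h q)) := by
  set Δ := (siegelSub p.1 q.1).1 with hΔ
  have hu : IsUnit Δ.det := isUnit_det_siegelSub p.1 q.1
  have hΔt : Δᵀ = Δ := (siegelSub p.1 q.1).2.1
  have e0 : (siegelSub (heisAct h p).1 (heisAct h q).1).1 = Δ := rfl
  have hpq : p.1.1 = conjM q.1.1 + Δ := by simp [hΔ, siegelSub]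
  have e1 : (heisAct h p).2 - conjM (heisAct h q).2 = (p.2 - conjM q.2) + toC h.lam * Δ := by
    simp only [heisAct, shiftZ, conjM_add, conjM_mul, conjM_toC, hpq, Matrix.mul_add]
    abel
  have e2 : ((p.2 - conjM q.2) + toC h.lam * Δ) * Δ⁻¹ * ((p.2 - conjM q.2) + toC h.lam * Δ)ᵀ
      = (p.2 - conjM q.2) * Δ⁻¹ * (p.2 - conjM q.2)ᵀ + (toC h.lam * (p.2 - conjM q.2)ᵀ)ᵀ
        + toC h.lam * (p.2 - conjM q.2)ᵀ + toC h.lam * Δ * (toC h.lam)ᵀ := by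
    rw [Matrix.add_mul, Matrix.mul_assoc (toC h.lam), Matrix.mul_nonsing_inv _ hu, Matrix.mul_one,
      Matrix.transpose_add, Matrix.transpose_mul (toC h.lam) Δ, hΔt]
    have : (p.2 - conjM q.2) * Δ⁻¹ * (Δ * (toC h.lam)ᵀ) = (p.2 - conjM q.2) * (toC h.lam)ᵀ := by
      rw [Matrix.mul_assoc, ← Matrix.mul_assoc Δ⁻¹, Matrix.nonsing_inv_mul _ hu, Matrix.one_mul]
    rw [Matrix.add_mul, Matrix.mul_add, Matrix.mul_add, this, Matrix.transpose_mul,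
      Matrix.transpose_transpose, Matrix.mul_assoc (toC h.lam) Δ]
    abel
  have e3 : heisExp h p - conjM (heisExp h q)
      = toC h.lam * Δ * (toC h.lam)ᵀ + (2 : ℂ) • (toC h.lam * (p.2 - conjM q.2)ᵀ) := by
    simp only [heisExp, hpq, two_smul, conjM_add, conjM_mul, conjM_toC, conjM_transpose,
      Matrix.mul_add, Matrix.add_mul, Matrix.transpose_sub, Matrix.mul_sub]
    abel
  rw [e0, e1, e2, add_sub_assoc, ← Matrix.trace_sub, ← Matrix.mul_sub, e3]
  simp only [Matrix.mul_add, Matrix.trace_add, trace_mul_transpose_symm hM, Matrix.mul_smul,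
    Matrix.trace_smul, smul_eq_mul]
  ring

/-- The reproducing kernel of the family `F^(M)` transforms by the factor `J*_M`. -/
theorem inner_covMap_smul {M : Matrix (Fin m) (Fin m) ℝ} (hM : M.PosDef) (x : GStarJ n m)
    (p q : SiegelJacobi n m) :
    inner ℂ (covMap hM (x • q)) (covMap hM (x • p))
      = jStar M x p * starRingEnd ℂ (jStar M x q) * inner ℂ (covMap hM q) (covMap hM p) := by
  have hMs : M.IsSymm := isSymm_of_posDef hM
  have e1 := kernel_exponent_heisAct hMs x.h p q
  have e2 := kernel_exponent_spAct x.a.g (heisAct x.h p) (heisAct x.h q)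
  have e3 := detSqrt_halfDiff_smul x.a p.1 q.1
  have e3' : (detSqrt n (halfDiff (x.a.g • p.1).1 (x.a.g • q.1).1) ^ m)⁻¹
      = jHalf x.a p.1 ^ m * starRingEnd ℂ (jHalf x.a q.1 ^ m)
        * (detSqrt n (halfDiff p.1.1 q.1.1) ^ m)⁻¹ := by
    rw [← inv_pow, e3, mul_pow, mul_pow, inv_pow, map_pow]
  have e4 : (x • p).1 = x.a.g • p.1 := rfl
  have e5 : (x • q).1 = x.a.g • q.1 := rfl
  have e6 : ∀ a b : ℂ, starRingEnd ℂ (cexp (π * Complex.I * (a - b)))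
      = cexp (-(π * Complex.I * (starRingEnd ℂ a - starRingEnd ℂ b))) := fun a b => by
    rw [← Complex.exp_conj, map_mul, map_mul, map_sub, Complex.conj_I, Complex.conj_ofReal]
    congr 1
    ring
  have e7 : ∀ X : Matrix (Fin m) (Fin m) ℂ, starRingEnd ℂ (Matrix.trace (toC M * X))
      = Matrix.trace (toC M * conjM X) := fun X => by
    rw [conj_trace, conjM_mul, conjM_toC]
  rw [inner_covMap, inner_covMap, jStar_eq, jStar_eq, map_mul, e6, e7, e7, e4, e5, e3']
  rw [← e4, ← e5, smul_eq_spAct, smul_eq_spAct, e2]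
  simp only [Matrix.mul_add, Matrix.mul_sub, Matrix.trace_add, Matrix.trace_sub] at e1 ⊢
  rw [e1]
  have e8 : ∀ A B C D E : ℂ, cexp (-(π * Complex.I * (A + B - C - D + E)))
      = cexp (π * Complex.I * (D - B)) * cexp (-(π * Complex.I * (E - C)))
        * cexp (-(π * Complex.I * A)) := fun A B C D E => by
    rw [← Complex.exp_add, ← Complex.exp_add]
    congr 1
    ring
  rw [e8]
  ring

end ReproducingKernel

/-! ### Fourier uniqueness and density of the Gaussians -/

section FourierUniqueness

variable {E : Type*} [NormedAddCommGroup E] [NormedSpace ℝ E] [MeasurableSpace E] [BorelSpace E]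
  [SecondCountableTopology E] [CompleteSpace E]

/-- An integrable real function whose Fourier transform vanishes is zero almost everywhere: the
finite measures with densities the positive and the negative part have the same characteristic
function. -/
theorem ae_eq_zero_of_real_fourier {μ : Measure E} {v : E → ℝ} (hv : Integrable v μ)
    (h : ∀ L : StrongDual ℝ E, ∫ x, (v x : ℂ) * cexp (L x * Complex.I) ∂μ = 0) : v =ᵐ[μ] 0 := by
  have hm : ∀ w : E → ℝ, Integrable w μ → AEMeasurable (fun x => ENNReal.ofReal (w x)) μ :=
    fun w hw => hw.1.aemeasurable.ennreal_ofReal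
  have hf : ∀ w : E → ℝ, Integrable w μ →
      IsFiniteMeasure (μ.withDensity fun x => ENNReal.ofReal (w x)) :=
    fun w hw => isFiniteMeasure_withDensity_ofReal hw.2
  have := hf _ hv
  have := hf _ hv.neg
  have hchar : ∀ (w : E → ℝ), Integrable w μ → ∀ L : StrongDual ℝ E,
      charFunDual (μ.withDensity fun x => ENNReal.ofReal (w x)) L
        = ∫ x, ((max (w x) 0 : ℝ) : ℂ) * cexp (L x * Complex.I) ∂μ := by
    intro w hw L
    rw [charFunDual_apply, integral_withDensity_eq_integral_toReal_smul₀ (hm w hw)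
      (Filter.Eventually.of_forall fun x => ENNReal.ofReal_lt_top)]
    refine integral_congr_ae (Filter.Eventually.of_forall fun x => ?_)
    simp only [ENNReal.toReal_ofReal', Complex.real_smul]
  have hint : ∀ (w : E → ℝ), Integrable w μ → ∀ L : StrongDual ℝ E,
      Integrable (fun x => ((max (w x) 0 : ℝ) : ℂ) * cexp (L x * Complex.I)) μ := by
    intro w hw L
    have h1 : Integrable (fun x => ((max (w x) 0 : ℝ) : ℂ)) μ := hw.pos_part.ofReal
    refine h1.mul_bdd (c := 1) (by fun_prop) (Filter.Eventually.of_forall fun x => ?_)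
    rw [Complex.norm_exp_ofReal_mul_I]
  have heq : (μ.withDensity fun x => ENNReal.ofReal (v x))
      = μ.withDensity fun x => ENNReal.ofReal ((-v) x) := by
    refine Measure.ext_of_charFunDual ?_
    ext L
    rw [hchar _ hv, hchar _ hv.neg, ← sub_eq_zero, ← integral_sub (hint _ hv L) (hint _ hv.neg L),
      ← h L]
    refine integral_congr_ae (Filter.Eventually.of_forall fun x => ?_)
    simp only [← sub_mul, ← Complex.ofReal_sub, Pi.neg_apply]
    congr 2
    rcases le_total (v x) 0 with h0 | h0
    · rw [max_eq_right h0, max_eq_left (by linarith)]; ring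
    · rw [max_eq_left h0, max_eq_right (by linarith)]; ring
  have hae := (withDensity_eq_iff (hm _ hv) (hm _ hv.neg) (by
    have := (hf _ hv).measure_univ_lt_top
    rw [withDensity_apply _ MeasurableSet.univ, Measure.restrict_univ] at this
    exact this.ne)).mp heq
  -- The positive and the negative part of `v` coincide, so both vanish.
  filter_upwards [hae] with x hx
  simp only [Pi.neg_apply] at hx
  rcases le_total (v x) 0 with h0 | h0
  · rw [ENNReal.ofReal_of_nonpos h0, eq_comm, ENNReal.ofReal_eq_zero] at hx
    simp only [Pi.zero_apply]
    linarith
  · rw [ENNReal.ofReal_of_nonpos (by linarith : -v x ≤ 0), ENNReal.ofReal_eq_zero] at hx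
    simp only [Pi.zero_apply]
    linarith

/-- An integrable function whose Fourier transform vanishes is zero almost everywhere. -/
theorem ae_eq_zero_of_fourier {μ : Measure E} {u : E → ℂ} (hu : Integrable u μ)
    (h : ∀ L : StrongDual ℝ E, ∫ x, u x * cexp (L x * Complex.I) ∂μ = 0) : u =ᵐ[μ] 0 := by
  have hint : ∀ w : E → ℂ, Integrable w μ → ∀ L : StrongDual ℝ E,
      Integrable (fun x => w x * cexp (L x * Complex.I)) μ := by
    intro w hw L
    refine hw.mul_bdd (c := 1) (by fun_prop) (Filter.Eventually.of_forall fun x => ?_)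
    rw [Complex.norm_exp_ofReal_mul_I]
  have hu' : Integrable (fun x => starRingEnd ℂ (u x)) μ :=
    (LinearIsometryEquiv.integrable_comp_iff Complex.conjLIE).mpr hu
  have hc : ∀ L : StrongDual ℝ E, ∫ x, starRingEnd ℂ (u x) * cexp (L x * Complex.I) ∂μ = 0 := by
    intro L
    have h1 := congrArg (starRingEnd ℂ) (h (-L))
    rw [← integral_conj, map_zero] at h1
    rw [← h1]
    refine integral_congr_ae (Filter.Eventually.of_forall fun x => ?_)
    simp only [map_mul, ← Complex.exp_conj, Complex.conj_ofReal, Complex.conj_I]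
    congr 2
    simp
  have hre := ae_eq_zero_of_real_fourier hu.re fun L => by
    have h1 := (integral_add (hint _ hu L) (hint _ hu' L)).trans (by rw [h L, hc L, add_zero])
    have h2 := congrArg (fun z => (1 / 2 : ℂ) * z) h1
    simp only [mul_zero] at h2
    rw [← h2, ← integral_const_mul]
    refine integral_congr_ae (Filter.Eventually.of_forall fun x => ?_)
    have := Complex.re_eq_add_conj (u x)
    simp only [RCLike.re_to_complex, this]
    ring
  have him := ae_eq_zero_of_real_fourier hu.im fun L => by
    have h1 := (integral_sub (hint _ hu L) (hint _ hu' L)).trans (by rw [h L, hc L, sub_zero])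
    have h2 := congrArg (fun z => (1 / (2 * Complex.I) : ℂ) * z) h1
    simp only [mul_zero] at h2
    rw [← h2, ← integral_const_mul]
    refine integral_congr_ae (Filter.Eventually.of_forall fun x => ?_)
    have := Complex.im_eq_sub_conj (u x)
    simp only [RCLike.im_to_complex, this]
    ring
  filter_upwards [hre, him] with x h1 h2
  exact Complex.ext h1 h2

end FourierUniqueness

section Density

variable {n m : ℕ}

/-- Fourier uniqueness on `ℝ^(m,n)` with respect to the characters `x ↦ exp (2 π i σ(M x Zᵗ))`. -/
theorem ae_eq_zero_of_trace_fourier {M : Matrix (Fin m) (Fin m) ℝ} (hM : M.PosDef)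
    {u : Matrix (Fin m) (Fin n) ℝ → ℂ} (hu : Integrable u)
    (h : ∀ Z : Matrix (Fin m) (Fin n) ℝ,
      ∫ x, u x * cexp (2 * π * Complex.I * Matrix.trace (M * (x * Zᵀ))) = 0) :
    u =ᵐ[volume] 0 := by
  refine ae_eq_zero_of_fourier (E := Fin m → Fin n → ℝ) (μ := (volume : Measure _)) hu fun L => ?_
  let ℓ : Matrix (Fin m) (Fin n) ℝ := fun i j => L (Pi.single i (Pi.single j 1))
  have hL : ∀ x : Matrix (Fin m) (Fin n) ℝ, L x = Matrix.trace (x * ℓᵀ) := by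
    intro x
    have hx : (x : Fin m → Fin n → ℝ) = ∑ i, ∑ j, x i j • Pi.single i (Pi.single j 1) := by
      ext i j
      simp [Finset.sum_apply, Pi.single_apply, ite_apply]
    have h1 : L x = ∑ i, ∑ j, x i j * ℓ i j := by
      conv_lhs => rw [hx]
      simp only [map_sum, map_smul, smul_eq_mul, ℓ]
    rw [h1]
    simp [Matrix.trace, Matrix.mul_apply]
  have hd : IsUnit M.det := isUnit_iff_ne_zero.mpr hM.det_pos.ne'
  have hMs : Mᵀ = M := isSymm_of_posDef hM
  have hZ := h ((2 * π)⁻¹ • (M⁻¹ * ℓ))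
  rw [← hZ]
  refine integral_congr_ae (μ := (volume : Measure (Matrix (Fin m) (Fin n) ℝ)))
    (Filter.Eventually.of_forall fun x => ?_)
  have e1 : Matrix.trace (M * (x * ((2 * π)⁻¹ • (M⁻¹ * ℓ))ᵀ)) = (2 * π)⁻¹ * L x := by
    rw [hL, Matrix.transpose_smul, Matrix.mul_smul, Matrix.mul_smul, Matrix.trace_smul, smul_eq_mul,
      Matrix.transpose_mul, Matrix.transpose_nonsing_inv, hMs, Matrix.trace_mul_comm,
      Matrix.mul_assoc, Matrix.mul_assoc, Matrix.nonsing_inv_mul _ hd, Matrix.mul_one]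
  simp only [e1]
  congr 2
  have hpi : (π : ℂ) ≠ 0 := by exact_mod_cast Real.pi_ne_zero
  push_cast
  field_simp

/-- The Gaussian at `(Ω, Z)` is the square of the square-integrable Gaussian at
`(Ω / 2, Z / 2)`. -/
theorem integrable_gaussFun {M : Matrix (Fin m) (Fin m) ℝ} (hM : M.PosDef)
    (p : SiegelJacobi n m) : Integrable (gaussFun M p) := by
  let q : SiegelJacobi n m := (⟨(2⁻¹ : ℝ) • p.1.1, by
    have h : p.1.1ᵀ = p.1.1 := p.1.2.1
    simp [Matrix.IsSymm, h], by
    have : ((2⁻¹ : ℝ) • p.1.1).map Complex.im = (2⁻¹ : ℝ) • p.1.1.map Complex.im := by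
      ext i j; simp
    rw [this]
    exact p.1.2.2.smul (by norm_num)⟩, (2⁻¹ : ℝ) • p.2)
  have h := (memLp_gaussFun hM q).integrable_mul (memLp_gaussFun hM q)
  refine h.congr (Filter.Eventually.of_forall fun x => ?_)
  simp only [Pi.mul_apply, gaussFun, q]
  rw [← Complex.exp_add, ← mul_add, ← Matrix.trace_add, ← Matrix.mul_add, ← two_smul ℝ]
  congr 4
  rw [Matrix.transpose_smul]
  simp only [Matrix.mul_smul, Matrix.smul_mul, smul_add]
  rw [smul_smul, smul_comm (2 : ℂ) (2⁻¹ : ℝ), smul_smul]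
  norm_num

theorem trace_toC {k : ℕ} (X : Matrix (Fin k) (Fin k) ℝ) :
    Matrix.trace (toC X) = ((Matrix.trace X : ℝ) : ℂ) := by
  simp [Matrix.trace, toC]

theorem gaussFun_toC (M : Matrix (Fin m) (Fin m) ℝ) (Ω : SiegelHalf n)
    (Z : Matrix (Fin m) (Fin n) ℝ) (x : Matrix (Fin m) (Fin n) ℝ) :
    gaussFun M (Ω, toC Z) x
      = gaussFun M (Ω, 0) x * cexp (2 * π * Complex.I * Matrix.trace (M * (x * Zᵀ))) := by
  have h : ((Matrix.trace (M * (x * Zᵀ)) : ℝ) : ℂ)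
      = Matrix.trace (toC M * (toC x * (toC Z)ᵀ)) := by
    rw [← trace_toC, toC_mul, toC_mul]; rfl
  rw [gaussFun, gaussFun, h, ← Complex.exp_add]
  congr 1
  simp only [Matrix.mul_add, Matrix.trace_add, Matrix.mul_smul, Matrix.trace_smul, smul_eq_mul,
    Matrix.transpose_zero, Matrix.mul_zero, Matrix.trace_zero]
  ring

/-- The Gaussians `F^(M)` span a dense subspace of `L²`: if `f` is orthogonal to all of them, then
the product of `f` with the conjugate of the Gaussian at `(i I_n, 0)` has vanishing Fourier
transform, since a real `Z` only contributes a character. -/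
theorem dense_span_covMap {M : Matrix (Fin m) (Fin m) ℝ} (hM : M.PosDef) :
    (Submodule.span ℂ (Set.range fun p : SiegelJacobi n m => covMap hM p)).topologicalClosure
      = ⊤ := by
  rw [Submodule.topologicalClosure_eq_top_iff, Submodule.eq_bot_iff]
  intro f hf
  have h0 : ∀ p : SiegelJacobi n m, ∫ x, starRingEnd ℂ (gaussFun M p x) * f x = 0 := by
    intro p
    have h1 := (Submodule.mem_orthogonal _ f).mp hf (covMap hM p)
      (Submodule.subset_span ⟨p, rfl⟩)
    rw [L2.inner_def] at h1
    rw [← h1]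
    refine integral_congr_ae ?_
    filter_upwards [covMap_coeFn hM p] with x hx
    rw [hx, RCLike.inner_apply, mul_comm]
  let p₀ : SiegelJacobi n m := (basePoint n, 0)
  have hu : Integrable (fun x => starRingEnd ℂ (gaussFun M p₀ x) * f x) := by
    have h1 : MemLp (fun x => starRingEnd ℂ (gaussFun M p₀ x)) 2 volume :=
      (memLp_gaussFun hM p₀).star
    exact h1.integrable_mul (Lp.memLp f)
  have h2 := ae_eq_zero_of_trace_fourier hM hu fun Z => by
    rw [← h0 (basePoint n, toC (-Z))]
    refine integral_congr_ae (Filter.Eventually.of_forall fun x => ?_)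
    simp only [gaussFun_toC, map_mul, p₀, ← Complex.exp_conj, Complex.conj_ofReal, Complex.conj_I,
      Complex.conj_ofNat, Matrix.transpose_neg, Matrix.mul_neg, Matrix.trace_neg]
    push_cast
    ring_nf
  rw [Lp.eq_zero_iff_ae_eq_zero]
  filter_upwards [h2] with x hx
  have h3 : starRingEnd ℂ (gaussFun M p₀ x) ≠ 0 := by
    rw [Ne, map_eq_zero]; exact Complex.exp_ne_zero _
  exact (mul_eq_zero.mp hx).resolve_left h3

end Density

/-! ### The representation defined by its action on Gaussians -/

section Extension

variable {ι H : Type*} [NormedAddCommGroup H] [InnerProductSpace ℂ H]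

theorem norm_linearCombination_eq {F G : ι → H}
    (h : ∀ i j, inner ℂ (G i) (G j) = inner ℂ (F i) (F j)) (c : ι →₀ ℂ) :
    ‖Finsupp.linearCombination ℂ G c‖ = ‖Finsupp.linearCombination ℂ F c‖ := by
  have h1 : inner ℂ (Finsupp.linearCombination ℂ G c) (Finsupp.linearCombination ℂ G c)
      = inner ℂ (Finsupp.linearCombination ℂ F c) (Finsupp.linearCombination ℂ F c) := by
    simp only [Finsupp.linearCombination_apply, Finsupp.sum_inner, Finsupp.inner_sum,
      inner_smul_left, inner_smul_right, h]
  rw [@norm_eq_sqrt_re_inner ℂ, @norm_eq_sqrt_re_inner ℂ, h1]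

theorem denseRange_linearCombination {F : ι → H}
    (h : (Submodule.span ℂ (Set.range F)).topologicalClosure = ⊤) :
    DenseRange (Finsupp.linearCombination ℂ F) := by
  rw [DenseRange, ← LinearMap.coe_range, Finsupp.range_linearCombination]
  exact Submodule.dense_iff_topologicalClosure_eq_top.mpr h

/-- Two total families with the same Gram matrix are related by a unitary operator. -/
theorem exists_unitary_of_gram [CompleteSpace H] {F G : ι → H}
    (hF : (Submodule.span ℂ (Set.range F)).topologicalClosure = ⊤)
    (hG : (Submodule.span ℂ (Set.range G)).topologicalClosure = ⊤)
    (h : ∀ i j, inner ℂ (G i) (G j) = inner ℂ (F i) (F j)) :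
    ∃ U : H ≃ₗᵢ[ℂ] H, ∀ i, U (F i) = G i := by
  refine ⟨(LinearEquiv.refl ℂ (ι →₀ ℂ)).extendOfIsometry (Finsupp.linearCombination ℂ F)
    (Finsupp.linearCombination ℂ G) (denseRange_linearCombination hF)
    (denseRange_linearCombination hG) (norm_linearCombination_eq h), fun i => ?_⟩
  have h1 := LinearEquiv.extendOfIsometry_eq (LinearEquiv.refl ℂ (ι →₀ ℂ)) _ _
    (denseRange_linearCombination hF) (denseRange_linearCombination hG)
    (norm_linearCombination_eq h) (Finsupp.single i 1)
  simpa using h1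

end Extension

section Representation

variable {n m : ℕ} {M : Matrix (Fin m) (Fin m) ℝ}

theorem eq_of_eqOn_covMap {F : Type*} [NormedAddCommGroup F] [NormedSpace ℂ F] (hM : M.PosDef)
    {S T : L2 n m →L[ℂ] F} (h : ∀ p, S (covMap hM p) = T (covMap hM p)) : S = T := by
  refine ContinuousLinearMap.ext_on
    (Submodule.dense_iff_topologicalClosure_eq_top.mpr (dense_span_covMap hM)) ?_
  rintro _ ⟨p, rfl⟩
  exact h p

theorem linearIsometryEquiv_ext_covMap (hM : M.PosDef) {U V : L2 n m ≃ₗᵢ[ℂ] L2 n m}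
    (h : ∀ p, U (covMap hM p) = V (covMap hM p)) : U = V := by
  have key := eq_of_eqOn_covMap hM (S := (U.toContinuousLinearEquiv : L2 n m →L[ℂ] L2 n m))
    (T := (V.toContinuousLinearEquiv : L2 n m →L[ℂ] L2 n m)) h
  ext1 f
  exact congrArg (fun T : L2 n m →L[ℂ] L2 n m => T f) key

theorem dense_span_smul_covMap (hM : M.PosDef) (x : GStarJ n m) :
    (Submodule.span ℂ (Set.range fun p : SiegelJacobi n m =>
      (jStar M x p)⁻¹ • covMap hM (x • p))).topologicalClosure = ⊤ := by
  rw [← top_le_iff, ← dense_span_covMap (n := n) hM]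
  refine Submodule.topologicalClosure_mono (Submodule.span_le.mpr ?_)
  rintro _ ⟨q, rfl⟩
  have h1 : x • (x⁻¹ • q) = q := by
    rw [← mul_smul_siegelJacobi, mul_inv_cancel, one_smul_siegelJacobi]
  have h2 := Submodule.smul_mem _ (jStar M x (x⁻¹ • q)) (Submodule.subset_span (R := ℂ)
    (Set.mem_range_self (f := fun p : SiegelJacobi n m => (jStar M x p)⁻¹ • covMap hM (x • p))
      (x⁻¹ • q)))
  simp only [smul_smul, mul_inv_cancel₀ (jStar_ne_zero _ _ _), one_smul, h1] at h2
  exact h2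

theorem exists_weil_operator (hM : M.PosDef) (x : GStarJ n m) :
    ∃ U : L2 n m ≃ₗᵢ[ℂ] L2 n m, ∀ p, U (covMap hM p) = (jStar M x p)⁻¹ • covMap hM (x • p) := by
  refine exists_unitary_of_gram (dense_span_covMap hM) (dense_span_smul_covMap hM x) fun p q => ?_
  have h1 := jStar_ne_zero M x p
  have h2 := jStar_ne_zero M x q
  have h3 : starRingEnd ℂ (jStar M x p) ≠ 0 := (map_ne_zero _).mpr h1
  rw [inner_smul_left, inner_smul_right, inner_covMap_smul hM x q p, map_inv₀, mul_assoc,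
    inv_mul_cancel_left₀ h2, inv_mul_cancel_left₀ h3]

/-- The unitary operator by which an element of `G_*^J` acts on the Gaussians `F^(M)`. -/
noncomputable def weilOp (hM : M.PosDef) (x : GStarJ n m) : L2 n m ≃ₗᵢ[ℂ] L2 n m :=
  Classical.choose (exists_weil_operator hM x)

theorem weilOp_covMap (hM : M.PosDef) (x : GStarJ n m) (p : SiegelJacobi n m) :
    weilOp hM x (covMap hM p) = (jStar M x p)⁻¹ • covMap hM (x • p) :=
  Classical.choose_spec (exists_weil_operator hM x) p

theorem weilOp_mul (hM : M.PosDef) (x y : GStarJ n m) :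
    weilOp hM (x * y) = weilOp hM x * weilOp hM y := by
  refine linearIsometryEquiv_ext_covMap hM fun p => ?_
  change _ = weilOp hM x (weilOp hM y (covMap hM p))
  rw [weilOp_covMap, weilOp_covMap, map_smul, weilOp_covMap,
    smul_smul, jStar_mul (isSymm_of_posDef hM), mul_inv, mul_comm, mul_smul_siegelJacobi]

/-- The Schrödinger-Weil representation, defined by its action on the Gaussians `F^(M)`. -/
noncomputable def weilRep (hM : M.PosDef) : GStarJ n m →* (L2 n m ≃ₗᵢ[ℂ] L2 n m) :=
  MonoidHom.mk' (weilOp hM) (weilOp_mul hM)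

theorem weilRep_covMap (hM : M.PosDef) (x : GStarJ n m) (p : SiegelJacobi n m) :
    weilRep hM x (covMap hM p) = (jStar M x p)⁻¹ • covMap hM (x • p) :=
  weilOp_covMap hM x p

end Representation

section WeightedComposition

variable {n m : ℕ} {M : Matrix (Fin m) (Fin m) ℝ}

theorem eLpNorm_weighted_comp_le {w : Matrix (Fin m) (Fin n) ℝ → ℂ}
    {ψ : Matrix (Fin m) (Fin n) ℝ → Matrix (Fin m) (Fin n) ℝ} {K : ℝ} {c : ENNReal}
    (hw : ∀ x, ‖w x‖ ≤ K) (hψ : Measurable ψ) (hc : c ≠ 0)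
    (hmap : Measure.map ψ volume = c • volume)
    {f : Matrix (Fin m) (Fin n) ℝ → ℂ} (hf : AEStronglyMeasurable f volume) :
    eLpNorm (fun x => w x * f (ψ x)) 2 volume
      ≤ ENNReal.ofReal K * (c ^ (1 / (2 : ENNReal)).toReal * eLpNorm f 2 volume) := by
  have h1 : eLpNorm (fun x => w x * f (ψ x)) 2 volume
      ≤ ENNReal.ofReal K * eLpNorm (f ∘ ψ) 2 volume := by
    refine eLpNorm_le_mul_eLpNorm_of_ae_le_mul (Filter.Eventually.of_forall fun x => ?_) 2
    rw [norm_mul]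
    exact mul_le_mul_of_nonneg_right (hw x) (norm_nonneg _)
  refine h1.trans (le_of_eq ?_)
  rw [← eLpNorm_map_measure (by rw [hmap]; exact hf.smul_measure c) hψ.aemeasurable, hmap,
    eLpNorm_smul_measure_of_ne_zero hc, smul_eq_mul]

/-- A bounded operator which is a weighted composition operator on the Gaussians `F^(M)` is that
operator on all of `L²`. -/
theorem ae_eq_weighted_comp (hM : M.PosDef) (U : L2 n m →L[ℂ] L2 n m)
    {w : Matrix (Fin m) (Fin n) ℝ → ℂ}
    {ψ : Matrix (Fin m) (Fin n) ℝ → Matrix (Fin m) (Fin n) ℝ} {K : ℝ} {c : ENNReal}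
    (hwm : Continuous w) (hw : ∀ x, ‖w x‖ ≤ K) (hψ : Measurable ψ) (hc : c ≠ 0) (hc' : c ≠ ⊤)
    (hmap : Measure.map ψ volume = c • volume)
    (h : ∀ p, U (covMap hM p) =ᵐ[volume] fun x => w x * gaussFun M p (ψ x)) (f : L2 n m) :
    U f =ᵐ[volume] fun x => w x * f (ψ x) := by
  have hq : Measure.QuasiMeasurePreserving ψ volume volume :=
    ⟨hψ, by rw [hmap]; exact Measure.smul_absolutelyContinuous⟩
  have hmem : ∀ f : L2 n m, MemLp (fun x => w x * f (ψ x)) 2 volume := fun f => by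
    refine ⟨hwm.aestronglyMeasurable.mul
      ((Lp.aestronglyMeasurable f).comp_quasiMeasurePreserving hq), ?_⟩
    refine (eLpNorm_weighted_comp_le hw hψ hc hmap (Lp.aestronglyMeasurable f)).trans_lt ?_
    refine ENNReal.mul_lt_top ENNReal.ofReal_lt_top (ENNReal.mul_lt_top ?_ (Lp.memLp f).2)
    exact ENNReal.rpow_lt_top_of_nonneg (by positivity) hc'
  let C : ENNReal := ENNReal.ofReal K * c ^ (1 / (2 : ENNReal)).toReal
  have hC : C ≠ ⊤ :=
    ENNReal.mul_ne_top ENNReal.ofReal_ne_top (ENNReal.rpow_lt_top_of_nonneg (by positivity) hc').ne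
  let T₀ : L2 n m →ₗ[ℂ] L2 n m :=
    { toFun := fun f => (hmem f).toLp _
      map_add' := fun f g => by
        rw [← MemLp.toLp_add]
        refine MemLp.toLp_congr _ _ ?_
        filter_upwards [hq.ae_eq_comp (Lp.coeFn_add f g)] with x hx
        simp only [Function.comp_apply, Pi.add_apply] at hx ⊢
        rw [hx, mul_add]
      map_smul' := fun a f => by
        rw [RingHom.id_apply, ← MemLp.toLp_const_smul]
        refine MemLp.toLp_congr _ _ ?_
        filter_upwards [hq.ae_eq_comp (Lp.coeFn_smul a f)] with x hx
        simp only [Function.comp_apply, Pi.smul_apply, smul_eq_mul] at hx ⊢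
        rw [hx, mul_left_comm] }
  let T : L2 n m →L[ℂ] L2 n m := T₀.mkContinuous C.toReal fun f => by
    change ‖(hmem f).toLp _‖ ≤ _
    rw [Lp.norm_toLp, Lp.norm_def, ← ENNReal.toReal_mul]
    refine ENNReal.toReal_mono (ENNReal.mul_ne_top hC (Lp.memLp f).2.ne) ?_
    refine (eLpNorm_weighted_comp_le hw hψ hc hmap (Lp.aestronglyMeasurable f)).trans (le_of_eq ?_)
    rw [← mul_assoc]
  have hT : ∀ f, T f =ᵐ[volume] fun x => w x * f (ψ x) := fun f => (hmem f).coeFn_toLp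
  have hUT : U = T := eq_of_eqOn_covMap hM fun p => by
    refine Lp.ext ((h p).trans ?_)
    filter_upwards [hT (covMap hM p), hq.ae_eq_comp (covMap_coeFn hM p)] with x h1 h2
    simp only [Function.comp_apply] at h2
    rw [h1, h2]
  rw [hUT]
  exact hT f

end WeightedComposition

/-! ### The operators over the Heisenberg group, `t(b)` and `g(α)` -/

section Formulas

variable {n m : ℕ} {M : Matrix (Fin m) (Fin m) ℝ}

theorem blocks_of_eq {g : Sp n} {A B C D : Matrix (Fin n) (Fin n) ℝ}
    (h : g.1 = fromBlocks A B C D) : g.A = A ∧ g.B = B ∧ g.C = C ∧ g.D = D := by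
  rw [sp_eq g] at h
  exact fromBlocks_inj.mp h

theorem toC_zero {k l : ℕ} : toC (0 : Matrix (Fin k) (Fin l) ℝ) = 0 := by
  ext; simp [toC]

theorem heisAct_one (p : SiegelJacobi n m) : heisAct 1 p = p := by
  refine Prod.ext rfl ?_
  change p.2 + toC (0 : Matrix (Fin m) (Fin n) ℝ) * p.1.1
    + toC (0 : Matrix (Fin m) (Fin n) ℝ) = p.2
  simp [toC_zero]

theorem mk_one_smul (a : GStar n) (p : SiegelJacobi n m) :
    (⟨a, 1⟩ : GStarJ n m) • p = spAct a.g p := by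
  rw [smul_eq_spAct, heisAct_one]

theorem one_mk_smul (h : Heis n m) (p : SiegelJacobi n m) :
    (⟨1, h⟩ : GStarJ n m) • p = heisAct h p := by
  rw [smul_eq_spAct]
  change spAct 1 (heisAct h p) = _
  refine Prod.ext (one_smul _ p.1) ?_
  simp [spAct, denom_one]

theorem jStar_mk_one (a : GStar n) (p : SiegelJacobi n m) :
    jStar M ⟨a, 1⟩ p
      = cexp (π * Complex.I * Matrix.trace (toC M * spExp a.g p)) * jHalf a p.1 ^ m := by
  have h : heisExp (1 : Heis n m) p = 0 := by
    change toC (0 : Matrix (Fin m) (Fin n) ℝ) * p.1.1 * (toC (0 : Matrix (Fin m) (Fin n) ℝ))ᵀ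
      + (2 : ℂ) • (toC (0 : Matrix (Fin m) (Fin n) ℝ) * p.2ᵀ)
      + toC (0 : Matrix (Fin m) (Fin m) ℝ)
      + toC (0 : Matrix (Fin m) (Fin n) ℝ) * (toC (0 : Matrix (Fin m) (Fin n) ℝ))ᵀ = 0
    simp [toC_zero]
  rw [jStar_eq, heisAct_one, h]
  simp

theorem jHalf_one (Ω : SiegelHalf n) : jHalf 1 Ω = 1 := by
  have h := jHalf_mul 1 1 Ω
  have h1 : (1 : GStar n).g • Ω = Ω := one_smul _ Ω
  rw [mul_one, h1] at h
  exact (mul_eq_left₀ (jHalf_ne_zero _ _)).mp h.symm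

theorem slope_of_C_eq_zero {g : Sp n} (hC : g.C = 0) (Ω : Matrix (Fin n) (Fin n) ℂ) :
    slope g Ω = 0 := by
  rw [slope, hC, toC_zero, Matrix.mul_zero]

theorem jStar_one_mk (h : Heis n m) (p : SiegelJacobi n m) :
    jStar M ⟨1, h⟩ p = cexp (-(π * Complex.I * Matrix.trace (toC M * heisExp h p))) := by
  have h1 : spExp (1 : GStar n).g (heisAct h p) = 0 := by
    have : slope (1 : GStar n).g (heisAct h p).1.1 = 0 :=
      slope_of_C_eq_zero (sp_one (n := n)).2.2.1 _
    rw [spExp, this, Matrix.mul_zero, Matrix.zero_mul]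
  rw [jStar_eq]
  simp [h1, jHalf_one]

/-- On the elements with `C = 0` the factor `ε(g; Ω, i)` is trivial. -/
theorem jHalf_of_C_eq_zero (a : GStar n) (hC : a.g.C = 0) (Ω : SiegelHalf n) :
    jHalf a Ω = a.ε⁻¹ * (√|a.g.D.det| : ℝ) := by
  have hden : ∀ Ω : SiegelHalf n, denom a.g Ω.1 = toC a.g.D := fun Ω => by
    rw [denom, hC, toC_zero, Matrix.zero_mul, zero_add]
  have hD : a.g.D.det ≠ 0 := by
    have := denom_det_ne_zero a.g Ω
    rw [hden, det_toC] at this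
    exact_mod_cast this
  have hn : ‖(toC a.g.D).det‖ = |a.g.D.det| := by
    rw [det_toC, Complex.norm_real, Real.norm_eq_abs]
  have hm := halfDiff_mem (a.g • Ω) (a.g • basePoint n)
  have h1 := halfDiff_moeb a.g Ω (basePoint n)
  rw [hden, hden, conjM_toC] at h1
  have hDt : (a.g.D)ᵀ.det ≠ 0 := by rwa [Matrix.det_transpose]
  have h2 := detSqrt_congr hDt hm
  rw [Matrix.transpose_transpose, ← toC_transpose, smul_val, smul_val, h1,
    Matrix.det_transpose] at h2
  have h3 := detSqrt_halfDiff_ne_zero (a.g • Ω) (a.g • basePoint n)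
  rw [smul_val, smul_val] at h3
  have h4 : ((√|a.g.D.det| : ℝ) : ℂ) * ((√|a.g.D.det| : ℝ) : ℂ) = ((|a.g.D.det| : ℝ) : ℂ) := by
    rw [← Complex.ofReal_mul, Real.mul_self_sqrt (abs_nonneg _)]
  have h5 : √|a.g.D.det| ≠ 0 := Real.sqrt_ne_zero'.mpr (abs_pos.mpr hD)
  have h5' : ((√|a.g.D.det| : ℝ) : ℂ) ≠ 0 := Complex.ofReal_ne_zero.mpr h5
  rw [jHalf, epsFactor, hden, hden, hn, smul_val, smul_val, h2, ← h4]
  push_cast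
  field_simp

theorem weilRep_covMap_ae (hM : M.PosDef) (x : GStarJ n m) (p : SiegelJacobi n m) :
    weilRep hM x (covMap hM p)
      =ᵐ[volume] fun y => (jStar M x p)⁻¹ * gaussFun M (x • p) y := by
  rw [weilRep_covMap]
  filter_upwards [Lp.coeFn_smul (jStar M x p)⁻¹ (covMap hM (x • p)), covMap_coeFn hM (x • p)]
    with y h1 h2
  rw [h1, Pi.smul_apply, h2, smul_eq_mul]

/-- To identify an operator `weilRep hM x` with a weighted composition operator it is enough to do
so on the Gaussians. -/
theorem weilRep_ae_eq (hM : M.PosDef) (x : GStarJ n m)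
    {w : Matrix (Fin m) (Fin n) ℝ → ℂ}
    {ψ : Matrix (Fin m) (Fin n) ℝ → Matrix (Fin m) (Fin n) ℝ} {K : ℝ} {c : ENNReal}
    (hwm : Continuous w) (hw : ∀ x, ‖w x‖ ≤ K) (hψ : Measurable ψ) (hc : c ≠ 0) (hc' : c ≠ ⊤)
    (hmap : Measure.map ψ volume = c • volume)
    (h : ∀ p y, (jStar M x p)⁻¹ * gaussFun M (x • p) y = w y * gaussFun M p (ψ y)) (f : L2 n m) :
    weilRep hM x f =ᵐ[volume] fun y => w y * f (ψ y) := by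
  refine ae_eq_weighted_comp hM ((weilRep hM x).toContinuousLinearEquiv : L2 n m →L[ℂ] L2 n m)
    hwm hw hψ hc hc' hmap (fun p => ?_) f
  exact (weilRep_covMap_ae hM x p).trans (Filter.Eventually.of_forall fun y => h p y)

theorem gaussFun_heisAct (hM : M.IsSymm) (h : Heis n m) (p : SiegelJacobi n m)
    (x : Matrix (Fin m) (Fin n) ℝ) :
    cexp (π * Complex.I * Matrix.trace (toC M * heisExp h p)) * gaussFun M (heisAct h p) x
      = cexp (π * Complex.I * Matrix.trace (M * (h.kap + h.mu * h.lamᵀ + (2 : ℝ) • (x * h.muᵀ))))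
        * gaussFun M p (x + h.lam) := by
  have e : ((Matrix.trace (M * (h.kap + h.mu * h.lamᵀ + (2 : ℝ) • (x * h.muᵀ))) : ℝ) : ℂ)
      = Matrix.trace (toC M * (toC h.kap + toC h.mu * (toC h.lam)ᵀ
        + (2 : ℂ) • (toC x * (toC h.mu)ᵀ))) := by
    rw [← trace_toC, toC_mul, two_smul, two_smul]
    simp only [toC_add, toC_mul]; rfl
  have hΩ : p.1.1ᵀ = p.1.1 := p.1.2.1
  rw [gaussFun, gaussFun, e, ← Complex.exp_add, ← Complex.exp_add, ← mul_add, ← mul_add,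
    ← Matrix.trace_add, ← Matrix.trace_add, ← Matrix.mul_add, ← Matrix.mul_add]
  congr 2
  have key : heisExp h p + (toC x * (heisAct h p).1.1 * (toC x)ᵀ
        + (2 : ℂ) • (toC x * (heisAct h p).2ᵀ))
      = (toC h.kap + toC h.mu * (toC h.lam)ᵀ + (2 : ℂ) • (toC x * (toC h.mu)ᵀ)
        + (toC (x + h.lam) * p.1.1 * (toC (x + h.lam))ᵀ + (2 : ℂ) • (toC (x + h.lam) * p.2ᵀ)))
        + ((toC x * p.1.1 * (toC h.lam)ᵀ) - (toC x * p.1.1 * (toC h.lam)ᵀ)ᵀ) := by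
    simp only [heisExp, heisAct, shiftZ, toC_add, Matrix.transpose_add, Matrix.transpose_mul, hΩ,
      Matrix.transpose_transpose, Matrix.mul_add, Matrix.add_mul, two_smul, Matrix.mul_assoc]
    abel
  rw [key, Matrix.mul_add, Matrix.trace_add, Matrix.mul_sub, Matrix.trace_sub,
    trace_mul_transpose_symm hM, sub_self, add_zero]

theorem norm_cexp_pi_I (r : ℝ) : ‖cexp (π * Complex.I * r)‖ = 1 := by
  have : (π * Complex.I * r : ℂ) = ((π * r : ℝ) : ℂ) * Complex.I := by push_cast; ring
  rw [this, Complex.norm_exp_ofReal_mul_I]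

theorem weilRep_heis (hM : M.PosDef) (h : Heis n m) (f : L2 n m) :
    weilRep hM ⟨1, h⟩ f =ᵐ[volume] fun x =>
      Complex.exp (π * Complex.I * Matrix.trace (M * (h.kap + h.mu * h.lamᵀ
        + (2 : ℝ) • (x * h.muᵀ))) ) * f (x + h.lam) := by
  refine weilRep_ae_eq hM ⟨1, h⟩ (K := 1) (c := 1) ?_ (fun x => (norm_cexp_pi_I _).le)
    (measurable_add_const h.lam) one_ne_zero ENNReal.one_ne_top ?_ (fun p y => ?_) f
  · refine Complex.continuous_exp.comp (continuous_const.mul (Complex.continuous_ofReal.comp ?_))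
    exact Continuous.matrix_trace (by fun_prop)
  · rw [one_smul, MeasureTheory.map_add_right_eq_self]
  · rw [jStar_one_mk, one_mk_smul, ← gaussFun_heisAct (isSymm_of_posDef hM), Complex.exp_neg,
      inv_inv]

theorem weilRep_trans (hM : M.PosDef) (a : GStar n) (b : Matrix (Fin n) (Fin n) ℝ)
    (ha : a.g.1 = fromBlocks 1 b 0 1) (f : L2 n m) :
    weilRep hM ⟨a, 1⟩ f =ᵐ[volume] fun x =>
      a.ε ^ m * Complex.exp (π * Complex.I * Matrix.trace (M * (x * b * xᵀ))) * f x := by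
  obtain ⟨hA, hB, hC, hD⟩ := blocks_of_eq ha
  refine weilRep_ae_eq hM ⟨a, 1⟩ (ψ := id) (K := 1) (c := 1) ?_ (fun x => ?_)
    measurable_id one_ne_zero ENNReal.one_ne_top ?_ (fun p y => ?_) f
  · refine continuous_const.mul (Complex.continuous_exp.comp
      (continuous_const.mul (Complex.continuous_ofReal.comp ?_)))
    exact Continuous.matrix_trace (by fun_prop)
  · rw [norm_mul, norm_cexp_pi_I, norm_pow, a.norm_ε]; simp
  · rw [Measure.map_id, one_smul]
  · have hden : denom a.g p.1.1 = 1 := by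
      rw [denom, hC, hD, toC_zero, toC_one, Matrix.zero_mul, zero_add]
    have hnum : numer a.g p.1.1 = p.1.1 + toC b := by
      rw [numer, hA, hB, toC_one, Matrix.one_mul]
    have e1 : (spAct a.g p).1.1 = p.1.1 + toC b := by
      change moeb a.g p.1.1 = _
      rw [moeb, hnum, hden, inv_one, Matrix.mul_one]
    have e2 : (spAct a.g p).2 = p.2 := by
      rw [spAct, hden, inv_one, Matrix.mul_one]
    have e3 : ((Matrix.trace (M * (y * b * yᵀ)) : ℝ) : ℂ)
        = Matrix.trace (toC M * (toC y * toC b * (toC y)ᵀ)) := by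
      rw [← trace_toC]
      simp only [toC_mul]; rfl
    have e4 : jStar M ⟨a, 1⟩ p = (a.ε ^ m)⁻¹ := by
      rw [jStar_mk_one, jHalf_of_C_eq_zero a hC, spExp, slope_of_C_eq_zero hC, hD]
      simp
    rw [e4, inv_inv, mk_one_smul, gaussFun, gaussFun, e1, e2, e3, mul_assoc (a.ε ^ m), ← Complex.exp_add,
      ← mul_add, ← Matrix.trace_add, ← Matrix.mul_add, id, Matrix.mul_add (toC y), Matrix.add_mul]
    congr 5
    abel

theorem weilRep_dil (hM : M.PosDef) (a : GStar n) (α : Matrix (Fin n) (Fin n) ℝ) (hα : IsUnit α)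
    (ha : a.g.1 = fromBlocks αᵀ 0 0 α⁻¹) (f : L2 n m) :
    weilRep hM ⟨a, 1⟩ f =ᵐ[volume] fun x =>
      a.ε ^ m * ((|α.det| ^ ((m : ℝ) / 2) : ℝ) : ℂ) * f (x * αᵀ) := by
  obtain ⟨hA, hB, hC, hD⟩ := blocks_of_eq ha
  have hd : IsUnit α.det := (Matrix.isUnit_iff_isUnit_det α).mp hα
  have hdet : LinearMap.det (mulRightLin m αᵀ) ≠ 0 := by
    rw [det_mulRightLin, Matrix.det_transpose]
    exact pow_ne_zero _ hd.ne_zero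
  refine weilRep_ae_eq hM ⟨a, 1⟩ (ψ := mulRightLin m αᵀ) continuous_const (fun x => le_rfl)
    ?_ ?_ ENNReal.ofReal_ne_top (map_linear_volume _ hdet) (fun p y => ?_) f
  · have : Continuous fun x : Matrix (Fin m) (Fin n) ℝ => x * αᵀ := by fun_prop
    exact this.measurable
  · rw [Ne, ENNReal.ofReal_eq_zero, not_le]
    exact abs_pos.mpr (inv_ne_zero hdet)
  · have hαu : IsUnit (toC α).det := by
      rw [det_toC]; exact isUnit_iff_ne_zero.mpr (by exact_mod_cast hd.ne_zero)
    have hinv : (toC α⁻¹)⁻¹ = toC α := by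
      refine Matrix.inv_eq_left_inv ?_
      rw [← toC_mul, Matrix.mul_nonsing_inv _ hd, toC_one]
    have hden : denom a.g p.1.1 = toC α⁻¹ := by
      rw [denom, hC, hD, toC_zero, Matrix.zero_mul, zero_add]
    have hnum : numer a.g p.1.1 = toC αᵀ * p.1.1 := by
      rw [numer, hA, hB, toC_zero, add_zero]
    have e1 : (spAct a.g p).1.1 = toC αᵀ * p.1.1 * toC α := by
      change moeb a.g p.1.1 = _
      rw [moeb, hnum, hden, hinv]
    have e2 : (spAct a.g p).2 = p.2 * toC α := by
      rw [spAct, hden, hinv]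
    have e4 : jStar M ⟨a, 1⟩ p = (a.ε ^ m)⁻¹ * ((|α.det| ^ ((m : ℝ) / 2) : ℝ) : ℂ)⁻¹ := by
      rw [jStar_mk_one, jHalf_of_C_eq_zero a hC, spExp, slope_of_C_eq_zero hC, hD,
        Matrix.det_nonsing_inv, Ring.inverse_eq_inv', abs_inv, Real.sqrt_inv, mul_pow, inv_pow,
        ← Complex.ofReal_pow, inv_pow, Real.sqrt_eq_rpow, ← Real.rpow_natCast,
        ← Real.rpow_mul (abs_nonneg _), one_div_mul_eq_div, Complex.ofReal_inv]
      simp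
    rw [e4, mul_inv, inv_inv, inv_inv, mk_one_smul, gaussFun, gaussFun, e1, e2]
    congr 5
    change _ = toC (y * αᵀ) * p.1.1 * (toC (y * αᵀ))ᵀ + (2 : ℂ) • (toC (y * αᵀ) * p.2ᵀ)
    simp only [toC_mul, Matrix.transpose_mul, toC_transpose, Matrix.transpose_transpose,
      Matrix.mul_assoc]

end Formulas

/-! ### The operator over `σ_n` and the Fourier transform -/

section FourierFormula

variable {n m : ℕ} {M : Matrix (Fin m) (Fin m) ℝ}

/-- Over `σ_n` the factor `J_{1/2}` is the holomorphic square root of `det (-i Ω)`, up to `ε`. -/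
theorem jHalf_of_inversion (a : GStar n) (ha : a.g.1 = fromBlocks 0 (-1) 1 0) (Ω : SiegelHalf n) :
    jHalf a Ω = a.ε⁻¹ * detSqrt n ((-Complex.I) • Ω.1) := by
  obtain ⟨-, -, hC, hD⟩ := blocks_of_eq ha
  have hden : ∀ Ω : SiegelHalf n, denom a.g Ω.1 = Ω.1 := fun Ω => by
    rw [denom, hC, hD, toC_zero, toC_one, Matrix.one_mul, add_zero]
  have hΩ : ∀ Ω : SiegelHalf n, Ω.1.det ≠ 0 := fun Ω => (isUnit_det_siegel Ω).ne_zero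
  have := preconnectedSpace_siegelHalf n
  have hb : (basePoint n).1.det = Complex.I ^ n := by
    simp [basePoint]
  have key := detSqrt_eq_of_continuous (X := SiegelHalf n) (S := fun Ω => (-Complex.I) • Ω.1)
    (φ := fun Ω => epsFactor a.g Ω (basePoint n) * (√‖(denom a.g Ω.1).det‖ : ℝ))
    (by fun_prop) neg_I_smul_mem ?_ ?_ (basePoint n) ?_ Ω
  · rw [← key, jHalf, mul_assoc]
  · have h1 : Continuous fun Ω : SiegelHalf n => epsFactor a.g Ω (basePoint n) := by
      have := Complex.continuous_conj.comp (continuous_epsFactor a.g (basePoint n))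
      refine this.congr fun Ω => ?_
      exact conj_epsFactor a.g (basePoint n) Ω
    exact h1.mul (Complex.continuous_ofReal.comp (continuous_denom a.g).matrix_det.norm.sqrt)
  · intro Ω
    have h1 : ((‖Ω.1.det‖ : ℝ) : ℂ) ≠ 0 :=
      Complex.ofReal_ne_zero.mpr (norm_ne_zero_iff.mpr (hΩ Ω))
    have hI : (Complex.I ^ n)⁻¹ = (-Complex.I) ^ n := by rw [← inv_pow, Complex.inv_I]
    rw [mul_pow, epsFactor_sq, ← Complex.ofReal_pow, Real.sq_sqrt (norm_nonneg _), alphaFactor,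
      alphaFactor, hden, hden, hb, Matrix.det_smul, Fintype.card_fin, norm_pow, Complex.norm_I,
      one_pow, Complex.ofReal_one, div_one, hI]
    field_simp
  · have h1 : (-Complex.I) • (basePoint n).1 = 1 := by
      simp [basePoint, smul_smul]
    simp only [h1, detSqrt_one, epsFactor_self, hden, hb]
    simp

/-- The Fourier transform on `ℝ^(m,n)` with respect to the bilinear form `σ(M y xᵗ)`. -/
noncomputable def traceFourier (M : Matrix (Fin m) (Fin m) ℝ) (f : Matrix (Fin m) (Fin n) ℝ → ℂ)
    (x : Matrix (Fin m) (Fin n) ℝ) : ℂ :=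
  ∫ y : Matrix (Fin m) (Fin n) ℝ,
    Complex.exp (-(2 * π * Complex.I * Matrix.trace (M * (y * xᵀ)))) * f y

theorem norm_trace_character (r : ℝ) : ‖cexp (-(2 * π * Complex.I * r))‖ = 1 := by
  have : (-(2 * π * Complex.I * r) : ℂ) = ((-(2 * π * r) : ℝ) : ℂ) * Complex.I := by
    push_cast; ring
  rw [this, Complex.norm_exp_ofReal_mul_I]

/-- The Gaussian integral at the point `(Ω, Z - x)`. -/
theorem traceFourier_gaussFun (hM : M.PosDef) (p : SiegelJacobi n m)
    (x : Matrix (Fin m) (Fin n) ℝ) :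
    traceFourier M (gaussFun M p) x = (((√M.det) ^ n)⁻¹ : ℝ)
      * (detSqrt n ((-Complex.I) • p.1.1) ^ m)⁻¹
      * cexp (-(π * Complex.I * Matrix.trace (toC M *
          ((p.2 - toC x) * p.1.1⁻¹ * (p.2 - toC x)ᵀ)))) := by
  rw [← integral_gaussFun hM, traceFourier]
  refine integral_congr_ae (Filter.Eventually.of_forall fun y => ?_)
  have h : ((Matrix.trace (M * (y * xᵀ)) : ℝ) : ℂ)
      = Matrix.trace (toC M * (toC y * (toC x)ᵀ)) := by
    rw [← trace_toC, toC_mul, toC_mul]; rfl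
  simp only [gaussFun, h]
  rw [← Complex.exp_add]
  congr 1
  simp only [Matrix.transpose_sub, Matrix.mul_add, Matrix.mul_sub, Matrix.trace_add,
    Matrix.trace_sub, Matrix.mul_smul, Matrix.trace_smul, smul_eq_mul]
  ring

/-- The operator over `σ_n` acts on the Gaussians as the normalized Fourier transform. -/
theorem weil_inversion_gaussFun (hM : M.PosDef) (a : GStar n)
    (ha : a.g.1 = fromBlocks 0 (-1) 1 0) (p : SiegelJacobi n m) (x : Matrix (Fin m) (Fin n) ℝ) :
    (jStar M ⟨a, 1⟩ p)⁻¹ * gaussFun M ((⟨a, 1⟩ : GStarJ n m) • p) x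
      = a.ε ^ m * ((M.det ^ ((n : ℝ) / 2) : ℝ) : ℂ) * traceFourier M (gaussFun M p) x := by
  obtain ⟨hA, hB, hC, hD⟩ := blocks_of_eq ha
  have hMs := isSymm_of_posDef hM
  have hden : denom a.g p.1.1 = p.1.1 := by
    rw [denom, hC, hD, toC_zero, toC_one, Matrix.one_mul, add_zero]
  have hnum : numer a.g p.1.1 = -1 := by
    have : toC (-1 : Matrix (Fin n) (Fin n) ℝ) = -1 := by
      rw [← zero_sub, toC_sub, toC_zero, toC_one, zero_sub]
    rw [numer, hA, hB, toC_zero, Matrix.zero_mul, zero_add, this]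
  have e1 : (spAct a.g p).1.1 = -p.1.1⁻¹ := by
    change moeb a.g p.1.1 = _
    rw [moeb, hnum, hden, Matrix.neg_mul, Matrix.one_mul]
  have e2 : (spAct a.g p).2 = p.2 * p.1.1⁻¹ := by rw [spAct, hden]
  have hs : (M.det ^ ((n : ℝ) / 2) : ℝ) = (√M.det) ^ n := by
    rw [Real.sqrt_eq_rpow, ← Real.rpow_natCast, ← Real.rpow_mul hM.det_pos.le, one_div_mul_eq_div]
  have hs0 : (((√M.det) ^ n : ℝ) : ℂ) ≠ 0 :=
    Complex.ofReal_ne_zero.mpr (pow_ne_zero _ (Real.sqrt_ne_zero'.mpr hM.det_pos))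
  have hΩ : (p.1.1⁻¹)ᵀ = p.1.1⁻¹ := by
    have : p.1.1ᵀ = p.1.1 := p.1.2.1
    rw [Matrix.transpose_nonsing_inv, this]
  have e3 : spExp a.g p = p.2 * p.1.1⁻¹ * p.2ᵀ := by
    rw [spExp, slope, hden, hC, toC_one, Matrix.mul_one]
  have e4 : Matrix.trace (toC M * ((p.2 - toC x) * p.1.1⁻¹ * (p.2 - toC x)ᵀ))
      = Matrix.trace (toC M * spExp a.g p)
        - Matrix.trace (toC M * (toC x * (spAct a.g p).1.1 * (toC x)ᵀ
          + (2 : ℂ) • (toC x * (spAct a.g p).2ᵀ))) := by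
    have : (p.2 - toC x) * p.1.1⁻¹ * (p.2 - toC x)ᵀ = spExp a.g p
        - (toC x * (spAct a.g p).1.1 * (toC x)ᵀ + (2 : ℂ) • (toC x * (spAct a.g p).2ᵀ))
        + (toC x * p.1.1⁻¹ * p.2ᵀ - (toC x * p.1.1⁻¹ * p.2ᵀ)ᵀ) := by
      rw [e1, e2, e3]
      simp only [Matrix.transpose_sub, Matrix.transpose_mul, Matrix.transpose_transpose, hΩ,
        Matrix.mul_sub, Matrix.sub_mul, Matrix.mul_neg, Matrix.neg_mul, two_smul, Matrix.mul_assoc]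
      abel
    rw [this]
    simp only [Matrix.mul_add, Matrix.mul_sub, Matrix.trace_add, Matrix.trace_sub,
      trace_mul_transpose_symm hMs]
    ring
  rw [traceFourier_gaussFun hM, e4, jStar_mk_one, jHalf_of_inversion a ha, mk_one_smul, gaussFun,
    hs, mul_sub, neg_sub, sub_eq_add_neg, Complex.exp_add, Complex.exp_neg, mul_pow, inv_pow,
    mul_inv, mul_inv, inv_inv, Complex.ofReal_inv]
  field_simp

theorem continuous_trace_character (M : Matrix (Fin m) (Fin m) ℝ) :
    Continuous fun z : Matrix (Fin m) (Fin n) ℝ × Matrix (Fin m) (Fin n) ℝ =>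
      cexp (-(2 * π * Complex.I * Matrix.trace (M * (z.2 * z.1ᵀ)))) := by
  refine Complex.continuous_exp.comp (continuous_const.mul
    (Complex.continuous_ofReal.comp ?_)).neg
  exact Continuous.matrix_trace (by fun_prop)

theorem continuous_traceFourier (M : Matrix (Fin m) (Fin m) ℝ)
    {f : Matrix (Fin m) (Fin n) ℝ → ℂ} (hf : Integrable f) : Continuous (traceFourier M f) := by
  have h1 : ∀ x : Matrix (Fin m) (Fin n) ℝ, Continuous fun y : Matrix (Fin m) (Fin n) ℝ =>
      cexp (-(2 * π * Complex.I * Matrix.trace (M * (y * xᵀ)))) := fun x => by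
    refine Complex.continuous_exp.comp (continuous_const.mul
      (Complex.continuous_ofReal.comp ?_)).neg
    exact Continuous.matrix_trace (by fun_prop)
  have h2 : ∀ y : Matrix (Fin m) (Fin n) ℝ, Continuous fun x : Matrix (Fin m) (Fin n) ℝ =>
      cexp (-(2 * π * Complex.I * Matrix.trace (M * (y * xᵀ)))) := fun y => by
    refine Complex.continuous_exp.comp (continuous_const.mul
      (Complex.continuous_ofReal.comp ?_)).neg
    exact Continuous.matrix_trace (by fun_prop)
  unfold traceFourier
  refine continuous_of_dominated (bound := fun y => ‖f y‖) (fun x => ?_)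
    (fun x => Filter.Eventually.of_forall fun y => ?_) hf.norm
    (Filter.Eventually.of_forall fun y => ?_)
  · exact (h1 x).aestronglyMeasurable.mul hf.1
  · rw [norm_mul, norm_trace_character, one_mul]
  · exact (h2 y).mul continuous_const

theorem norm_traceFourier_le (M : Matrix (Fin m) (Fin m) ℝ)
    (f : Matrix (Fin m) (Fin n) ℝ → ℂ) (x : Matrix (Fin m) (Fin n) ℝ) :
    ‖traceFourier M f x‖ ≤ ∫ y, ‖f y‖ := by
  refine (norm_integral_le_integral_norm _).trans (le_of_eq ?_)
  simp only [norm_mul, norm_trace_character, one_mul]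

/-- The multiplication formula for the Fourier transform. -/
theorem integral_traceFourier_mul (hM : M.IsSymm) {f g : Matrix (Fin m) (Fin n) ℝ → ℂ}
    (hf : Integrable f) (hg : Integrable g) :
    ∫ x, traceFourier M f x * g x = ∫ y, f y * traceFourier M g y := by
  have hint : Integrable (Function.uncurry fun x y : Matrix (Fin m) (Fin n) ℝ =>
      cexp (-(2 * π * Complex.I * Matrix.trace (M * (y * xᵀ)))) * f y * g x)
      (volume.prod volume) := by
    have h1 : Integrable (fun z : Matrix (Fin m) (Fin n) ℝ × Matrix (Fin m) (Fin n) ℝ =>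
        g z.1 * f z.2) (volume.prod volume) := hg.mul_prod hf
    have h2 := h1.bdd_mul (c := 1) (continuous_trace_character M).aestronglyMeasurable
      (Filter.Eventually.of_forall fun z => (norm_trace_character _).le)
    refine h2.congr (Filter.Eventually.of_forall fun z => ?_)
    simp only [Function.uncurry]
    ring
  have hsym : ∀ x y : Matrix (Fin m) (Fin n) ℝ,
      Matrix.trace (M * (y * xᵀ)) = Matrix.trace (M * (x * yᵀ)) := fun x y => by
    have hMt : Mᵀ = M := hM
    rw [← Matrix.trace_transpose, Matrix.transpose_mul, Matrix.transpose_mul,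
      Matrix.transpose_transpose, hMt, Matrix.trace_mul_comm]
  have h := integral_integral_swap hint
  simp only [traceFourier, ← integral_mul_const, ← integral_const_mul]
  rw [h]
  refine integral_congr_ae (Filter.Eventually.of_forall fun y =>
    integral_congr_ae (Filter.Eventually.of_forall fun x => ?_))
  simp only
  rw [hsym x y]
  ring

theorem memLp_conj_gaussFun (hM : M.PosDef) (p : SiegelJacobi n m) :
    MemLp (fun x => starRingEnd ℂ (gaussFun M p x)) 2 volume :=
  (memLp_gaussFun hM p).star

/-- The bilinear pairing with a Gaussian is a continuous functional on `L²`. -/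
theorem inner_conj_gaussFun (hM : M.PosDef) (p : SiegelJacobi n m) (f : L2 n m) :
    inner ℂ ((memLp_conj_gaussFun hM p).toLp _) f = ∫ x, f x * gaussFun M p x := by
  rw [L2.inner_def]
  refine integral_congr_ae ?_
  filter_upwards [(memLp_conj_gaussFun hM p).coeFn_toLp] with x hx
  rw [hx, RCLike.inner_apply, RCLike.conj_conj]

/-- The operator over `σ_n` is symmetric for the bilinear pairing `∫ f g`. Both sides are
continuous in `f`, and for Gaussian `f` this is the multiplication formula. -/
theorem integral_weilRep_inversion_mul (hM : M.PosDef) (a : GStar n)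
    (ha : a.g.1 = fromBlocks 0 (-1) 1 0) (p : SiegelJacobi n m) (f : L2 n m) :
    ∫ x, weilRep hM ⟨a, 1⟩ f x * gaussFun M p x
      = ∫ x, f x * (a.ε ^ m * ((M.det ^ ((n : ℝ) / 2) : ℝ) : ℂ)
        * traceFourier M (gaussFun M p) x) := by
  set c : ℂ := a.ε ^ m * ((M.det ^ ((n : ℝ) / 2) : ℝ) : ℂ) with hc
  let y : GStarJ n m := ⟨a, 1⟩
  have key := eq_of_eqOn_covMap hM
    (S := (innerSL ℂ ((memLp_conj_gaussFun hM p).toLp _)).comp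
      ((weilRep hM y).toContinuousLinearEquiv : L2 n m →L[ℂ] L2 n m))
    (T := (jStar M y p)⁻¹ • innerSL ℂ ((memLp_conj_gaussFun hM (y • p)).toLp _)) fun q => by
      change inner ℂ _ (weilRep hM y (covMap hM q)) = (jStar M y p)⁻¹ • inner ℂ _ (covMap hM q)
      rw [inner_conj_gaussFun hM p, inner_conj_gaussFun hM (y • p), smul_eq_mul, ← integral_const_mul]
      have h1 := integral_traceFourier_mul (isSymm_of_posDef hM) (integrable_gaussFun hM q)
        (integrable_gaussFun hM p)
      have h2 := congrArg (fun z => c * z) h1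
      simp only [← integral_const_mul] at h2
      refine Eq.trans ?_ (h2.trans ?_)
      · refine integral_congr_ae ?_
        filter_upwards [weilRep_covMap_ae hM y q] with x hx
        rw [hx, weil_inversion_gaussFun hM a ha q x, mul_assoc]
      · refine integral_congr_ae ?_
        filter_upwards [covMap_coeFn hM q] with x hx
        rw [hx, mul_left_comm, ← weil_inversion_gaussFun hM a ha p x]
        ring
  have h3 := congrArg (fun T : L2 n m →L[ℂ] ℂ => T f) key
  change inner ℂ _ (weilRep hM y f) = (jStar M y p)⁻¹ • inner ℂ _ f at h3
  rw [inner_conj_gaussFun hM p, inner_conj_gaussFun hM (y • p), smul_eq_mul, ← integral_const_mul] at h3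
  rw [h3]
  refine integral_congr_ae (Filter.Eventually.of_forall fun x => ?_)
  simp only
  rw [← weil_inversion_gaussFun hM a ha p x]
  ring

/-- For integrable `f` both sides have the same bilinear pairing with every Gaussian. The Gaussians
at `(i I_n, Z)` with `Z` real are a fixed nowhere vanishing function times the characters, so
Fourier uniqueness applies to the difference. -/
theorem weilRep_fourier (hM : M.PosDef) (a : GStar n) (ha : a.g.1 = fromBlocks 0 (-1) 1 0)
    (f : L2 n m) (hf : Integrable f volume) :
    weilRep hM ⟨a, 1⟩ f =ᵐ[volume] fun x =>
      a.ε ^ m * ((M.det ^ ((n : ℝ) / 2) : ℝ) : ℂ) * traceFourier M f x := by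
  set c : ℂ := a.ε ^ m * ((M.det ^ ((n : ℝ) / 2) : ℝ) : ℂ) with hc
  have hT : ∀ p : SiegelJacobi n m, Integrable fun x => c * traceFourier M f x * gaussFun M p x :=
    fun p => by
      refine (integrable_gaussFun hM p).bdd_mul (c := ‖c‖ * ∫ y, ‖f y‖)
        (continuous_const.mul (continuous_traceFourier M hf)).aestronglyMeasurable
        (Filter.Eventually.of_forall fun x => ?_)
      rw [norm_mul]
      exact mul_le_mul_of_nonneg_left (norm_traceFourier_le M f x) (norm_nonneg _)
  have hU : ∀ p : SiegelJacobi n m,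
      Integrable fun x => weilRep hM ⟨a, 1⟩ f x * gaussFun M p x := fun p =>
    (Lp.memLp _).integrable_mul (memLp_gaussFun hM p)
  have h0 : ∀ p : SiegelJacobi n m,
      ∫ x, (weilRep hM ⟨a, 1⟩ f x - c * traceFourier M f x) * gaussFun M p x = 0 := by
    intro p
    simp only [sub_mul]
    rw [integral_sub (hU p) (hT p), integral_weilRep_inversion_mul hM a ha p f, sub_eq_zero]
    have h1 := congrArg (fun z => c * z) (integral_traceFourier_mul (isSymm_of_posDef hM) hf
      (integrable_gaussFun hM p))
    simp only [← integral_const_mul] at h1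
    simp only [mul_assoc c]
    rw [h1]
    refine integral_congr_ae (Filter.Eventually.of_forall fun x => ?_)
    simp only
    ring
  have hu : Integrable fun x =>
      (weilRep hM ⟨a, 1⟩ f x - c * traceFourier M f x) * gaussFun M (basePoint n, 0) x := by
    simp only [sub_mul]
    exact (hU _).sub (hT _)
  have h2 := ae_eq_zero_of_trace_fourier hM hu fun Z => by
    rw [← h0 (basePoint n, toC Z)]
    refine integral_congr_ae (Filter.Eventually.of_forall fun x => ?_)
    simp only [gaussFun_toC]
    ring
  filter_upwards [h2] with x hx
  have h3 : gaussFun M (basePoint n, 0) x ≠ 0 := Complex.exp_ne_zero _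
  exact sub_eq_zero.mp ((mul_eq_zero.mp hx).resolve_right h3)

theorem isSchrodingerWeil_weilRep (hM : M.PosDef) :
    IsSchrodingerWeil M (weilRep (n := n) hM) where
  heis := weilRep_heis hM
  trans a b _ ha f := weilRep_trans hM a b ha f
  dil := weilRep_dil hM
  fourier := weilRep_fourier hM

end FourierFormula

/-! ### Generation of the symplectic group and uniqueness -/

section Generation

variable {n : ℕ}

/-- On the line `t ↦ t I`, the polynomial `det (t C + D)` does not vanish identically, since it is
nonzero at `t = i`. -/
theorem exists_real_det_ne_zero (g : Sp n) : ∃ t : ℝ, (t • g.C + g.D).det ≠ 0 := by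
  by_contra! h
  let Q : Matrix (Fin n) (Fin n) (Polynomial ℂ) := Matrix.of fun i j =>
    Polynomial.X * Polynomial.C (toC g.C i j) + Polynomial.C (toC g.D i j)
  have hev : ∀ z : ℂ, Polynomial.eval z Q.det = (z • toC g.C + toC g.D).det := fun z => by
    rw [← Polynomial.coe_evalRingHom, RingHom.map_det]
    congr 1
    ext i j
    simp [Q, mul_comm z]
  have h0 : Q.det = 0 := by
    refine Polynomial.eq_zero_of_infinite_isRoot _
      ((Set.infinite_range_of_injective Complex.ofReal_injective).mono ?_)
    rintro _ ⟨t, rfl⟩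
    have h1 : (t : ℂ) • toC g.C + toC g.D = toC (t • g.C + g.D) := by
      ext i j; simp [toC]
    change Polynomial.eval (t : ℂ) Q.det = 0
    rw [hev, h1, det_toC, h t, Complex.ofReal_zero]
  have h2 := denom_det_ne_zero g (basePoint n)
  have h3 : denom g (basePoint n).1 = Complex.I • toC g.C + toC g.D := by
    simp [denom, basePoint]
  rw [h3, ← hev, h0, Polynomial.eval_zero] at h2
  exact h2 rfl

theorem sp_rel_real (g : Sp n) :
    g.Aᵀ * g.C = g.Cᵀ * g.A ∧ g.Aᵀ * g.D - g.Cᵀ * g.B = 1 ∧ g.C * g.Dᵀ = g.D * g.Cᵀ := by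
  have h := g.2
  have h' := SymplecticGroup.transpose_mem g.2
  rw [sp_eq g] at h h'
  rw [fromBlocks_transpose] at h'
  obtain ⟨h1, -, h2⟩ := SymplecticGroup.fromBlocks_mem_iff.mp h
  exact ⟨h1, h2, (SymplecticGroup.fromBlocks_mem_iff.mp h').2.1⟩

/-- The element `t(b) = (1, b; 0, 1)` of `Sp n`. -/
def spTrans (b : Matrix (Fin n) (Fin n) ℝ) (hb : b.IsSymm) : Sp n :=
  ⟨fromBlocks 1 b 0 1, SymplecticGroup.fromBlocks_mem_iff.mpr
    ⟨by simp, by simpa using hb.eq, by simp⟩⟩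

/-- The element `g(α) = (αᵀ, 0; 0, α⁻¹)` of `Sp n`. -/
noncomputable def spDil (α : Matrix (Fin n) (Fin n) ℝ) (hα : IsUnit α.det) : Sp n :=
  ⟨fromBlocks αᵀ 0 0 α⁻¹, SymplecticGroup.fromBlocks_mem_iff.mpr
    ⟨by simp, by simp, by simp [Matrix.mul_nonsing_inv _ hα]⟩⟩

/-- The element `σ_n = (0, -1; 1, 0)` of `Sp n`. -/
def spInv (n : ℕ) : Sp n :=
  ⟨fromBlocks 0 (-1) 1 0, SymplecticGroup.J_mem (Fin n) ℝ⟩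

/-- The elements of `Sp n` whose block `C` is invertible form the big Bruhat cell
`t(b) g(α) σ_n t(b')`. -/
theorem exists_bruhat (g : Sp n) (hC : IsUnit g.C.det) :
    ∃ (b b' α : Matrix (Fin n) (Fin n) ℝ) (hb : b.IsSymm) (hb' : b'.IsSymm) (hα : IsUnit α.det),
      g = spTrans b hb * spDil α hα * spInv n * spTrans b' hb' := by
  obtain ⟨h1, h2, h3⟩ := sp_rel_real g
  have hCt : IsUnit (g.Cᵀ).det := by rwa [Matrix.det_transpose]
  refine ⟨g.A * g.C⁻¹, g.C⁻¹ * g.D, g.C⁻¹, ?_, ?_, (Matrix.isUnit_nonsing_inv_det_iff).mpr hC, ?_⟩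
  · rw [Matrix.IsSymm, Matrix.transpose_mul, Matrix.transpose_nonsing_inv]
    calc (g.Cᵀ)⁻¹ * g.Aᵀ = (g.Cᵀ)⁻¹ * (g.Aᵀ * g.C) * g.C⁻¹ := by
          rw [← Matrix.mul_assoc, Matrix.mul_assoc, Matrix.mul_nonsing_inv _ hC, Matrix.mul_one]
      _ = g.A * g.C⁻¹ := by
          rw [h1, ← Matrix.mul_assoc, Matrix.nonsing_inv_mul _ hCt, Matrix.one_mul]
  · rw [Matrix.IsSymm, Matrix.transpose_mul, Matrix.transpose_nonsing_inv]
    calc g.Dᵀ * (g.Cᵀ)⁻¹ = g.C⁻¹ * (g.C * g.Dᵀ) * (g.Cᵀ)⁻¹ := by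
          rw [← Matrix.mul_assoc, Matrix.nonsing_inv_mul _ hC, Matrix.one_mul]
      _ = g.C⁻¹ * g.D := by
          rw [h3, ← Matrix.mul_assoc, Matrix.mul_assoc, Matrix.mul_nonsing_inv _ hCt,
            Matrix.mul_one]
  · have e1 : g.A * g.C⁻¹ * g.C = g.A := by
      rw [Matrix.mul_assoc, Matrix.nonsing_inv_mul _ hC, Matrix.mul_one]
    have e2 : g.A * (g.C⁻¹ * g.D) + -(g.C⁻¹)ᵀ = g.B := by
      have h4 : g.Cᵀ * g.B = g.Aᵀ * g.D - 1 := by rw [← h2]; abel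
      have h5 : g.A * g.C⁻¹ = (g.Cᵀ)⁻¹ * g.Aᵀ := by
        calc g.A * g.C⁻¹ = (g.Cᵀ)⁻¹ * (g.Cᵀ * g.A) * g.C⁻¹ := by
              rw [← Matrix.mul_assoc, Matrix.nonsing_inv_mul _ hCt, Matrix.one_mul]
          _ = (g.Cᵀ)⁻¹ * g.Aᵀ := by
              rw [← h1, ← Matrix.mul_assoc, Matrix.mul_assoc, Matrix.mul_nonsing_inv _ hC,
                Matrix.mul_one]
      have h6 : g.B = (g.Cᵀ)⁻¹ * (g.Cᵀ * g.B) := by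
        rw [← Matrix.mul_assoc, Matrix.nonsing_inv_mul _ hCt, Matrix.one_mul]
      rw [h6, h4, ← Matrix.mul_assoc, h5, Matrix.mul_sub, Matrix.mul_one,
        Matrix.transpose_nonsing_inv, Matrix.mul_assoc]
      abel
    have e3 : g.C * (g.C⁻¹ * g.D) = g.D := by
      rw [← Matrix.mul_assoc, Matrix.mul_nonsing_inv _ hC, Matrix.one_mul]
    refine Subtype.ext ?_
    change g.1 = fromBlocks 1 _ 0 1 * fromBlocks _ 0 0 _ * fromBlocks 0 (-1) 1 0
      * fromBlocks 1 _ 0 1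
    rw [sp_eq g]
    simp only [fromBlocks_multiply, Matrix.mul_zero, Matrix.zero_mul, Matrix.mul_one,
      Matrix.one_mul, zero_add, add_zero, Matrix.mul_neg, neg_zero,
      Matrix.nonsing_inv_nonsing_inv _ hC, e1, e2, e3]

/-- `Sp n` is generated by the elements `t(b)`, `g(α)` and `σ_n`: every `g` is moved into the big
cell by right multiplication with some `t(t I) σ_n`. -/
theorem sp_subgroup_eq_top (L : Subgroup (Sp n)) (ht : ∀ b hb, spTrans b hb ∈ L)
    (hd : ∀ α hα, spDil α hα ∈ L) (hs : spInv n ∈ L) : L = ⊤ := by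
  refine (Subgroup.eq_top_iff' L).mpr fun g => ?_
  obtain ⟨t, ht0⟩ := exists_real_det_ne_zero g
  have hsymm : (t • (1 : Matrix (Fin n) (Fin n) ℝ)).IsSymm := by simp [Matrix.IsSymm]
  let k : Sp n := g * (spTrans _ hsymm * spInv n)
  have hk : k.C = t • g.C + g.D := by
    have h1 : k.1 = g.1 * (fromBlocks 1 (t • 1) 0 1 * fromBlocks 0 (-1) 1 0) := rfl
    rw [sp_eq g, fromBlocks_multiply, fromBlocks_multiply] at h1
    rw [(blocks_of_eq h1).2.2.1]
    simp
  obtain ⟨b, b', α, hb, hb', hα, h⟩ := exists_bruhat k (isUnit_iff_ne_zero.mpr (by rwa [hk]))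
  have hkL : k ∈ L := by
    rw [h]
    exact L.mul_mem (L.mul_mem (L.mul_mem (ht _ _) (hd _ _)) hs) (ht _ _)
  exact (L.mul_mem_cancel_right (L.mul_mem (ht _ _) hs)).mp hkL

/-- The map `G_* → Sp n` is surjective. -/
theorem exists_gStar (g : Sp n) : ∃ a : GStar n, a.g = g := by
  obtain ⟨z, hz⟩ := IsAlgClosed.exists_pow_nat_eq (alphaFactor (basePoint n) g)⁻¹ two_pos
  exact ⟨⟨g, z, hz⟩, rfl⟩

/-- The projection `G_* → Sp n`. -/
def GStar.proj (n : ℕ) : GStar n →* Sp n where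
  toFun a := a.g
  map_one' := rfl
  map_mul' _ _ := rfl

/-- A subgroup of `G_*` containing every element over `t(b)`, `g(α)` and `σ_n` is everything; the
kernel of `G_* → Sp n` is covered by the elements over `t(0)`. -/
theorem gStar_subgroup_eq_top (K : Subgroup (GStar n))
    (ht : ∀ (a : GStar n) (b : Matrix (Fin n) (Fin n) ℝ), b.IsSymm →
      a.g.1 = fromBlocks 1 b 0 1 → a ∈ K)
    (hd : ∀ (a : GStar n) (α : Matrix (Fin n) (Fin n) ℝ), IsUnit α →
      a.g.1 = fromBlocks αᵀ 0 0 α⁻¹ → a ∈ K)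
    (hs : ∀ a : GStar n, a.g.1 = fromBlocks 0 (-1) 1 0 → a ∈ K) : K = ⊤ := by
  have hmap : K.map (GStar.proj n) = ⊤ := by
    refine sp_subgroup_eq_top _ (fun b hb => ?_) (fun α hα => ?_) ?_
    · obtain ⟨a, ha⟩ := exists_gStar (spTrans b hb)
      exact ⟨a, ht a b hb (by rw [ha]; rfl), ha⟩
    · obtain ⟨a, ha⟩ := exists_gStar (spDil α hα)
      exact ⟨a, hd a α ((Matrix.isUnit_iff_isUnit_det α).mpr hα) (by rw [ha]; rfl), ha⟩
    · obtain ⟨a, ha⟩ := exists_gStar (spInv n)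
      exact ⟨a, hs a (by rw [ha]; rfl), ha⟩
  refine (Subgroup.eq_top_iff' K).mpr fun a => ?_
  obtain ⟨k, hk, hka⟩ : a.g ∈ K.map (GStar.proj n) := hmap ▸ Subgroup.mem_top _
  have h1 : k⁻¹ * a ∈ K := by
    refine ht _ 0 (by simp [Matrix.IsSymm]) ?_
    have h2 : (k⁻¹ * a).g = 1 := by
      change k.g⁻¹ * a.g = 1
      rw [← hka]
      exact inv_mul_cancel k.g
    rw [h2, fromBlocks_one]
    rfl
  exact (K.mul_mem_cancel_left (K.inv_mem hk)).mp h1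

end Generation

section Uniqueness

variable {n m : ℕ} {M : Matrix (Fin m) (Fin m) ℝ}

/-- The inclusion `G_* → G_*^J`. -/
def GStarJ.ofGStar (n m : ℕ) : GStar n →* GStarJ n m where
  toFun a := ⟨a, 1⟩
  map_one' := rfl
  map_mul' a b := by
    refine GStarJ.ext rfl ?_
    change (1 : Heis n m) = (1 : Heis n m).act b.g * 1
    rw [Heis.one_act, mul_one]

theorem gStarJ_eq_mul (x : GStarJ n m) : x = ⟨x.a, 1⟩ * ⟨1, x.h⟩ := by
  refine GStarJ.ext (mul_one x.a).symm ?_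
  change x.h = (1 : Heis n m).act 1 * x.h
  rw [Heis.act_one, one_mul]

theorem integrable_covMap (hM : M.PosDef) (p : SiegelJacobi n m) :
    Integrable (covMap hM p) volume :=
  (integrable_gaussFun hM p).congr (covMap_coeFn hM p).symm

/-- The properties in `IsSchrodingerWeil` determine the homomorphism. -/
theorem isSchrodingerWeil_unique (hM : M.PosDef) {ω ω' : GStarJ n m →* (L2 n m ≃ₗᵢ[ℂ] L2 n m)}
    (h : IsSchrodingerWeil M ω) (h' : IsSchrodingerWeil M ω') : ω' = ω := by
  have hK : ((ω'.comp (GStarJ.ofGStar n m)).eqLocus (ω.comp (GStarJ.ofGStar n m))) = ⊤ := by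
    refine gStar_subgroup_eq_top _ (fun a b hb ha => ?_) (fun a α hα ha => ?_) fun a ha => ?_
    · change ω' ⟨a, 1⟩ = ω ⟨a, 1⟩
      ext1 f
      exact Lp.ext ((h'.trans a b hb ha f).trans (h.trans a b hb ha f).symm)
    · change ω' ⟨a, 1⟩ = ω ⟨a, 1⟩
      ext1 f
      exact Lp.ext ((h'.dil a α hα ha f).trans (h.dil a α hα ha f).symm)
    · change ω' ⟨a, 1⟩ = ω ⟨a, 1⟩
      -- The integral formula is available on the Gaussians, which are integrable.
      refine linearIsometryEquiv_ext_covMap hM fun p => ?_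
      have hp := integrable_covMap hM p
      exact Lp.ext ((h'.fourier a ha _ hp).trans (h.fourier a ha _ hp).symm)
  ext1 x
  have h1 : ω' ⟨x.a, 1⟩ = ω ⟨x.a, 1⟩ := by
    have : x.a ∈ ((ω'.comp (GStarJ.ofGStar n m)).eqLocus (ω.comp (GStarJ.ofGStar n m))) :=
      hK ▸ Subgroup.mem_top x.a
    exact this
  have h2 : ω' ⟨1, x.h⟩ = ω ⟨1, x.h⟩ := by
    ext1 f
    exact Lp.ext ((h'.heis x.h f).trans (h.heis x.h f).symm)
  rw [gStarJ_eq_mul x, map_mul, map_mul, h1, h2]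

end Uniqueness

end JacobiWeil

open JacobiWeil

theorem theorem7p1 (n m : ℕ) (hn : 0 < n) (hm : Odd m) (M : Matrix (Fin m) (Fin m) ℤ)
    (hM : (M.map (Int.cast : ℤ → ℝ)).PosDef) :
    ∃ ω : GStarJ n m →* (L2 n m ≃ₗᵢ[ℂ] L2 n m),
      IsSchrodingerWeil (M.map (Int.cast : ℤ → ℝ)) ω ∧
      (∀ ω', IsSchrodingerWeil (M.map (Int.cast : ℤ → ℝ)) ω' → ω' = ω) ∧
      ∀ (x : GStarJ n m) (p : SiegelJacobi n m),
        ω x (covMap hM p) = (jStar (M.map (Int.cast : ℤ → ℝ)) x p)⁻¹ • covMap hM (x • p) :=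
  ⟨weilRep hM, isSchrodingerWeil_weilRep hM,
    fun _ h' => isSchrodingerWeil_unique hM (isSchrodingerWeil_weilRep hM) h',
    weilRep_covMap hM⟩
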